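/- **The operad $\mathsf{PaPB}$.** $\mathsf{PaPB}$ is the following (symmetric) operad in groupoids with two colors, $\mathfrak c$ ("closed") and $\mathfrak o$ ("open"). Its objects are the operations of the free two-colored operad on three generators $\mu_{\mathfrak c} : (\mathfrak c, \mathfrak c) \to \mathfrak c$, $f : \mathfrak c \to \mathfrak o$, $\mu_{\mathfrak o} : (\mathfrak o, \mathfrak o) \to \mathfrak o$; there are no nullary operations. Such an operation $u$ has an underlying sequence $\omega(u)$ of labelled points of color $\mathfrak c$ ("aerial") or $\mathfrak o$ ("terrestrial"), namely its inputs read from left to right. A morphism $u \to v$ in $\mathsf{PaPB}$ is an isotopy class of braids from $\omega(u)$ to $\omega(v)$, respecting the labels, that can be drawn so that a terrestrial strand never passes behind another strand (aerial or terrestrial). Composition of morphisms is concatenation of braids. Operadic composition is substitution on objects and, on morphisms, insertion of braids in tubular neighbourhoods of the strands. Consider in $\mathsf{PaPB}$ the associators $\alpha_{\mathfrak c} : \mu_{\mathfrak c}(\mu_{\mathfrak c}(x_1,x_2),x_3) \to \mu_{\mathfrak c}(x_1,\mu_{\mathfrak c}(x_2,x_3))$ and $\alpha_{\mathfrak o}$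 (similarly) and $p : \mu_{\mathfrak o}(f(x_1), f(x_2)) \to f(\mu_{\mathfrak c}(x_1,x_2))$, all three given by trivial braids, and $\tau : \mu_{\mathfrak c}(x_1,x_2) \to \mu_{\mathfrak c}(x_2,x_1)$ and $\psi : \mu_{\mathfrak o}(f(x_1), y_1) \to \mu_{\mathfrak o}(y_1, f(x_1))$, given by one crossing in which the strand $x_1$ passes behind the other strand. An *algebra* over $\mathsf{PaPB}$ (in categories) on a pair of categories $(\mathcal M, \mathcal N)$ is a morphism of two-colored operads in categories from $\mathsf{PaPB}$ to the endomorphism operad $\mathrm{End}_{(\mathcal M, \mathcal N)}$, where $\mathcal M$ has color $\mathfrak c$ and $\mathcal N$ has color $\mathfrak o$; the operations of the endomorphism operad are the functors $\prod_i \mathcal C_{\kappa(i)} \to \mathcal C_d$ with $\mathcal C_{\mathfrak c} = \mathcal M$, $\mathcal C_{\mathfrak o} = \mathcal N$, and its morphisms are the natural transformations. **The Drinfeld center.** For a non-unital monoidal category $\mathcal N$, the objects of the Drinfeld center $\mathcal Z(\mathcal N)$ are the pairs $(X, \Psi)$ of an object $X$ and a half-braiding on it, i.e. a natural isomorphism $\Psi_Y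 : X \otimes Y \to Y \otimes X$ such that, with $\alpha$ the associator, $\alpha \circ \Psi_{Y \otimes Z} \circ \alpha = (1 \otimes \Psi_Z) \circ \alpha \circ (\Psi_Y \otimes 1)$ for all $Y, Z$. Its morphisms $(X,\Psi) \to (X',\Psi')$ are the morphisms $g : X \to X'$ with $\Psi'_Z \circ (g \otimes 1) = (1 \otimes g) \circ \Psi_Z$ for all $Z$. The tensor product $(X,\Psi) \otimes (X',\Psi')$ is $X \otimes X'$ with the half-braiding $\alpha \circ (\Psi_Y \otimes 1) \circ \alpha^{-1} \circ (1 \otimes \Psi'_Y) \circ \alpha$. The associator is that of $\mathcal N$, and the braiding $(X,\Psi) \otimes (X', \Psi') \to (X',\Psi') \otimes (X,\Psi)$ is $\Psi_{X'}$. **Statement.** Let $\mathcal M$ and $\mathcal N$ be categories. There is a bijection between the algebras over $\mathsf{PaPB}$ on $(\mathcal M, \mathcal N)$ and the triples consisting of - a non-unital monoidal structure on $\mathcal N$, - a non-unital braided monoidal structure on $\mathcal M$, - a strong (non-unital) braided monoidal functor $F : \mathcal M \to \mathcal Z(\mathcal N)$. An algebra $\theta$ corresponds to a triple precisely when $\theta(\mu_{\mathfrak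 c})$ and $\theta(\mu_{\mathfrak o})$ are the tensor products of $\mathcal M$ and $\mathcal N$, $\theta(\alpha_{\mathfrak c})$ and $\theta(\alpha_{\mathfrak o})$ are their associators, $\theta(\tau)$ is the braiding of $\mathcal M$, $\theta(f)$ is the composite of $F$ with the forgetful functor $\mathcal Z(\mathcal N) \to \mathcal N$, $\theta(p)$ is the structure isomorphism $F(x_1) \otimes F(x_2) \cong F(x_1 \otimes x_2)$ of $F$, and $\theta(\psi)$ is the half-braiding $F(x_1) \otimes y_1 \cong y_1 \otimes F(x_1)$ of $F(x_1)$. -/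

import Mathlib

open CategoryTheory

universe v u w w'

/-- Artin's braid relations, as relators on the generators `σ₀, σ₁, σ₂, …`. -/
def artinRels : Set (FreeGroup ℕ) :=
  {r | (∃ i j : ℕ, i + 2 ≤ j ∧ r = FreeGroup.of i * FreeGroup.of j *
          (FreeGroup.of j * FreeGroup.of i)⁻¹) ∨
       (∃ i : ℕ, r = FreeGroup.of i * FreeGroup.of (i + 1) * FreeGroup.of i *
          (FreeGroup.of (i + 1) * FreeGroup.of i * FreeGroup.of (i + 1))⁻¹)}

/-- The braid group on the strands `0, 1, 2, …`, of which only finitely many move (Artin's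
presentation), that is, the union of the braid groups on `n` strands.  The braid group on `n`
strands is realized as its subgroup `Braid.bounded n` generated by the `σᵢ` with `i + 1 < n`.
A product `b * b'` is the braid `b` followed by the braid `b'`. -/
abbrev Braid : Type := PresentedGroup artinRels

namespace Braid

/-- The elementary braid in which the strand at position `i` moves one step to the right,
passing *behind* the strand at position `i + 1`, which moves one step to the left. -/
def σ (i : ℕ) : Braid := PresentedGroup.of i

theorem far {i j : ℕ} (h : i + 2 ≤ j) : σ i * σ j = σ j * σ i := by
  have := PresentedGroup.mk_eq_one_iff (rels := artinRels)
    (x := FreeGroup.of i * FreeGroup.of j * (FreeGroup.of j * FreeGroup.of i)⁻¹)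
  have h2 := this.2 (Subgroup.subset_normalClosure (Or.inl ⟨i, j, h, rfl⟩))
  rw [map_mul, map_inv, mul_inv_eq_one, map_mul, map_mul] at h2
  exact h2

theorem yb (i : ℕ) : σ i * σ (i + 1) * σ i = σ (i + 1) * σ i * σ (i + 1) := by
  have := PresentedGroup.mk_eq_one_iff (rels := artinRels)
    (x := FreeGroup.of i * FreeGroup.of (i + 1) * FreeGroup.of i *
          (FreeGroup.of (i + 1) * FreeGroup.of i * FreeGroup.of (i + 1))⁻¹)
  have h2 := this.2 (Subgroup.subset_normalClosure (Or.inr ⟨i, rfl⟩))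
  rw [map_mul, map_inv, mul_inv_eq_one, map_mul, map_mul, map_mul, map_mul] at h2
  exact h2

/-- The homomorphism out of `Braid` given by images of the generators. -/
def lift {G : Type*} [Group G] (s : ℕ → G) (hf : ∀ i j, i + 2 ≤ j → s i * s j = s j * s i)
    (hy : ∀ i, s i * s (i + 1) * s i = s (i + 1) * s i * s (i + 1)) : Braid →* G :=
  PresentedGroup.toGroup (f := s) (by
    rintro r (⟨i, j, h, rfl⟩ | ⟨i, rfl⟩)
    · simp [hf i j h]
    · simp [hy i])

theorem lift_σ {G : Type*} [Group G] (s : ℕ → G) (hf) (hy) (i : ℕ) :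
    lift s hf hy (σ i) = s i := PresentedGroup.toGroup.of _

/-- Adding `n` straight strands on the left. -/
def shift (n : ℕ) : Braid →* Braid :=
  lift (fun i => σ (n + i)) (fun i j h => far (by omega)) (fun i => yb (n + i))

theorem shift_σ (n i : ℕ) : shift n (σ i) = σ (n + i) := lift_σ _ _ _ _

theorem hom_ext {G : Type*} [Group G] {f g : Braid →* G} (h : ∀ i, f (σ i) = g (σ i)) : f = g :=
  PresentedGroup.ext h

theorem shift_shift (m n : ℕ) (b : Braid) : shift m (shift n b) = shift (m + n) b := by
  have : (shift m).comp (shift n) = shift (m + n) := hom_ext fun i => by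
    simp [shift_σ, add_assoc]
  exact DFunLike.congr_fun this b

theorem shift_zero (b : Braid) : shift 0 b = b := by
  have : shift 0 = MonoidHom.id _ := hom_ext fun i => by simp [shift_σ]
  exact DFunLike.congr_fun this b

/-- The subgroup of braids on the first `n` strands. -/
def bounded (n : ℕ) : Subgroup Braid := Subgroup.closure {b | ∃ i, i + 1 < n ∧ b = σ i}

theorem σ_mem {i n : ℕ} (h : i + 1 < n) : σ i ∈ bounded n := Subgroup.subset_closure ⟨i, h, rfl⟩

theorem bounded_mono {m n : ℕ} (h : m ≤ n) : bounded m ≤ bounded n :=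
  Subgroup.closure_mono fun _ ⟨i, hi, e⟩ => ⟨i, by omega, e⟩

theorem shift_mem {m n : ℕ} {b : Braid} (h : b ∈ bounded n) : shift m b ∈ bounded (m + n) := by
  induction h using Subgroup.closure_induction with
  | mem x hx => obtain ⟨i, hi, rfl⟩ := hx; rw [shift_σ]; exact σ_mem (by omega)
  | one => rw [map_one]; exact one_mem _
  | mul x y _ _ hx hy => rw [map_mul]; exact mul_mem hx hy
  | inv x _ hx => rw [map_inv]; exact inv_mem hx

theorem gen_induction {p : Braid → Prop} (hσ : ∀ i, p (σ i)) (h1 : p 1)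
    (hm : ∀ x y, p x → p y → p (x * y)) (hi : ∀ x, p x → p x⁻¹) (b : Braid) : p b := by
  have hb : b ∈ Subgroup.closure (Set.range (PresentedGroup.of (rels := artinRels))) := by
    rw [PresentedGroup.closure_range_of]; trivial
  induction hb using Subgroup.closure_induction with
  | mem x hx => obtain ⟨i, rfl⟩ := hx; exact hσ i
  | one => exact h1
  | mul x y _ _ hx hy => exact hm x y hx hy
  | inv x _ hx => exact hi x hx

theorem commute_shift {n : ℕ} {a : Braid} (h : a ∈ bounded n) (b : Braid) :
    Commute a (shift n b) := by
  induction h using Subgroup.closure_induction with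
  | mem x hx =>
    obtain ⟨i, hi, rfl⟩ := hx
    refine gen_induction (p := fun b => Commute (σ i) (shift n b)) (fun j => ?_) (by simp)
      (fun x y hx hy => by rw [map_mul]; exact hx.mul_right hy)
      (fun x hx => by rw [map_inv]; exact hx.inv_right) b
    rw [shift_σ]; exact far (by omega)
  | one => exact Commute.one_left _
  | mul x y _ _ hx hy => exact hx.mul_left hy
  | inv x _ hx => exact hx.inv_left

/-- The strand at position `0` moves to position `q`, passing behind the next `q` strands. -/
def strandCross : ℕ → Braid
  | 0 => 1
  | q + 1 => strandCross q * σ q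

/-- The first `p` strands move to the right, in parallel, behind the next `q` strands. -/
def blockCross : ℕ → ℕ → Braid
  | 0, _ => 1
  | p + 1, q => shift p (strandCross q) * blockCross p q

theorem strandCross_mem (q : ℕ) : strandCross q ∈ bounded (q + 1) := by
  induction q with
  | zero => exact one_mem _
  | succ q ih => exact mul_mem (bounded_mono (by omega) ih) (σ_mem (by omega))

theorem blockCross_mem (p q : ℕ) : blockCross p q ∈ bounded (p + q) := by
  induction p with
  | zero => exact one_mem _
  | succ p ih =>
    refine mul_mem ?_ (bounded_mono (by omega) ih)
    exact bounded_mono (by omega) (shift_mem (m := p) (strandCross_mem q))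

theorem strandCross_add (a b : ℕ) :
    strandCross (a + b) = strandCross a * shift a (strandCross b) := by
  induction b with
  | zero => simp [strandCross]
  | succ b ih => rw [← add_assoc, strandCross, strandCross, ih, map_mul, shift_σ, mul_assoc]

theorem blockCross_add_left (a b q : ℕ) :
    blockCross (a + b) q = shift a (blockCross b q) * blockCross a q := by
  induction b with
  | zero => simp [blockCross]
  | succ b ih => rw [← add_assoc, blockCross, blockCross, ih, map_mul, shift_shift, mul_assoc]

theorem blockCross_add_right (p a b : ℕ) :
    blockCross p (a + b) = blockCross p a * shift a (blockCross p b) := by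
  induction p with
  | zero => simp [blockCross]
  | succ p ih =>
    simp only [blockCross, ih, strandCross_add, map_mul, shift_shift]
    have h := (commute_shift (blockCross_mem p a) (strandCross b)).eq
    rw [add_comm a p]
    simp only [mul_assoc]
    rw [← mul_assoc (shift (p + a) _), ← h, mul_assoc]

theorem blockCross_zero_right (p : ℕ) : blockCross p 0 = 1 := by
  induction p with
  | zero => rfl
  | succ p ih => simp [blockCross, strandCross, ih]

theorem blockCross_one_one : blockCross 1 1 = σ 0 := by
  simp [blockCross, strandCross, shift_zero]

theorem σ_strandCross {j q : ℕ} (h : j + 1 < q) :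
    σ (j + 1) * strandCross q = strandCross q * σ j := by
  obtain ⟨r, rfl⟩ : ∃ r, q = j + (1 + 1 + r) := ⟨q - j - 2, by omega⟩
  have h1 : Commute (strandCross j) (σ (j + 1)) := by
    simpa [shift_σ] using commute_shift (strandCross_mem j) (σ 0)
  have h2 : Commute (σ j) (shift (j + 2) (strandCross r)) :=
    commute_shift (σ_mem (by omega)) _
  rw [strandCross_add, strandCross_add (1 + 1) r, map_mul, shift_shift]
  have e : shift j (strandCross (1 + 1)) = σ j * σ (j + 1) := by
    simp [strandCross, shift_σ]
  rw [e]
  calc σ (j + 1) * (strandCross j * (σ j * σ (j + 1) * shift (j + (1 + 1)) (strandCross r)))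
      = (σ (j + 1) * strandCross j) * (σ j * σ (j + 1) * shift (j + 2) (strandCross r)) := by
        simp only [mul_assoc]
    _ = strandCross j * ((σ (j + 1) * σ j * σ (j + 1)) * shift (j + 2) (strandCross r)) := by
        rw [← h1.eq]; simp only [mul_assoc]
    _ = strandCross j * (σ j * σ (j + 1) * (σ j * shift (j + 2) (strandCross r))) := by
        rw [← yb]; simp only [mul_assoc]
    _ = _ := by rw [h2.eq]; simp only [mul_assoc]

/-- Braids of the right-hand block may be moved through a block crossing. -/
theorem blockCross_natural_right {p q : ℕ} {b : Braid} (hb : b ∈ bounded q) :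
    shift p b * blockCross p q = blockCross p q * b := by
  induction hb using Subgroup.closure_induction with
  | mem x hx =>
    obtain ⟨j, hj, rfl⟩ := hx
    induction p with
    | zero => simp [blockCross, shift_zero]
    | succ p ih =>
      rw [blockCross, ← mul_assoc, ← shift_shift, ← map_mul, shift_σ, add_comm 1 j,
        σ_strandCross hj, map_mul, mul_assoc, ih, mul_assoc]
  | one => simp
  | mul x y _ _ hx hy => rw [map_mul, mul_assoc, hy, ← mul_assoc, hx, mul_assoc]
  | inv x _ hx => rw [map_inv, inv_mul_eq_iff_eq_mul, ← mul_assoc, hx, mul_inv_cancel_right]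

theorem σ_blockCross_two (q : ℕ) : σ 0 * blockCross 2 q = blockCross 2 q * σ q := by
  induction q with
  | zero => simp [blockCross_zero_right]
  | succ q ih =>
    have e : blockCross 2 1 = σ 1 * σ 0 := by
      simp [blockCross, strandCross, shift_σ]
    rw [blockCross_add_right, ← mul_assoc, ih, e, map_mul, shift_σ, shift_σ, mul_assoc, mul_assoc]
    congr 1
    simpa [mul_assoc] using yb q

/-- Braids of the left-hand block may be moved through a block crossing. -/
theorem blockCross_natural_left {p q : ℕ} {b : Braid} (hb : b ∈ bounded p) :
    b * blockCross p q = blockCross p q * shift q b := by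
  induction hb using Subgroup.closure_induction with
  | mem x hx =>
    obtain ⟨j, hj, rfl⟩ := hx
    obtain ⟨r, rfl⟩ : ∃ r, p = j + (2 + r) := ⟨p - j - 2, by omega⟩
    have h1 : Commute (σ j) (shift (j + 2) (blockCross r q)) :=
      commute_shift (σ_mem (by omega)) _
    have h2 : Commute (blockCross j q) (σ (q + j)) := by
      simpa [shift_σ, add_comm] using commute_shift (blockCross_mem j q) (σ 0)
    have h3 : σ j * shift j (blockCross 2 q) = shift j (blockCross 2 q) * σ (q + j) := by
      have := congrArg (shift j) (σ_blockCross_two q)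
      simpa [shift_σ, add_comm] using this
    rw [blockCross_add_left, blockCross_add_left, map_mul, shift_shift, shift_σ]
    calc _ = (σ j * shift (j + 2) (blockCross r q)) *
              (shift j (blockCross 2 q) * blockCross j q) := by simp only [mul_assoc]
      _ = shift (j + 2) (blockCross r q) * ((σ j * shift j (blockCross 2 q)) * blockCross j q) := by
          rw [h1.eq]; simp only [mul_assoc]
      _ = shift (j + 2) (blockCross r q) * (shift j (blockCross 2 q) *
            (σ (q + j) * blockCross j q)) := by rw [h3]; simp only [mul_assoc]
      _ = _ := by rw [← h2.eq]; simp only [mul_assoc]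
  | one => simp
  | mul x y _ _ hx hy => rw [map_mul, mul_assoc, hy, ← mul_assoc, hx, mul_assoc]
  | inv x _ hx => rw [map_inv, inv_mul_eq_iff_eq_mul, ← mul_assoc, hx, mul_inv_cancel_right]

theorem blockCross_yb (p q r : ℕ) :
    blockCross p q * shift q (blockCross p r) * blockCross q r =
      shift p (blockCross q r) * blockCross p r * shift r (blockCross p q) := by
  rw [← blockCross_add_right, ← blockCross_natural_right (blockCross_mem q r), add_comm q r,
    blockCross_add_right, mul_assoc]

/-! ### Cabling -/

/-- The block crossing that replaces `σ i` when the strand at each position `j` is replaced by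
`k j` parallel strands. -/
def cableGen (k : ℕ → ℕ) (i : ℕ) : Braid :=
  shift (∑ j ∈ Finset.range i, k j) (blockCross (k i) (k (i + 1)))

/-- The sizes of the blocks after the crossing of the positions `i` and `i + 1`. -/
def swapAt (i : ℕ) (k : ℕ → ℕ) : ℕ → ℕ := fun j => k (Equiv.swap i (i + 1) j)

theorem swapAt_swapAt (i : ℕ) (k : ℕ → ℕ) : swapAt i (swapAt i k) = k := by
  funext j; simp [swapAt]

/-- The permutation of the pairs (block sizes, braid) that appends the cable of `σ i`. -/
def cableStep (i : ℕ) : Equiv.Perm ((ℕ → ℕ) × Braid) where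
  toFun x := (swapAt i x.1, x.2 * cableGen x.1 i)
  invFun x := (swapAt i x.1, x.2 * (cableGen (swapAt i x.1) i)⁻¹)
  left_inv x := by simp [swapAt_swapAt]
  right_inv x := by simp [swapAt_swapAt]

theorem swapAt_left (i : ℕ) (k : ℕ → ℕ) : swapAt i k i = k (i + 1) := by simp [swapAt]

theorem swapAt_right (i : ℕ) (k : ℕ → ℕ) : swapAt i k (i + 1) = k i := by simp [swapAt]

theorem swapAt_ne {i j : ℕ} (k : ℕ → ℕ) (h : j ≠ i) (h' : j ≠ i + 1) : swapAt i k j = k j := by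
  simp [swapAt, Equiv.swap_apply_of_ne_of_ne h h']

theorem sum_swapAt_le {i n : ℕ} (k : ℕ → ℕ) (h : n ≤ i) :
    ∑ j ∈ Finset.range n, swapAt i k j = ∑ j ∈ Finset.range n, k j :=
  Finset.sum_congr rfl fun j hj => by
    have := Finset.mem_range.1 hj
    exact swapAt_ne k (by omega) (by omega)

theorem sum_swapAt_ge {i n : ℕ} (k : ℕ → ℕ) (h : i + 2 ≤ n) :
    ∑ j ∈ Finset.range n, swapAt i k j = ∑ j ∈ Finset.range n, k j := by
  obtain ⟨r, rfl⟩ : ∃ r, n = i + 2 + r := ⟨n - (i + 2), by omega⟩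
  induction r with
  | zero =>
    rw [add_zero, Finset.sum_range_succ, Finset.sum_range_succ, Finset.sum_range_succ,
      Finset.sum_range_succ, sum_swapAt_le k le_rfl, swapAt_left, swapAt_right]
    omega
  | succ r ih =>
    rw [← add_assoc, Finset.sum_range_succ, Finset.sum_range_succ, ih (by omega),
      swapAt_ne k (by omega) (by omega)]

theorem cableGen_far {i j : ℕ} (k : ℕ → ℕ) (h : i + 2 ≤ j) :
    cableGen k i * cableGen (swapAt i k) j = cableGen k j * cableGen (swapAt j k) i := by
  have e1 : cableGen (swapAt i k) j = cableGen k j := by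
    simp only [cableGen]
    rw [sum_swapAt_ge k h, swapAt_ne k (by omega) (by omega), swapAt_ne k (by omega) (by omega)]
  have e2 : cableGen (swapAt j k) i = cableGen k i := by
    simp only [cableGen]
    rw [sum_swapAt_le k (by omega), swapAt_ne k (by omega) (by omega),
      swapAt_ne k (by omega) (by omega)]
  rw [e1, e2]
  have h1 : cableGen k i ∈ bounded (∑ l ∈ Finset.range (i + 2), k l) := by
    rw [Finset.sum_range_succ, Finset.sum_range_succ, add_assoc]
    exact shift_mem (blockCross_mem _ _)
  have h2 := Finset.sum_range_add_sum_Ico k h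
  have h3 := commute_shift h1
    (shift (∑ l ∈ Finset.Ico (i + 2) j, k l) (blockCross (k j) (k (j + 1))))
  rw [shift_shift, h2] at h3
  exact h3.eq

theorem swapAt_comm {i j : ℕ} (k : ℕ → ℕ) (h : i + 2 ≤ j) :
    swapAt j (swapAt i k) = swapAt i (swapAt j k) := by
  funext l
  simp only [swapAt, Equiv.swap_apply_def]
  congr 1
  split_ifs <;> omega

theorem swapAt_yb (i : ℕ) (k : ℕ → ℕ) :
    swapAt i (swapAt (i + 1) (swapAt i k)) = swapAt (i + 1) (swapAt i (swapAt (i + 1) k)) := by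
  funext l
  simp only [swapAt, Equiv.swap_apply_def]
  congr 1
  split_ifs <;> omega

theorem cableGen_yb (i : ℕ) (k : ℕ → ℕ) :
    cableGen k i * cableGen (swapAt i k) (i + 1) * cableGen (swapAt (i + 1) (swapAt i k)) i =
      cableGen k (i + 1) * cableGen (swapAt (i + 1) k) i *
        cableGen (swapAt i (swapAt (i + 1) k)) (i + 1) := by
  have e (k : ℕ → ℕ) : swapAt (i + 1) k i = k i := swapAt_ne k (by omega) (by omega)
  have e' (k : ℕ → ℕ) : swapAt i k (i + 2) = k (i + 2) := swapAt_ne k (by omega) (by omega)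
  have s (k : ℕ → ℕ) : ∑ j ∈ Finset.range i, swapAt i k j = ∑ j ∈ Finset.range i, k j :=
    sum_swapAt_le k le_rfl
  have s' (k : ℕ → ℕ) : ∑ j ∈ Finset.range i, swapAt (i + 1) k j = ∑ j ∈ Finset.range i, k j :=
    sum_swapAt_le k (by omega)
  have a : i + 1 + 1 = i + 2 := rfl
  simp only [cableGen, a, Finset.sum_range_succ, s, s', swapAt_left, swapAt_right, e, e',
    ← shift_shift, ← map_mul]
  rw [blockCross_yb]

/-- The right action of the braid group on the pairs (block sizes, braid). -/
def cableAction : Braid →* (Equiv.Perm ((ℕ → ℕ) × Braid))ᵐᵒᵖ :=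
  lift (fun i => MulOpposite.op (cableStep i))
    (fun i j h => by
      rw [← MulOpposite.op_mul, ← MulOpposite.op_mul]
      congr 1
      ext1 x
      refine Prod.ext ?_ ?_
      · exact swapAt_comm x.1 h
      · simpa [cableStep, mul_assoc] using cableGen_far x.1 h)
    (fun i => by
      rw [← MulOpposite.op_mul, ← MulOpposite.op_mul, ← MulOpposite.op_mul, ← MulOpposite.op_mul]
      congr 1
      ext1 x
      refine Prod.ext ?_ ?_
      · exact swapAt_yb i x.1
      · simpa [cableStep, mul_assoc] using cableGen_yb i x.1)

/-- The block sizes after the strands of `b`, cabled according to `k`, have been permuted. -/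
def cableSizes (k : ℕ → ℕ) (b : Braid) : ℕ → ℕ := ((cableAction b).unop (k, 1)).1

/-- The cabling of `b`: the strand that starts at position `j` is replaced by `k j` parallel
strands, in a tubular neighbourhood of it. -/
def cable (k : ℕ → ℕ) (b : Braid) : Braid := ((cableAction b).unop (k, 1)).2

theorem cableAction_apply (k : ℕ → ℕ) (a b : Braid) :
    (cableAction b).unop (k, a) = (cableSizes k b, a * cable k b) := by
  have main : ∀ b : Braid, ∀ k a c, (cableAction b).unop (k, c * a) =
      (((cableAction b).unop (k, a)).1, c * ((cableAction b).unop (k, a)).2) := by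
    intro b
    refine gen_induction (p := fun b => ∀ k a c, (cableAction b).unop (k, c * a) =
      (((cableAction b).unop (k, a)).1, c * ((cableAction b).unop (k, a)).2)) ?_ ?_ ?_ ?_ b
    · intro i k a c
      simp [cableAction, lift_σ, cableStep, mul_assoc]
    · intro k a c; simp
    · intro x y hx hy k a c
      simp only [map_mul, MulOpposite.unop_mul, Equiv.Perm.mul_apply]
      rw [hx, hy]
    · intro x hx k a c
      simp only [map_inv, MulOpposite.unop_inv]
      rw [Equiv.Perm.inv_eq_iff_eq, hx]
      simp
  have := main b k 1 a
  rwa [mul_one] at this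

theorem cable_one (k : ℕ → ℕ) : cable k 1 = 1 := by simp [cable]

theorem cableSizes_one (k : ℕ → ℕ) : cableSizes k 1 = k := by simp [cableSizes]

theorem cableSizes_mul (k : ℕ → ℕ) (a b : Braid) :
    cableSizes k (a * b) = cableSizes (cableSizes k a) b := by
  have : (cableAction (a * b)).unop (k, 1) = (cableAction b).unop ((cableAction a).unop (k, 1)) := by
    simp
  rw [cableAction_apply k 1 a, cableAction_apply, cableAction_apply] at this
  exact (Prod.mk.inj this).1

/-- The cabling of a product. -/
theorem cable_mul (k : ℕ → ℕ) (a b : Braid) :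
    cable k (a * b) = cable k a * cable (cableSizes k a) b := by
  have : (cableAction (a * b)).unop (k, 1) = (cableAction b).unop ((cableAction a).unop (k, 1)) := by
    simp
  rw [cableAction_apply k 1 a, cableAction_apply, cableAction_apply] at this
  simpa using congrArg Prod.snd this

/-- The cabling of a generator. -/
theorem cable_σ (k : ℕ → ℕ) (i : ℕ) : cable k (σ i) = cableGen k i := by
  simp [cable, cableAction, lift_σ, cableStep]

theorem cableSizes_σ (k : ℕ → ℕ) (i : ℕ) : cableSizes k (σ i) = swapAt i k := by
  simp [cableSizes, cableAction, lift_σ, cableStep]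

theorem cable_σ_inv (k : ℕ → ℕ) (i : ℕ) : cable k (σ i)⁻¹ = (cableGen (swapAt i k) i)⁻¹ := by
  simp [cable, cableAction, lift_σ, cableStep, Equiv.Perm.inv_def]

theorem cableSizes_σ_inv (k : ℕ → ℕ) (i : ℕ) : cableSizes k (σ i)⁻¹ = swapAt i k := by
  simp [cableSizes, cableAction, lift_σ, cableStep, Equiv.Perm.inv_def]

end Braid

/-- The two colors of the Swiss-Cheese operad. -/
inductive Color
  | closed
  | opened

/-- Formal operations of the free two-colored operad on `μ_c : (c, c) → c`, `f : c → o` and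
`μ_o : (o, o) → o`, with inputs labelled in `I` (an input `i` has color `κ i`; labels may be
omitted or repeated).  The index is the color of the output. -/
inductive Term {I : Type} (κ : I → Color) : Color → Type
  | leaf (i : I) : Term κ (κ i)
  | mulC (s t : Term κ .closed) : Term κ .closed
  | mulO (s t : Term κ .opened) : Term κ .opened
  | f (s : Term κ .closed) : Term κ .opened

namespace Term

/-- The inputs, read from left to right. -/
def word {I : Type} {κ : I → Color} : {d : Color} → Term κ d → List I
  | _, leaf i => [i]
  | _, mulC s t => word s ++ word t
  | _, mulO s t => word s ++ word t
  | _, f s => word s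

/-- Relabelling of the inputs. -/
def relabel {I J : Type} (e : I → J) (κ : J → Color) :
    {d : Color} → Term (κ ∘ e) d → Term κ d
  | _, leaf i => leaf (κ := κ) (e i)
  | _, mulC s t => mulC (relabel e κ s) (relabel e κ t)
  | _, mulO s t => mulO (relabel e κ s) (relabel e κ t)
  | _, f s => f (relabel e κ s)

/-- Substitution of a term `y i` for each input `i`. -/
def subst {I : Type} {κ : I → Color} {J : I → Type} (κJ : ∀ i, J i → Color)
    (y : ∀ i, Term (κJ i) (κ i)) :
    {d : Color} → Term κ d → Term (fun p : Σ i, J i => κJ p.1 p.2) d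
  | _, leaf i => relabel (Sigma.mk i) (fun p : Σ i, J i => κJ p.1 p.2) (y i)
  | _, mulC s t => mulC (subst κJ y s) (subst κJ y t)
  | _, mulO s t => mulO (subst κJ y s) (subst κJ y t)
  | _, f s => f (subst κJ y s)

theorem word_relabel {I J : Type} (e : I → J) (κ : J → Color) {d : Color} (t : Term (κ ∘ e) d) :
    (relabel e κ t).word = t.word.map e := by
  induction t with
  | leaf i => rfl
  | mulC s t hs ht => simp [relabel, word, hs, ht]
  | mulO s t hs ht => simp [relabel, word, hs, ht]
  | f s hs => simp [relabel, word, hs]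

theorem word_subst {I : Type} {κ : I → Color} {J : I → Type} (κJ : ∀ i, J i → Color)
    (y : ∀ i, Term (κJ i) (κ i)) {d : Color} (t : Term κ d) :
    (subst κJ y t).word = t.word.flatMap fun i => (y i).word.map (Sigma.mk i) := by
  induction t with
  | leaf i => simp [subst, word, word_relabel]
  | mulC s t hs ht => simp [subst, word, hs, ht]
  | mulO s t hs ht => simp [subst, word, hs, ht]
  | f s hs => simp [subst, word, hs]

/-- An operation with closed output only has closed inputs. -/
theorem closed_of_mem {I : Type} {κ : I → Color} {d : Color} (t : Term κ d) (hd : d = .closed) :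
    ∀ i ∈ t.word, κ i = .closed := by
  induction t with
  | leaf i => simpa [word] using hd
  | mulC s t hs ht =>
    intro i hi
    rcases List.mem_append.1 hi with h | h
    · exact hs rfl i h
    · exact ht rfl i h
  | mulO s t hs ht => cases hd
  | f s hs => cases hd

theorem relabel_id {I : Type} (κ : I → Color) {d : Color} (t : Term κ d) :
    relabel (fun i => i) κ t = t := by
  induction t with
  | leaf i => rfl
  | mulC s t hs ht => exact congrArg₂ mulC hs ht
  | mulO s t hs ht => exact congrArg₂ mulO hs ht
  | f s hs => exact congrArg f hs

theorem relabel_relabel {I J K : Type} (e : I → J) (g : J → K) (κ : K → Color) {d : Color}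
    (t : Term (κ ∘ g ∘ e) d) :
    relabel g κ (relabel e (κ ∘ g) t) = relabel (g ∘ e) κ t := by
  induction t with
  | leaf i => rfl
  | mulC s t hs ht => exact congrArg₂ mulC hs ht
  | mulO s t hs ht => exact congrArg₂ mulO hs ht
  | f s hs => exact congrArg f hs

theorem subst_relabel {I I' : Type} (e : I → I') (κ : I' → Color) {J : I' → Type}
    (κJ : ∀ i, J i → Color) (y : ∀ i, Term (κJ i) (κ i)) {d : Color} (t : Term (κ ∘ e) d) :
    subst κJ y (relabel e κ t) =
      relabel (fun p : Σ i, J (e i) => (⟨e p.1, p.2⟩ : Σ i, J i)) (fun p => κJ p.1 p.2)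
        (subst (fun i => κJ (e i)) (fun i => y (e i)) t) := by
  induction t with
  | leaf i => exact (relabel_relabel (Sigma.mk i)
      (fun p : Σ i, J (e i) => (⟨e p.1, p.2⟩ : Σ i, J i)) (fun p => κJ p.1 p.2) (y (e i))).symm
  | mulC s t hs ht => exact congrArg₂ mulC hs ht
  | mulO s t hs ht => exact congrArg₂ mulO hs ht
  | f s hs => exact congrArg f hs

theorem subst_relabel_inner {I : Type} {κ : I → Color} {J J' : I → Type} (e : ∀ i, J i → J' i)
    (κJ : ∀ i, J' i → Color) (y : ∀ i, Term (κJ i ∘ e i) (κ i)) {d : Color} (t : Term κ d) :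
    subst κJ (fun i => relabel (e i) (κJ i) (y i)) t =
      relabel (fun p : Σ i, J i => (⟨p.1, e p.1 p.2⟩ : Σ i, J' i)) (fun p => κJ p.1 p.2)
        (subst (fun i => κJ i ∘ e i) y t) := by
  induction t with
  | leaf i =>
    exact (relabel_relabel (e i) (Sigma.mk i) (fun p : Σ i, J' i => κJ p.1 p.2) (y i)).trans
      (relabel_relabel (Sigma.mk i) (fun p : Σ i, J i => (⟨p.1, e p.1 p.2⟩ : Σ i, J' i))
        (fun p => κJ p.1 p.2) (y i)).symm
  | mulC s t hs ht => exact congrArg₂ mulC hs ht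
  | mulO s t hs ht => exact congrArg₂ mulO hs ht
  | f s hs => exact congrArg f hs

theorem subst_one_left {I : Type} {κ : I → Color} {d : Color} (t : Term κ d) :
    relabel (fun p : Σ _ : Unit, I => p.2) κ
      (subst (κ := fun _ : Unit => d) (fun _ => κ) (fun _ => t)
        (leaf (κ := fun _ : Unit => d) ())) = t :=
  (relabel_relabel (Sigma.mk ()) (fun p : Σ _ : Unit, I => p.2) κ t).trans (relabel_id κ t)

theorem subst_one_right {I : Type} {κ : I → Color} {d : Color} (t : Term κ d) :
    relabel (fun p : Σ _ : I, Unit => p.1) κ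
      (subst (fun i _ => κ i) (fun i => leaf (κ := fun _ : Unit => κ i) ()) t) = t := by
  induction t with
  | leaf i => rfl
  | mulC s t hs ht => exact congrArg₂ mulC hs ht
  | mulO s t hs ht => exact congrArg₂ mulO hs ht
  | f s hs => exact congrArg f hs

theorem subst_assoc {I : Type} {κ : I → Color} {J : I → Type} {K : ∀ i, J i → Type}
    (κJ : ∀ i, J i → Color) (κK : ∀ i j, K i j → Color)
    (y : ∀ i, Term (κJ i) (κ i)) (z : ∀ i j, Term (κK i j) (κJ i j)) {d : Color} (t : Term κ d) :
    relabel (fun x : Σ p : Σ i, J i, K p.1 p.2 => (⟨x.1.1, ⟨x.1.2, x.2⟩⟩ : Σ i, Σ j, K i j))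
      (fun x => κK x.1 x.2.1 x.2.2)
      (subst (fun p : Σ i, J i => κK p.1 p.2) (fun p => z p.1 p.2) (subst κJ y t)) =
    subst (fun i (q : Σ j, K i j) => κK i q.1 q.2) (fun i => subst (κK i) (z i) (y i)) t := by
  induction t with
  | leaf i =>
    exact (congrArg _ (subst_relabel (Sigma.mk i) (fun p : Σ i, J i => κJ p.1 p.2)
      (fun p : Σ i, J i => κK p.1 p.2) (fun p => z p.1 p.2) (y i))).trans
        (relabel_relabel _ _ _ _)
  | mulC s t hs ht => exact congrArg₂ mulC hs ht
  | mulO s t hs ht => exact congrArg₂ mulO hs ht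
  | f s hs => exact congrArg f hs

end Term

/-- `Bicolored κ w b w'`: the braid `b` goes from the sequence of strands `w` to the sequence `w'`,
and it has a diagram in which only closed (aerial) strands pass behind other strands; that is, an
open (terrestrial) strand never goes behind any other strand. -/
inductive Bicolored {I : Type} (κ : I → Color) : List I → Braid → List I → Prop
  | nil (w : List I) : Bicolored κ w 1 w
  | pos {w : List I} {b : Braid} (u : List I) (x y : I) (v : List I) :
      Bicolored κ w b (u ++ x :: y :: v) → κ x = .closed →
        Bicolored κ w (b * Braid.σ u.length) (u ++ y :: x :: v)
  | neg {w : List I} {b : Braid} (u : List I) (x y : I) (v : List I) :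
      Bicolored κ w b (u ++ x :: y :: v) → κ y = .closed →
        Bicolored κ w (b * (Braid.σ u.length)⁻¹) (u ++ y :: x :: v)

namespace Bicolored

open Braid

variable {I : Type} {κ : I → Color}

theorem trans {w w' w'' : List I} {b b' : Braid} (h : Bicolored κ w b w')
    (h' : Bicolored κ w' b' w'') : Bicolored κ w (b * b') w'' := by
  induction h' with
  | nil => simpa using h
  | pos u x y v _ hx ih => rw [← mul_assoc]; exact pos u x y v ih hx
  | neg u x y v _ hx ih => rw [← mul_assoc]; exact neg u x y v ih hx

theorem symm {w w' : List I} {b : Braid} (h : Bicolored κ w b w') : Bicolored κ w' b⁻¹ w := by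
  induction h with
  | nil => simpa using nil _
  | pos u x y v _ hx ih =>
    rw [mul_inv_rev]
    have := neg u y x v (nil (κ := κ) _) hx
    rw [one_mul] at this
    exact this.trans ih
  | neg u x y v _ hx ih =>
    rw [mul_inv_rev, inv_inv]
    have := pos u y x v (nil (κ := κ) _) hx
    rw [one_mul] at this
    exact this.trans ih

theorem perm {w w' : List I} {b : Braid} (h : Bicolored κ w b w') : w.Perm w' := by
  induction h with
  | nil => exact List.Perm.refl _
  | pos u x y v _ _ ih => exact ih.trans ((List.Perm.swap y x v).append_left u)
  | neg u x y v _ _ ih => exact ih.trans ((List.Perm.swap y x v).append_left u)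

theorem mem_bounded {w w' : List I} {b : Braid} (h : Bicolored κ w b w') :
    b ∈ bounded w.length := by
  induction h with
  | nil => exact one_mem _
  | pos u x y v h _ ih =>
    refine mul_mem ih (σ_mem ?_)
    rw [h.perm.length_eq]; simp
  | neg u x y v h _ ih =>
    refine mul_mem ih (inv_mem (σ_mem ?_))
    rw [h.perm.length_eq]; simp

theorem append_right {w w' : List I} {b : Braid} (h : Bicolored κ w b w') (r : List I) :
    Bicolored κ (w ++ r) b (w' ++ r) := by
  induction h with
  | nil => exact nil _
  | pos u x y v _ hx ih => simpa using pos u x y (v ++ r) (by simpa using ih) hx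
  | neg u x y v _ hx ih => simpa using neg u x y (v ++ r) (by simpa using ih) hx

theorem append_left {w w' : List I} {b : Braid} (h : Bicolored κ w b w') (r : List I) :
    Bicolored κ (r ++ w) (shift r.length b) (r ++ w') := by
  induction h with
  | nil => rw [map_one]; exact nil _
  | pos u x y v _ hx ih =>
    have := pos (r ++ u) x y v (by simpa using ih) hx
    simpa [shift_σ] using this
  | neg u x y v _ hx ih =>
    have := neg (r ++ u) x y v (by simpa using ih) hx
    simpa [shift_σ] using this

theorem map {J : Type} (e : I → J) {κ : J → Color} {w w' : List I} {b : Braid}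
    (h : Bicolored (κ ∘ e) w b w') : Bicolored κ (w.map e) b (w'.map e) := by
  induction h with
  | nil => exact nil _
  | pos u x y v _ hx ih =>
    have := pos (u.map e) (e x) (e y) (v.map e) (by simpa using ih) hx
    simpa using this
  | neg u x y v _ hx ih =>
    have := neg (u.map e) (e x) (e y) (v.map e) (by simpa using ih) hx
    simpa using this

theorem strand (x : I) (hx : κ x = .closed) (v : List I) :
    Bicolored κ (x :: v) (strandCross v.length) (v ++ [x]) := by
  induction v using List.reverseRecOn with
  | nil => exact nil _
  | append_singleton v y ih =>
    have := pos v x y [] (by simpa using ih.append_right [y]) hx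
    simpa [strandCross] using this

theorem block (u v : List I) (hu : ∀ x ∈ u, κ x = .closed) :
    Bicolored κ (u ++ v) (blockCross u.length v.length) (v ++ u) := by
  induction u using List.reverseRecOn with
  | nil => simpa [blockCross] using nil v
  | append_singleton u x ih =>
    have h1 := (strand x (hu x (by simp)) v).append_left u
    have h2 := (ih fun x hx => hu x (by simp [hx])).append_right [x]
    have := h1.trans (w'' := v ++ u ++ [x]) (by simpa using h2)
    simpa [blockCross] using this

end Bicolored

/-! ### Composition of bicolored braids -/

/-- The sizes of the blocks, from left to right, when each strand `i` of `w` is replaced by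
`ℓ i` strands. -/
def blockSizes {I : Type} (ℓ : I → ℕ) (w : List I) : ℕ → ℕ := fun p => (w.map ℓ).getD p 0

/-- The braids `β i`, on `ℓ i` strands, side by side in the order given by `w`. -/
def juxtapose {I : Type} (ℓ : I → ℕ) (β : I → Braid) : List I → Braid
  | [] => 1
  | i :: w => β i * Braid.shift (ℓ i) (juxtapose ℓ β w)

/-- The insertion of the braid `β i`, on `ℓ i` strands, in a tubular neighbourhood of the strand
`i` of the braid `b`, for each `i`.  The strands of `b` start in the order given by `w`. -/
def insertBraids {I : Type} (ℓ : I → ℕ) (w : List I) (b : Braid) (β : I → Braid) : Braid :=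
  juxtapose ℓ β w * Braid.cable (blockSizes ℓ w) b

section insert

open Braid

variable {I : Type}

theorem blockSizes_append_right (ℓ : I → ℕ) (u v : List I) (p : ℕ) :
    blockSizes ℓ (u ++ v) (u.length + p) = blockSizes ℓ v p := by
  simp [blockSizes, List.getD_eq_getElem?_getD, List.getElem?_append_right]

theorem blockSizes_append_left (ℓ : I → ℕ) (u v : List I) {p : ℕ} (h : p < u.length) :
    blockSizes ℓ (u ++ v) p = blockSizes ℓ u p := by
  simp [blockSizes, List.getD_eq_getElem?_getD, List.getElem?_append_left, h]

theorem sum_blockSizes (ℓ : I → ℕ) (u v : List I) :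
    ∑ j ∈ Finset.range u.length, blockSizes ℓ (u ++ v) j = (u.map ℓ).sum := by
  induction u generalizing v with
  | nil => simp
  | cons x u ih =>
    rw [List.length_cons, Finset.sum_range_succ', List.map_cons, List.sum_cons, add_comm (ℓ x)]
    congr 1
    exact ih v

theorem swapAt_blockSizes (ℓ : I → ℕ) (u : List I) (x y : I) (v : List I) :
    swapAt u.length (blockSizes ℓ (u ++ x :: y :: v)) = blockSizes ℓ (u ++ y :: x :: v) := by
  funext p
  rcases lt_trichotomy p u.length with h | rfl | h
  · rw [swapAt_ne _ (by omega) (by omega), blockSizes_append_left _ _ _ h,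
      blockSizes_append_left _ _ _ h]
  · rw [swapAt_left, blockSizes_append_right _ _ _ 1]
    exact (blockSizes_append_right ℓ u (y :: x :: v) 0).symm
  · obtain ⟨r, rfl⟩ : ∃ r, p = u.length + (r + 1) := ⟨p - u.length - 1, by omega⟩
    cases r with
    | zero =>
      rw [zero_add, swapAt_right, blockSizes_append_right]
      exact (blockSizes_append_right ℓ u (x :: y :: v) 0)
    | succ r =>
      rw [swapAt_ne _ (by omega) (by omega), blockSizes_append_right, blockSizes_append_right]
      rfl

theorem cableGen_blockSizes (ℓ : I → ℕ) (u : List I) (x y : I) (v : List I) :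
    cableGen (blockSizes ℓ (u ++ x :: y :: v)) u.length =
      shift (u.map ℓ).sum (blockCross (ℓ x) (ℓ y)) := by
  rw [cableGen, sum_blockSizes, blockSizes_append_right _ _ _ 1]
  have : blockSizes ℓ (u ++ x :: y :: v) u.length = ℓ x := blockSizes_append_right _ _ _ 0
  rw [this]; rfl

variable {κ : I → Color}

theorem cableSizes_bicolored (ℓ : I → ℕ) {w w' : List I} {b : Braid} (h : Bicolored κ w b w') :
    cableSizes (blockSizes ℓ w) b = blockSizes ℓ w' := by
  induction h with
  | nil => exact cableSizes_one _
  | pos u x y v _ _ ih => rw [cableSizes_mul, ih, cableSizes_σ, swapAt_blockSizes]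
  | neg u x y v _ _ ih => rw [cableSizes_mul, ih, cableSizes_σ_inv, swapAt_blockSizes]

theorem cable_trans (ℓ : I → ℕ) {w w' : List I} {b : Braid} (h : Bicolored κ w b w')
    (b' : Braid) : cable (blockSizes ℓ w) (b * b') =
      cable (blockSizes ℓ w) b * cable (blockSizes ℓ w') b' := by
  rw [cable_mul, cableSizes_bicolored ℓ h]

theorem cable_pos (ℓ : I → ℕ) {w : List I} {b : Braid} {u : List I} {x y : I} {v : List I}
    (h : Bicolored κ w b (u ++ x :: y :: v)) :
    cable (blockSizes ℓ w) (b * σ u.length) =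
      cable (blockSizes ℓ w) b * shift (u.map ℓ).sum (blockCross (ℓ x) (ℓ y)) := by
  rw [cable_trans ℓ h, cable_σ, cableGen_blockSizes]

theorem cable_neg (ℓ : I → ℕ) {w : List I} {b : Braid} {u : List I} {x y : I} {v : List I}
    (h : Bicolored κ w b (u ++ x :: y :: v)) :
    cable (blockSizes ℓ w) (b * (σ u.length)⁻¹) =
      cable (blockSizes ℓ w) b * (shift (u.map ℓ).sum (blockCross (ℓ y) (ℓ x)))⁻¹ := by
  rw [cable_trans ℓ h, cable_σ_inv, swapAt_blockSizes, cableGen_blockSizes]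

theorem juxtapose_append (ℓ : I → ℕ) (β : I → Braid) (u v : List I) :
    juxtapose ℓ β (u ++ v) = juxtapose ℓ β u * shift (u.map ℓ).sum (juxtapose ℓ β v) := by
  induction u with
  | nil => simp [juxtapose, shift_zero]
  | cons x u ih => simp [juxtapose, ih, shift_shift, mul_assoc]

theorem juxtapose_mem {ℓ : I → ℕ} {β : I → Braid} (hβ : ∀ i, β i ∈ bounded (ℓ i))
    (w : List I) : juxtapose ℓ β w ∈ bounded (w.map ℓ).sum := by
  induction w with
  | nil => exact one_mem _
  | cons x w ih =>
    rw [List.map_cons, List.sum_cons]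
    exact mul_mem (bounded_mono (by omega) (hβ x)) (shift_mem ih)

theorem juxtapose_one (ℓ : I → ℕ) (w : List I) : juxtapose ℓ (fun _ => 1) w = 1 := by
  induction w with
  | nil => rfl
  | cons x w ih => simp [juxtapose, ih]

theorem juxtapose_mul {ℓ : I → ℕ} {β : I → Braid} (β' : I → Braid)
    (hβ' : ∀ i, β' i ∈ bounded (ℓ i)) (w : List I) :
    juxtapose ℓ (fun i => β i * β' i) w = juxtapose ℓ β w * juxtapose ℓ β' w := by
  induction w with
  | nil => simp [juxtapose]
  | cons x w ih =>
    simp only [juxtapose, ih, map_mul, mul_assoc]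
    rw [← mul_assoc (shift _ _) (β' x), ← (commute_shift (hβ' x) _).eq, mul_assoc]

theorem juxtapose_swap {ℓ : I → ℕ} {β : I → Braid} (hβ : ∀ i, β i ∈ bounded (ℓ i))
    (u : List I) (x y : I) (v : List I) :
    juxtapose ℓ β (u ++ x :: y :: v) * shift (u.map ℓ).sum (blockCross (ℓ x) (ℓ y)) =
      shift (u.map ℓ).sum (blockCross (ℓ x) (ℓ y)) * juxtapose ℓ β (u ++ y :: x :: v) := by
  have hu := (commute_shift (juxtapose_mem hβ u) (blockCross (ℓ x) (ℓ y))).eq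
  have hv : Commute (blockCross (ℓ x) (ℓ y)) (shift (ℓ x + ℓ y) (juxtapose ℓ β v)) :=
    commute_shift (blockCross_mem _ _) _
  have hx := blockCross_natural_left (q := ℓ y) (hβ x)
  have hy := blockCross_natural_right (p := ℓ x) (hβ y)
  have hc : Commute (β y) (shift (ℓ y) (β x)) := commute_shift (hβ y) _
  rw [juxtapose_append, juxtapose_append, ← mul_assoc, ← hu, mul_assoc, mul_assoc, ← map_mul,
    ← map_mul]
  congr 2
  simp only [juxtapose, map_mul, shift_shift, mul_assoc]
  rw [← hv.eq, ← mul_assoc (shift _ (β y)), hy, ← mul_assoc (β x), ← mul_assoc (β x), hx,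
    mul_assoc, mul_assoc, ← mul_assoc (shift _ (β x)), ← hc.eq, add_comm (ℓ x)]
  simp only [mul_assoc]

/-- Inner braids may be moved through a cabled braid. -/
theorem juxtapose_cable {ℓ : I → ℕ} {β : I → Braid} (hβ : ∀ i, β i ∈ bounded (ℓ i))
    {w w' : List I} {b : Braid} (h : Bicolored κ w b w') :
    juxtapose ℓ β w * cable (blockSizes ℓ w) b =
      cable (blockSizes ℓ w) b * juxtapose ℓ β w' := by
  induction h with
  | nil => simp [cable_one]
  | pos u x y v h _ ih =>
    rw [cable_pos ℓ h, ← mul_assoc, ih, mul_assoc, juxtapose_swap hβ, mul_assoc]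
  | neg u x y v h _ ih =>
    rw [cable_neg ℓ h, ← mul_assoc, ih, mul_assoc, mul_assoc]
    congr 1
    rw [eq_inv_mul_iff_mul_eq, ← mul_assoc, ← juxtapose_swap hβ, mul_inv_cancel_right]

theorem insertBraids_mul {ℓ : I → ℕ} {β β' : I → Braid}
    (hβ' : ∀ i, β' i ∈ bounded (ℓ i)) {w w' : List I} {b : Braid}
    (h : Bicolored κ w b w') (b' : Braid) :
    insertBraids ℓ w (b * b') (fun i => β i * β' i) =
      insertBraids ℓ w b β * insertBraids ℓ w' b' β' := by
  rw [insertBraids, insertBraids, insertBraids, cable_trans ℓ h, juxtapose_mul β' hβ', mul_assoc,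
    ← mul_assoc (juxtapose ℓ β' w), juxtapose_cable hβ' h]
  simp only [mul_assoc]

theorem insertBraids_one (ℓ : I → ℕ) (w : List I) :
    insertBraids ℓ w 1 (fun _ => 1) = 1 := by
  simp [insertBraids, juxtapose_one, cable_one]

/-- The word obtained by substituting a word `W i` for each letter `i`. -/
abbrev substWord {J : I → Type} (W : ∀ i, List (J i)) (w : List I) : List (Σ i, J i) :=
  w.flatMap fun i => (W i).map (Sigma.mk i)

theorem length_substWord {J : I → Type} (W : ∀ i, List (J i)) (w : List I) :
    (substWord W w).length = (w.map fun i => (W i).length).sum := by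
  simp [substWord, List.length_flatMap]

theorem Bicolored.juxtapose {J : I → Type} {κJ : ∀ i, J i → Color} {W W' : ∀ i, List (J i)}
    {β : I → Braid} (hβ : ∀ i, Bicolored (κJ i) (W i) (β i) (W' i)) (w : List I) :
    Bicolored (fun p : Σ i, J i => κJ p.1 p.2) (substWord W w)
      (juxtapose (fun i => (W i).length) β w) (substWord W' w) := by
  induction w with
  | nil => exact Bicolored.nil _
  | cons i w ih =>
    have h1 := (Bicolored.map (Sigma.mk i) (κ := fun p : Σ i, J i => κJ p.1 p.2)
      (hβ i)).append_right (substWord W w)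
    have h2 := ih.append_left ((W' i).map (Sigma.mk i))
    rw [List.length_map, ← (hβ i).perm.length_eq] at h2
    exact h1.trans h2

theorem Bicolored.cable {J : I → Type} {κJ : ∀ i, J i → Color} {W : ∀ i, List (J i)}
    (hW : ∀ i, κ i = .closed → ∀ j ∈ W i, κJ i j = .closed) {w w' : List I} {b : Braid}
    (h : Bicolored κ w b w') :
    Bicolored (fun p : Σ i, J i => κJ p.1 p.2) (substWord W w)
      (cable (blockSizes (fun i => (W i).length) w) b) (substWord W w') := by
  have key : ∀ (u : List I) (x y : I) (v : List I), κ x = .closed →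
      Bicolored (fun p : Σ i, J i => κJ p.1 p.2) (substWord W (u ++ x :: y :: v))
      (shift (u.map fun i => (W i).length).sum (blockCross (W x).length (W y).length))
      (substWord W (u ++ y :: x :: v)) := by
    intro u x y v hx
    have h1 := ((Bicolored.block (κ := fun p : Σ i, J i => κJ p.1 p.2)
      ((W x).map (Sigma.mk x)) ((W y).map (Sigma.mk y)) (by
        intro p hp
        obtain ⟨j, hj, rfl⟩ := List.mem_map.1 hp
        exact hW x hx j hj)).append_right (substWord W v)).append_left (substWord W u)
    rw [length_substWord] at h1
    simpa [substWord] using h1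
  induction h with
  | nil => rw [cable_one]; exact Bicolored.nil _
  | pos u x y v h hx ih =>
    rw [cable_pos _ h]
    exact ih.trans (key u x y v hx)
  | neg u x y v h hx ih =>
    rw [cable_neg _ h]
    exact ih.trans (key u y x v hx).symm

theorem Bicolored.insert {J : I → Type} {κJ : ∀ i, J i → Color} {W W' : ∀ i, List (J i)}
    {β : I → Braid} (hβ : ∀ i, Bicolored (κJ i) (W i) (β i) (W' i))
    (hW : ∀ i, κ i = .closed → ∀ j ∈ W' i, κJ i j = .closed) {w w' : List I} {b : Braid}
    (h : Bicolored κ w b w') :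
    Bicolored (fun p : Σ i, J i => κJ p.1 p.2) (substWord W w)
      (insertBraids (fun i => (W i).length) w b β) (substWord W' w') := by
  refine (Bicolored.juxtapose hβ w).trans ?_
  have : (fun i => (W i).length) = fun i => (W' i).length :=
    funext fun i => (hβ i).perm.length_eq
  rw [this]
  exact h.cable hW

/-! The unit and associativity laws of the insertion. -/

theorem cable_ones (w : List I) {w' : List I} {b : Braid} (h : Bicolored κ w b w') :
    cable (blockSizes (fun _ => 1) w) b = b := by
  induction h with
  | nil => exact cable_one _
  | pos u x y v h _ ih => rw [cable_pos _ h, ih, blockCross_one_one, shift_σ]; simp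
  | neg u x y v h _ ih => rw [cable_neg _ h, ih, blockCross_one_one, shift_σ]; simp

theorem Bicolored.allClosed {w w' : List I} {b : Braid} (h : Bicolored κ w b w') :
    Bicolored (fun _ => Color.closed) w b w' := by
  induction h with
  | nil => exact Bicolored.nil _
  | pos u x y v _ _ ih => exact Bicolored.pos u x y v ih rfl
  | neg u x y v _ _ ih => exact Bicolored.neg u x y v ih rfl

theorem cable_mem (ℓ : I → ℕ) {w w' : List I} {b : Braid} (h : Bicolored κ w b w') :
    cable (blockSizes ℓ w) b ∈ bounded (w.map ℓ).sum := by
  induction h with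
  | nil => rw [cable_one]; exact one_mem _
  | pos u x y v h _ ih =>
    rw [cable_pos _ h]
    refine mul_mem ih (bounded_mono ?_ (shift_mem (blockCross_mem _ _)))
    rw [(h.perm.map ℓ).sum_eq]; simp
  | neg u x y v h _ ih =>
    rw [cable_neg _ h]
    refine mul_mem ih (inv_mem (bounded_mono ?_ (shift_mem (blockCross_mem _ _))))
    rw [(h.perm.map ℓ).sum_eq]; simp; omega

theorem cable_append_right (ℓ : I → ℕ) {w w' : List I} {b : Braid} (h : Bicolored κ w b w')
    (r : List I) : cable (blockSizes ℓ (w ++ r)) b = cable (blockSizes ℓ w) b := by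
  induction h with
  | nil => rw [cable_one, cable_one]
  | pos u x y v h _ ih =>
    rw [cable_pos _ h, cable_pos ℓ (u := u) (x := x) (y := y) (v := v ++ r)
      (by simpa using h.append_right r), ih]
  | neg u x y v h _ ih =>
    rw [cable_neg _ h, cable_neg ℓ (u := u) (x := x) (y := y) (v := v ++ r)
      (by simpa using h.append_right r), ih]

theorem cable_append_left (ℓ : I → ℕ) {w w' : List I} {b : Braid} (h : Bicolored κ w b w')
    (r : List I) : cable (blockSizes ℓ (r ++ w)) (shift r.length b) =
      shift (r.map ℓ).sum (cable (blockSizes ℓ w) b) := by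
  induction h with
  | nil => simp [cable_one]
  | pos u x y v h _ ih =>
    have := cable_pos ℓ (u := r ++ u) (x := x) (y := y) (v := v) (by simpa using h.append_left r)
    rw [cable_pos _ h, map_mul, map_mul, ← ih, shift_σ, ← List.length_append, this]
    simp [shift_shift]
  | neg u x y v h _ ih =>
    have := cable_neg ℓ (u := r ++ u) (x := x) (y := y) (v := v) (by simpa using h.append_left r)
    rw [cable_neg _ h, map_mul, map_mul, ← ih, map_inv, shift_σ, ← List.length_append, this]
    simp [shift_shift]

theorem cable_strandCross (ℓ : I → ℕ) (x : I) (v : List I) :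
    cable (blockSizes ℓ (x :: v)) (strandCross v.length) = blockCross (ℓ x) (v.map ℓ).sum := by
  induction v using List.reverseRecOn with
  | nil => simp [strandCross, cable_one, blockCross_zero_right]
  | append_singleton v y ih =>
    have h := Bicolored.strand (κ := fun _ => Color.closed) x rfl v
    have h' := h.append_right [y]
    rw [List.length_append, List.length_singleton, strandCross,
      cable_pos ℓ (u := v) (x := x) (y := y) (v := []) (by simpa using h')]
    have := cable_append_right ℓ h [y]
    rw [List.cons_append] at this
    rw [this, ih, List.map_append, List.sum_append, blockCross_add_right]
    simp

theorem cable_blockCross (ℓ : I → ℕ) (u v : List I) :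
    cable (blockSizes ℓ (u ++ v)) (blockCross u.length v.length) =
      blockCross (u.map ℓ).sum (v.map ℓ).sum := by
  induction u using List.reverseRecOn with
  | nil => simp [blockCross, cable_one]
  | append_singleton u x ih =>
    have h1 := Bicolored.strand (κ := fun _ => Color.closed) x rfl v
    have h2 := h1.append_left u
    have h3 := Bicolored.block (κ := fun _ => Color.closed) u v (fun _ _ => rfl)
    have e := cable_trans ℓ h2 (blockCross u.length v.length)
    have e' := cable_append_right ℓ h3 [x]
    rw [List.append_assoc] at e'
    rw [List.length_append, List.length_singleton, blockCross, List.append_assoc,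
      List.singleton_append, e, cable_append_left ℓ h1, e', ih, cable_strandCross]
    simp [blockCross_add_left]

theorem juxtapose_map {I' : Type} (e : I → I') (ℓ : I' → ℕ) (β : I' → Braid) (w : List I) :
    juxtapose ℓ β (w.map e) = juxtapose (fun i => ℓ (e i)) (fun i => β (e i)) w := by
  induction w with
  | nil => rfl
  | cons x w ih => simp [juxtapose, ih]

theorem juxtapose_substWord {J : I → Type} (W : ∀ i, List (J i)) (ℓ : (Σ i, J i) → ℕ)
    (δ : (Σ i, J i) → Braid) (w : List I) :
    juxtapose ℓ δ (substWord W w) = juxtapose (fun i => ((W i).map fun j => ℓ ⟨i, j⟩).sum)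
      (fun i => juxtapose (fun j => ℓ ⟨i, j⟩) (fun j => δ ⟨i, j⟩) (W i)) w := by
  induction w with
  | nil => rfl
  | cons i w ih =>
    rw [substWord, List.flatMap_cons, juxtapose_append, ih, juxtapose_map, juxtapose, List.map_map]
    rfl

theorem blockSizes_map {I' : Type} (e : I → I') (ℓ : I' → ℕ) (w : List I) :
    blockSizes ℓ (w.map e) = blockSizes (fun i => ℓ (e i)) w := by
  funext p
  simp [blockSizes, Function.comp_def]

theorem cable_juxtapose {J : I → Type} {κJ : ∀ i, J i → Color} {W W' : ∀ i, List (J i)}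
    {β : I → Braid} (hβ : ∀ i, Bicolored (κJ i) (W i) (β i) (W' i)) (ℓ : (Σ i, J i) → ℕ)
    (w : List I) :
    cable (blockSizes ℓ (substWord W w)) (juxtapose (fun i => (W i).length) β w) =
      juxtapose (fun i => ((W i).map fun j => ℓ ⟨i, j⟩).sum)
        (fun i => cable (blockSizes (fun j => ℓ ⟨i, j⟩) (W i)) (β i)) w := by
  induction w with
  | nil => exact cable_one _
  | cons i w ih =>
    have h1 := Bicolored.map (Sigma.mk i) (κ := fun p : Σ i, J i => κJ p.1 p.2) (hβ i)
    have h2 := h1.append_right (substWord W w)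
    have h3 := Bicolored.juxtapose hβ w
    have e := cable_append_left ℓ h3 ((W' i).map (Sigma.mk i))
    rw [List.length_map, ← (hβ i).perm.length_eq, List.map_map,
      ← ((hβ i).perm.map _).sum_eq] at e
    rw [substWord, List.flatMap_cons, juxtapose, cable_trans ℓ h2, e, ih, juxtapose,
      cable_append_right ℓ h1, blockSizes_map]
    rfl

theorem cable_cable {J : I → Type} (W : ∀ i, List (J i)) (ℓ : (Σ i, J i) → ℕ)
    {w w' : List I} {b : Braid} (h : Bicolored κ w b w') :
    cable (blockSizes ℓ (substWord W w)) (cable (blockSizes (fun i => (W i).length) w) b) =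
      cable (blockSizes (fun i => ((W i).map fun j => ℓ ⟨i, j⟩).sum) w) b := by
  have key : ∀ (u : List I) (x y : I) (v : List I),
      cable (blockSizes ℓ (substWord W (u ++ x :: y :: v)))
        (shift (u.map fun i => (W i).length).sum (blockCross (W x).length (W y).length)) =
      shift (u.map fun i => ((W i).map fun j => ℓ ⟨i, j⟩).sum).sum
        (blockCross ((W x).map fun j => ℓ ⟨x, j⟩).sum ((W y).map fun j => ℓ ⟨y, j⟩).sum) := by
    intro u x y v
    have h1 := Bicolored.block (κ := fun _ => Color.closed) ((W x).map (Sigma.mk x))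
      ((W y).map (Sigma.mk y)) (fun _ _ => rfl)
    have h2 := h1.append_right (substWord W v)
    have e := cable_append_left ℓ h2 (substWord W u)
    rw [length_substWord, cable_append_right ℓ h1, cable_blockCross] at e
    have e2 : substWord W (u ++ x :: y :: v) = substWord W u ++
      ((W x).map (Sigma.mk x) ++ (W y).map (Sigma.mk y) ++ substWord W v) := by
      simp [substWord]
    have e3 : ((substWord W u).map ℓ).sum =
        (u.map fun i => ((W i).map fun j => ℓ ⟨i, j⟩).sum).sum := by
      clear e e2
      induction u with
      | nil => rfl
      | cons a u ih => simp [ih, Function.comp_def]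
    rw [e2]
    rw [e3, List.length_map, List.length_map, List.map_map, List.map_map] at e
    exact e
  have tr : ∀ {w w' : List I} {b : Braid} (_ : Bicolored κ w b w') (b' : Braid),
      cable (blockSizes ℓ (substWord W w))
        (cable (blockSizes (fun i => (W i).length) w) b * b') =
      cable (blockSizes ℓ (substWord W w)) (cable (blockSizes (fun i => (W i).length) w) b) *
        cable (blockSizes ℓ (substWord W w')) b' := by
    intro w w' b h b'
    exact cable_trans ℓ (Bicolored.cable (κJ := fun _ _ => Color.closed) (W := W)
      (fun _ _ _ _ => rfl) h) b'
  induction h with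
  | nil => rw [cable_one, cable_one, cable_one]
  | pos u x y v h _ ih => rw [cable_pos _ h, tr h, ih, key, cable_pos _ h]
  | neg u x y v h _ ih =>
    have h1 : Bicolored (fun _ => Color.closed) (substWord W (u ++ y :: x :: v))
        (cable (blockSizes (fun i => (W i).length) (u ++ y :: x :: v)) (σ u.length))
        (substWord W (u ++ x :: y :: v)) := by
      have := Bicolored.pos (κ := fun _ => Color.closed) u y x v (Bicolored.nil _) rfl
      rw [one_mul] at this
      exact Bicolored.cable (κJ := fun _ _ => Color.closed) (fun _ _ _ _ => rfl) this
    rw [cable_σ, cableGen_blockSizes] at h1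
    have h2 := cable_trans ℓ h1.symm
      (shift (u.map fun i => (W i).length).sum (blockCross (W y).length (W x).length))
    rw [inv_mul_cancel, cable_one, key] at h2
    rw [cable_neg _ h, tr h, ih, cable_neg _ h, eq_inv_of_mul_eq_one_left h2.symm]

theorem insertBraids_assoc {J : I → Type} {κJ : ∀ i, J i → Color} {W W' : ∀ i, List (J i)}
    {β : I → Braid} (hβ : ∀ i, Bicolored (κJ i) (W i) (β i) (W' i)) (ℓ : (Σ i, J i) → ℕ)
    (δ : (Σ i, J i) → Braid) {w w' : List I} {b : Braid} (h : Bicolored κ w b w') :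
    insertBraids ℓ (substWord W w) (insertBraids (fun i => (W i).length) w b β) δ =
      insertBraids (fun i => ((W i).map fun j => ℓ ⟨i, j⟩).sum) w b
        (fun i => insertBraids (fun j => ℓ ⟨i, j⟩) (W i) (β i) (fun j => δ ⟨i, j⟩)) := by
  have e : ∀ i, (W i).length = (W' i).length := fun i => (hβ i).perm.length_eq
  have e' : (fun i => ((W i).map fun j => ℓ ⟨i, j⟩).sum) =
      fun i => ((W' i).map fun j => ℓ ⟨i, j⟩).sum :=
    funext fun i => ((hβ i).perm.map _).sum_eq
  simp only [insertBraids]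
  rw [cable_trans ℓ (Bicolored.juxtapose hβ w), cable_juxtapose hβ, juxtapose_substWord,
    juxtapose_mul _ (fun i => cable_mem _ (hβ i)), mul_assoc]
  congr 2
  simp only [e]
  rw [cable_cable W' ℓ h, e']

theorem insertBraids_map {I' : Type} (e : I → I') (ℓ : I' → ℕ) (b : Braid) (β : I' → Braid)
    (w : List I) : insertBraids ℓ (w.map e) b β =
      insertBraids (fun i => ℓ (e i)) w b (fun i => β (e i)) := by
  rw [insertBraids, insertBraids, juxtapose_map]
  congr 2
  funext p
  simp [blockSizes, Function.comp_def]

end insert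

set_option linter.checkUnivs false in
/-- A (symmetric, strict) colored operad in the category of categories, with set of colors `S`.
The inputs of an operation are labelled by an arbitrary finite set `I`, the input `i` having the
color `κ i`; the symmetric group actions are given by the relabellings along bijections. -/
structure CatOperad (S : Type) where
  /-- The category of operations with inputs `κ` and output `d`. -/
  Op : (I : Type) → [Finite I] → (I → S) → S → Type w'
  [cat : ∀ (I : Type) [Finite I] (κ : I → S) (d : S), Category.{w} (Op I κ d)]
  /-- The relabelling of the inputs along a bijection. -/
  relabel : ∀ {I J : Type} [Finite I] [Finite J] (e : I ≃ J) (κ : J → S) (d : S),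
    Op I (κ ∘ e) d ⥤ Op J κ d
  /-- The operadic unit. -/
  one : ∀ d : S, Op Unit (fun _ => d) d
  /-- The operadic composition, on objects: `y i` is inserted in the input `i` of `x`. -/
  comp : ∀ {I : Type} [Finite I] {J : I → Type} [∀ i, Finite (J i)] {κ : I → S}
    {κJ : ∀ i, J i → S} {d : S} (_x : Op I κ d) (_y : ∀ i, Op (J i) (κJ i) (κ i)),
    Op (Σ i, J i) (fun p => κJ p.1 p.2) d
  /-- The operadic composition, on morphisms. -/
  compMap : ∀ {I : Type} [Finite I] {J : I → Type} [∀ i, Finite (J i)] {κ : I → S}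
    {κJ : ∀ i, J i → S} {d : S} {x x' : Op I κ d} {y y' : ∀ i, Op (J i) (κJ i) (κ i)}
    (_f : x ⟶ x') (_g : ∀ i, y i ⟶ y' i), comp x y ⟶ comp x' y'
  -- the composition is a functor
  compMap_id : ∀ {I : Type} [Finite I] {J : I → Type} [∀ i, Finite (J i)] {κ : I → S}
    {κJ : ∀ i, J i → S} {d : S} (x : Op I κ d) (y : ∀ i, Op (J i) (κJ i) (κ i)),
    compMap (𝟙 x) (fun i => 𝟙 (y i)) = 𝟙 (comp x y)
  compMap_comp : ∀ {I : Type} [Finite I] {J : I → Type} [∀ i, Finite (J i)] {κ : I → S}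
    {κJ : ∀ i, J i → S} {d : S} {x x' x'' : Op I κ d} {y y' y'' : ∀ i, Op (J i) (κJ i) (κ i)}
    (f : x ⟶ x') (f' : x' ⟶ x'') (g : ∀ i, y i ⟶ y' i) (g' : ∀ i, y' i ⟶ y'' i),
    compMap (f ≫ f') (fun i => g i ≫ g' i) = compMap f g ≫ compMap f' g'
  -- the relabelling is an action
  relabel_refl : ∀ {I : Type} [Finite I] (κ : I → S) (d : S),
    relabel (Equiv.refl I) κ d = 𝟭 _
  relabel_trans : ∀ {I J K : Type} [Finite I] [Finite J] [Finite K] (e : I ≃ J) (g : J ≃ K)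
    (κ : K → S) (d : S),
    relabel (e.trans g) κ d = relabel e (κ ∘ g) d ⋙ relabel g κ d
  -- the composition is unital
  one_comp : ∀ {I : Type} [Finite I] {κ : I → S} {d : S} (x : Op I κ d),
    (relabel ⟨fun p : Σ _ : Unit, I => p.2, fun i => ⟨(), i⟩, fun _ => rfl, fun _ => rfl⟩ κ d).obj
      (comp (one d) fun _ => x) = x
  one_compMap : ∀ {I : Type} [Finite I] {κ : I → S} {d : S} {x x' : Op I κ d} (f : x ⟶ x'),
    (relabel ⟨fun p : Σ _ : Unit, I => p.2, fun i => ⟨(), i⟩, fun _ => rfl, fun _ => rfl⟩ κ d).map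
      (compMap (𝟙 (one d)) fun _ => f) ≍ f
  comp_one : ∀ {I : Type} [Finite I] {κ : I → S} {d : S} (x : Op I κ d),
    (relabel ⟨fun p : Σ _ : I, Unit => p.1, fun i => ⟨i, ()⟩, fun _ => rfl, fun _ => rfl⟩ κ d).obj
      (comp x fun i => one (κ i)) = x
  compMap_one : ∀ {I : Type} [Finite I] {κ : I → S} {d : S} {x x' : Op I κ d} (f : x ⟶ x'),
    (relabel ⟨fun p : Σ _ : I, Unit => p.1, fun i => ⟨i, ()⟩, fun _ => rfl, fun _ => rfl⟩ κ d).map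
      (compMap f fun i => 𝟙 (one (κ i))) ≍ f
  -- the composition is associative
  comp_assoc : ∀ {I : Type} [Finite I] {J : I → Type} [∀ i, Finite (J i)] {K : ∀ i, J i → Type}
    [∀ i j, Finite (K i j)] {κ : I → S} {κJ : ∀ i, J i → S} {κK : ∀ i j, K i j → S} {d : S}
    (x : Op I κ d) (y : ∀ i, Op (J i) (κJ i) (κ i)) (z : ∀ i j, Op (K i j) (κK i j) (κJ i j)),
    (relabel (Equiv.sigmaAssoc K) (fun q => κK q.1 q.2.1 q.2.2) d).obj
      (comp (comp x y) fun p => z p.1 p.2) = comp x fun i => comp (y i) (z i)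
  compMap_assoc : ∀ {I : Type} [Finite I] {J : I → Type} [∀ i, Finite (J i)]
    {K : ∀ i, J i → Type} [∀ i j, Finite (K i j)] {κ : I → S} {κJ : ∀ i, J i → S}
    {κK : ∀ i j, K i j → S} {d : S} {x x' : Op I κ d} {y y' : ∀ i, Op (J i) (κJ i) (κ i)}
    {z z' : ∀ i j, Op (K i j) (κK i j) (κJ i j)}
    (f : x ⟶ x') (g : ∀ i, y i ⟶ y' i) (h : ∀ i j, z i j ⟶ z' i j),
    (relabel (Equiv.sigmaAssoc K) (fun q => κK q.1 q.2.1 q.2.2) d).map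
      (compMap (compMap f g) fun p => h p.1 p.2) ≍ compMap f fun i => compMap (g i) (h i)
  -- the composition is equivariant
  relabel_comp : ∀ {I I' : Type} [Finite I] [Finite I'] {J : I' → Type} [∀ i, Finite (J i)]
    (e : I ≃ I') {κ : I' → S} {κJ : ∀ i, J i → S} {d : S} (x : Op I (κ ∘ e) d)
    (y : ∀ i, Op (J i) (κJ i) (κ i)),
    comp ((relabel e κ d).obj x) y =
      (relabel (Equiv.sigmaCongrLeft e) (fun p : Σ i, J i => κJ p.1 p.2) d).obj
        (comp x fun i => y (e i))
  relabel_compMap : ∀ {I I' : Type} [Finite I] [Finite I'] {J : I' → Type} [∀ i, Finite (J i)]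
    (e : I ≃ I') {κ : I' → S} {κJ : ∀ i, J i → S} {d : S} {x x' : Op I (κ ∘ e) d}
    {y y' : ∀ i, Op (J i) (κJ i) (κ i)} (f : x ⟶ x') (g : ∀ i, y i ⟶ y' i),
    compMap ((relabel e κ d).map f) g ≍
      (relabel (Equiv.sigmaCongrLeft e) (fun p : Σ i, J i => κJ p.1 p.2) d).map
        (compMap f fun i => g (e i))
  comp_relabel : ∀ {I : Type} [Finite I] {J J' : I → Type} [∀ i, Finite (J i)]
    [∀ i, Finite (J' i)] (e : ∀ i, J i ≃ J' i) {κ : I → S} {κJ : ∀ i, J' i → S} {d : S}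
    (x : Op I κ d) (y : ∀ i, Op (J i) (κJ i ∘ e i) (κ i)),
    comp x (fun i => (relabel (e i) (κJ i) (κ i)).obj (y i)) =
      (relabel (Equiv.sigmaCongrRight e) (fun p : Σ i, J' i => κJ p.1 p.2) d).obj (comp x y)
  compMap_relabel : ∀ {I : Type} [Finite I] {J J' : I → Type} [∀ i, Finite (J i)]
    [∀ i, Finite (J' i)] (e : ∀ i, J i ≃ J' i) {κ : I → S} {κJ : ∀ i, J' i → S} {d : S}
    {x x' : Op I κ d} {y y' : ∀ i, Op (J i) (κJ i ∘ e i) (κ i)}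
    (f : x ⟶ x') (g : ∀ i, y i ⟶ y' i),
    compMap f (fun i => (relabel (e i) (κJ i) (κ i)).map (g i)) ≍
      (relabel (Equiv.sigmaCongrRight e) (fun p : Σ i, J' i => κJ p.1 p.2) d).map (compMap f g)

attribute [instance] CatOperad.cat

/-- A morphism of colored operads in categories: functors between the categories of operations,
strictly compatible with the relabellings, the units and the compositions. -/
structure CatOperad.Hom {S : Type} (P : CatOperad.{w, w'} S) (Q : CatOperad.{v, u} S) where
  /-- The underlying functors. -/
  app : ∀ {I : Type} [Finite I] (κ : I → S) (d : S), P.Op I κ d ⥤ Q.Op I κ d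
  app_relabel : ∀ {I J : Type} [Finite I] [Finite J] (e : I ≃ J) (κ : J → S) (d : S),
    P.relabel e κ d ⋙ app κ d = app (κ ∘ e) d ⋙ Q.relabel e κ d
  app_one : ∀ d : S, (app (fun _ => d) d).obj (P.one d) = Q.one d
  app_comp : ∀ {I : Type} [Finite I] {J : I → Type} [∀ i, Finite (J i)] {κ : I → S}
    {κJ : ∀ i, J i → S} {d : S} (x : P.Op I κ d) (y : ∀ i, P.Op (J i) (κJ i) (κ i)),
    (app (fun p : Σ i, J i => κJ p.1 p.2) d).obj (P.comp x y) =
      Q.comp ((app κ d).obj x) fun i => (app (κJ i) (κ i)).obj (y i)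
  app_compMap : ∀ {I : Type} [Finite I] {J : I → Type} [∀ i, Finite (J i)] {κ : I → S}
    {κJ : ∀ i, J i → S} {d : S} {x x' : P.Op I κ d} {y y' : ∀ i, P.Op (J i) (κJ i) (κ i)}
    (f : x ⟶ x') (g : ∀ i, y i ⟶ y' i),
    (app (fun p : Σ i, J i => κJ p.1 p.2) d).map (P.compMap f g) ≍
      Q.compMap ((app κ d).map f) fun i => (app (κJ i) (κ i)).map (g i)

/-- The endomorphism operad of a family of categories: the operations are the functors
`∏ i, C (κ i) ⥤ C d`, and the morphisms are the natural transformations. -/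
def endOperad {S : Type} (C : S → Type u) [∀ s, Category.{v} (C s)] :
    CatOperad.{max u v, max u v} S where
  Op I _ κ d := (∀ i : I, C (κ i)) ⥤ C d
  relabel e κ d := (Functor.whiskeringLeft _ _ _).obj (Pi.comap (fun j => C (κ j)) e)
  one d := Pi.eval (fun _ : Unit => C d) ()
  comp x y :=
    { obj := fun X => x.obj fun i => (y i).obj fun j => X ⟨i, j⟩
      map := fun f => x.map fun i => (y i).map fun j => f ⟨i, j⟩
      map_id := fun X => by
        rw [← x.map_id]; congr 1; funext i; exact (y i).map_id _
      map_comp := fun f g => by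
        rw [← x.map_comp]; congr 1; funext i; exact (y i).map_comp _ _ }
  compMap {I _ J _ κ κJ d x x' y y'} f g :=
    { app := fun X => f.app _ ≫ x'.map fun i => (g i).app fun j => X ⟨i, j⟩
      naturality := fun X Y h => by
        simp only [NatTrans.naturality_assoc, Category.assoc, ← Functor.map_comp]
        congr 2
        funext i
        exact (g i).naturality _ }
  compMap_id x y := by
    ext X
    exact (Category.id_comp _).trans (x.map_id _)
  compMap_comp {I _ J _ κ κJ d x x' x'' y y' y''} f f' g g' := by
    ext X
    simp only [NatTrans.comp_app, Category.assoc]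
    rw [NatTrans.naturality_assoc, ← Functor.map_comp]
    rfl
  relabel_refl _ _ := rfl
  relabel_trans _ _ _ _ := rfl
  one_comp _ := rfl
  one_compMap _ := heq_of_eq (by
    ext X
    exact Category.id_comp _)
  comp_one _ := rfl
  compMap_one {I _ κ d x x'} f := heq_of_eq (by
    ext X
    exact (congrArg (f.app X ≫ ·) (x'.map_id _)).trans (Category.comp_id _))
  comp_assoc _ _ _ := rfl
  compMap_assoc {I _ J _ K _ κ κJ κK d x x' y y' z z'} f g h := heq_of_eq (by
    ext X
    refine (Category.assoc _ _ _).trans (congrArg (f.app _ ≫ ·) ?_)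
    exact (x'.map_comp _ _).symm)
  relabel_comp := by intros; rfl
  relabel_compMap := by intros; rfl
  comp_relabel := by intros; rfl
  compMap_relabel := by intros; rfl

/-! ### The operad of parenthesized permutations and braids -/

/-- The objects of `PaPB`: the operations of the free two-colored operad on `μ_c`, `f` and `μ_o`,
i.e. the terms in which each input occurs exactly once. -/
@[ext]
structure PaPBObj {I : Type} (κ : I → Color) (d : Color) where
  /-- The underlying term. -/
  term : Term κ d
  nodup : term.word.Nodup
  complete : ∀ i, i ∈ term.word

namespace PaPBObj

variable {I : Type} {κ : I → Color} {d : Color}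

/-- The underlying sequence of colored points, obtained by forgetting the parentheses. -/
abbrev word (x : PaPBObj κ d) : List I := x.term.word

/-- A morphism of `PaPB`: a bicolored braid between the underlying sequences of points. -/
@[ext]
structure Hom (x y : PaPBObj κ d) where
  /-- The underlying braid. -/
  braid : Braid
  bicolored : Bicolored κ x.word braid y.word

instance : Category (PaPBObj κ d) where
  Hom := Hom
  id _ := ⟨1, Bicolored.nil _⟩
  comp f g := ⟨f.braid * g.braid, f.bicolored.trans g.bicolored⟩
  id_comp _ := Hom.ext (one_mul _)
  comp_id _ := Hom.ext (mul_one _)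
  assoc _ _ _ := Hom.ext (mul_assoc _ _ _)

/-- `PaPB` is an operad in groupoids. -/
instance : Groupoid (PaPBObj κ d) where
  inv f := ⟨f.braid⁻¹, f.bicolored.symm⟩
  inv_comp f := Hom.ext (inv_mul_cancel f.braid)
  comp_inv f := Hom.ext (mul_inv_cancel f.braid)

theorem hom_ext {x y : PaPBObj κ d} {f g : x ⟶ y} (h : f.braid = g.braid) : f = g := Hom.ext h

theorem hom_heq {x y x' y' : PaPBObj κ d} {f : x ⟶ y} {g : x' ⟶ y'} (hx : x = x') (hy : y = y')
    (h : f.braid = g.braid) : f ≍ g := by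
  subst hx hy
  exact heq_of_eq (hom_ext h)

theorem sum_word [Finite I] (x : PaPBObj κ d) (ℓ : I → ℕ) : (x.word.map ℓ).sum = ∑ᶠ i, ℓ i := by
  classical
  have : Fintype I := Fintype.ofFinite I
  rw [finsum_eq_sum_of_fintype, ← List.sum_toFinset ℓ x.nodup]
  congr 1
  ext i
  simpa using x.complete i

theorem length_word [Finite I] (x : PaPBObj κ d) : x.word.length = Nat.card I := by
  have h := x.sum_word fun _ => 1
  have : Fintype I := Fintype.ofFinite I
  rw [finsum_eq_sum_of_fintype] at h
  simpa [Nat.card_eq_fintype_card] using h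

/-- Relabelling of the inputs. -/
def relabel {J : Type} (e : I ≃ J) (κ : J → Color) (x : PaPBObj (κ ∘ e) d) : PaPBObj κ d where
  term := x.term.relabel e κ
  nodup := by
    rw [Term.word_relabel]
    exact x.nodup.map e.injective
  complete j := by
    rw [Term.word_relabel]
    exact List.mem_map.2 ⟨e.symm j, x.complete _, e.apply_symm_apply j⟩

/-- Substitution. -/
def comp {J : I → Type} {κJ : ∀ i, J i → Color} (x : PaPBObj κ d)
    (y : ∀ i, PaPBObj (κJ i) (κ i)) : PaPBObj (fun p : Σ i, J i => κJ p.1 p.2) d where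
  term := x.term.subst κJ fun i => (y i).term
  nodup := by
    rw [Term.word_subst, List.nodup_flatMap]
    refine ⟨fun i _ => (y i).nodup.map sigma_mk_injective, x.nodup.imp ?_⟩
    intro i i' hii' p hp hp'
    obtain ⟨j, _, rfl⟩ := List.mem_map.1 hp
    obtain ⟨j', _, h⟩ := List.mem_map.1 hp'
    exact hii' (congrArg Sigma.fst h).symm
  complete p := by
    rw [Term.word_subst]
    exact List.mem_flatMap.2 ⟨p.1, x.complete _, List.mem_map.2 ⟨p.2, (y p.1).complete _, rfl⟩⟩

theorem word_comp {J : I → Type} {κJ : ∀ i, J i → Color} (x : PaPBObj κ d)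
    (y : ∀ i, PaPBObj (κJ i) (κ i)) : (comp x y).word = substWord (fun i => (y i).word) x.word :=
  Term.word_subst κJ (fun i => (y i).term) x.term

theorem Hom.mem_bounded [Finite I] {x y : PaPBObj κ d} (f : x ⟶ y) :
    f.braid ∈ Braid.bounded (Nat.card I) := by
  rw [← x.length_word]
  exact f.bicolored.mem_bounded

/-- Insertion of the bicolored braids `g i` in the strands of the bicolored braid `f`. -/
noncomputable def compMap {J : I → Type} [∀ i, Finite (J i)] {κJ : ∀ i, J i → Color} {x x' : PaPBObj κ d}
    {y y' : ∀ i, PaPBObj (κJ i) (κ i)} (f : x ⟶ x') (g : ∀ i, y i ⟶ y' i) :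
    comp x y ⟶ comp x' y' where
  braid := insertBraids (fun i => Nat.card (J i)) x.word f.braid fun i => (g i).braid
  bicolored := by
    rw [word_comp, word_comp]
    have := Bicolored.insert (fun i => (g i).bicolored)
      (fun i hi => (y' i).term.closed_of_mem hi) f.bicolored
    simpa only [length_word] using this

end PaPBObj

open PaPBObj in
/-- The operad `PaPB` of parenthesized permutations and braids, with colors `closed` and
`opened`. -/
noncomputable def PaPB : CatOperad.{0, 0} Color where
  Op _ _ κ d := PaPBObj κ d
  relabel e κ d :=
    { obj := fun x => x.relabel e κ
      map := fun {x y} f => ⟨f.braid, by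
        have := Bicolored.map e f.bicolored
        rwa [← Term.word_relabel, ← Term.word_relabel] at this⟩
      map_id := fun _ => rfl
      map_comp := fun _ _ => rfl }
  one d := ⟨Term.leaf (κ := fun _ : Unit => d) (), by simp [Term.word], by simp [Term.word]⟩
  comp x y := PaPBObj.comp x y
  compMap f g := PaPBObj.compMap f g
  compMap_id x y := hom_ext (insertBraids_one _ _)
  compMap_comp f f' g g' :=
    hom_ext (insertBraids_mul (fun i => Hom.mem_bounded (g' i)) f.bicolored f'.braid)
  relabel_refl κ _ := Functor.hext (fun x => PaPBObj.ext (Term.relabel_id κ x.term))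
    (fun x y _ => hom_heq (PaPBObj.ext (Term.relabel_id κ x.term))
      (PaPBObj.ext (Term.relabel_id κ y.term)) rfl)
  relabel_trans e g κ _ :=
    have h (x) : _ := PaPBObj.ext (Term.relabel_relabel e g κ x.term).symm
    Functor.hext h fun x y _ => hom_heq (h x) (h y) rfl
  one_comp {I _ κ d} x := by exact PaPBObj.ext (Term.subst_one_left x.term)
  one_compMap {I _ κ d x x'} f := by
    refine hom_heq (PaPBObj.ext (Term.subst_one_left x.term))
      (PaPBObj.ext (Term.subst_one_left x'.term)) ?_
    show insertBraids _ [()] 1 _ = f.braid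
    simp [insertBraids, juxtapose, Braid.cable_one]
  comp_one x := PaPBObj.ext (Term.subst_one_right x.term)
  compMap_one {I _ κ d x x'} f := by
    refine hom_heq (PaPBObj.ext (Term.subst_one_right x.term))
      (PaPBObj.ext (Term.subst_one_right x'.term)) ?_
    show insertBraids (fun _ => Nat.card Unit) x.word f.braid (fun _ => 1) = f.braid
    rw [insertBraids, juxtapose_one, one_mul, Nat.card_unique]
    exact cable_ones _ f.bicolored
  comp_assoc {I _ J _ K _ κ κJ κK d} x y z := PaPBObj.ext
    (Term.subst_assoc κJ κK (fun i => (y i).term) (fun i j => (z i j).term) x.term)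
  compMap_assoc {I _ J _ K _ κ κJ κK d x x' y y' z z'} f g h := by
    refine hom_heq
      (PaPBObj.ext (Term.subst_assoc κJ κK (fun i => (y i).term) (fun i j => (z i j).term) x.term))
      (PaPBObj.ext
        (Term.subst_assoc κJ κK (fun i => (y' i).term) (fun i j => (z' i j).term) x'.term)) ?_
    show insertBraids (fun p : Σ i, J i => Nat.card (K p.1 p.2)) (PaPBObj.comp x y).word
        (insertBraids (fun i => Nat.card (J i)) x.word f.braid fun i => (g i).braid)
        (fun p => (h p.1 p.2).braid) =
      insertBraids (fun i => Nat.card (Σ j, K i j)) x.word f.braid (fun i =>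
        insertBraids (fun j => Nat.card (K i j)) (y i).word (g i).braid fun j => (h i j).braid)
    have e := insertBraids_assoc (fun i => (g i).bicolored)
      (fun p : Σ i, J i => Nat.card (K p.1 p.2)) (fun p => (h p.1 p.2).braid) f.bicolored
    rw [word_comp]
    simp only [length_word] at e
    rw [e]
    congr 1
    funext i
    have : Fintype (J i) := Fintype.ofFinite _
    rw [Nat.card_sigma, sum_word, finsum_eq_sum_of_fintype]
  relabel_comp {I I' _ _ J _} e {κ κJ d} x y :=
    PaPBObj.ext (Term.subst_relabel e κ κJ (fun i => (y i).term) x.term)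
  relabel_compMap {I I' _ _ J _} e {κ κJ d x x' y y'} f g := by
    refine hom_heq (PaPBObj.ext (Term.subst_relabel e κ κJ (fun i => (y i).term) x.term))
      (PaPBObj.ext (Term.subst_relabel e κ κJ (fun i => (y' i).term) x'.term)) ?_
    show insertBraids _ (x.term.relabel e κ).word _ _ = insertBraids _ x.word _ _
    rw [Term.word_relabel, insertBraids_map]
  comp_relabel {I _ J J' _ _} e {κ κJ d} x y :=
    PaPBObj.ext (Term.subst_relabel_inner (fun i => e i) κJ (fun i => (y i).term) x.term)
  compMap_relabel {I _ J J' _ _} e {κ κJ d x x' y y'} f g := by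
    refine hom_heq
      (PaPBObj.ext (Term.subst_relabel_inner (fun i => e i) κJ (fun i => (y i).term) x.term))
      (PaPBObj.ext
        (Term.subst_relabel_inner (fun i => e i) κJ (fun i => (y' i).term) x'.term)) ?_
    show insertBraids (fun i => Nat.card (J' i)) _ _ _ = insertBraids (fun i => Nat.card (J i)) _ _ _
    congr 1
    funext i
    exact (Nat.card_congr (e i)).symm

/-! ### Non-unital monoidal categories and the Drinfeld center -/

/-- A non-unital monoidal structure on a category. -/
class SemigroupalCategory (C : Type u) [Category.{v} C] where
  /-- The tensor product of objects. -/
  tensorObj : C → C → C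
  /-- The tensor product of morphisms. -/
  tensorHom : ∀ {X₁ Y₁ X₂ Y₂ : C}, (X₁ ⟶ Y₁) → (X₂ ⟶ Y₂) → (tensorObj X₁ X₂ ⟶ tensorObj Y₁ Y₂)
  tensor_id : ∀ X Y : C, tensorHom (𝟙 X) (𝟙 Y) = 𝟙 (tensorObj X Y)
  tensor_comp : ∀ {X₁ Y₁ Z₁ X₂ Y₂ Z₂ : C} (f₁ : X₁ ⟶ Y₁) (f₂ : X₂ ⟶ Y₂) (g₁ : Y₁ ⟶ Z₁)
    (g₂ : Y₂ ⟶ Z₂), tensorHom (f₁ ≫ g₁) (f₂ ≫ g₂) = tensorHom f₁ f₂ ≫ tensorHom g₁ g₂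
  /-- The associativity isomorphism. -/
  assoc : ∀ X Y Z : C, tensorObj (tensorObj X Y) Z ≅ tensorObj X (tensorObj Y Z)
  assoc_naturality : ∀ {X₁ X₂ X₃ Y₁ Y₂ Y₃ : C} (f₁ : X₁ ⟶ Y₁) (f₂ : X₂ ⟶ Y₂) (f₃ : X₃ ⟶ Y₃),
    tensorHom (tensorHom f₁ f₂) f₃ ≫ (assoc Y₁ Y₂ Y₃).hom =
      (assoc X₁ X₂ X₃).hom ≫ tensorHom f₁ (tensorHom f₂ f₃)
  pentagon : ∀ W X Y Z : C,
    tensorHom (assoc W X Y).hom (𝟙 Z) ≫ (assoc W (tensorObj X Y) Z).hom ≫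
        tensorHom (𝟙 W) (assoc X Y Z).hom =
      (assoc (tensorObj W X) Y Z).hom ≫ (assoc W X (tensorObj Y Z)).hom

namespace SemigroupalCategory

infixr:70 " ⊠ " => SemigroupalCategory.tensorObj
infixr:70 " ⊠ₘ " => SemigroupalCategory.tensorHom

section lemmas

variable {C : Type u} [Category.{v} C] [SemigroupalCategory C]

/-- Whiskering of an isomorphism on the left. -/
abbrev lIso (X : C) {Y Z : C} (e : Y ≅ Z) : X ⊠ Y ≅ X ⊠ Z where
  hom := 𝟙 X ⊠ₘ e.hom
  inv := 𝟙 X ⊠ₘ e.inv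
  hom_inv_id := by rw [← tensor_comp, e.hom_inv_id, Category.id_comp, tensor_id]
  inv_hom_id := by rw [← tensor_comp, e.inv_hom_id, Category.id_comp, tensor_id]

/-- Whiskering of an isomorphism on the right. -/
abbrev rIso {Y Z : C} (e : Y ≅ Z) (X : C) : Y ⊠ X ≅ Z ⊠ X where
  hom := e.hom ⊠ₘ 𝟙 X
  inv := e.inv ⊠ₘ 𝟙 X
  hom_inv_id := by rw [← tensor_comp, e.hom_inv_id, Category.id_comp, tensor_id]
  inv_hom_id := by rw [← tensor_comp, e.inv_hom_id, Category.id_comp, tensor_id]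

theorem l_comp (W : C) {X Y Z : C} (f : X ⟶ Y) (g : Y ⟶ Z) :
    (𝟙 W ⊠ₘ f) ≫ (𝟙 W ⊠ₘ g) = 𝟙 W ⊠ₘ (f ≫ g) := by
  rw [← tensor_comp, Category.id_comp]

theorem r_comp (W : C) {X Y Z : C} (f : X ⟶ Y) (g : Y ⟶ Z) :
    (f ⊠ₘ 𝟙 W) ≫ (g ⊠ₘ 𝟙 W) = (f ≫ g) ⊠ₘ 𝟙 W := by
  rw [← tensor_comp, Category.id_comp]

theorem exch {W X Y Z : C} (f : W ⟶ X) (g : Y ⟶ Z) :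
    (f ⊠ₘ 𝟙 Y) ≫ (𝟙 X ⊠ₘ g) = (𝟙 W ⊠ₘ g) ≫ (f ⊠ₘ 𝟙 Z) := by
  rw [← tensor_comp, ← tensor_comp]; simp

theorem hom_def {W X Y Z : C} (f : W ⟶ X) (g : Y ⟶ Z) :
    f ⊠ₘ g = (f ⊠ₘ 𝟙 Y) ≫ (𝟙 X ⊠ₘ g) := by
  rw [← tensor_comp]; simp

theorem assoc_inv_naturality {X₁ X₂ X₃ Y₁ Y₂ Y₃ : C} (f₁ : X₁ ⟶ Y₁) (f₂ : X₂ ⟶ Y₂)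
    (f₃ : X₃ ⟶ Y₃) : (f₁ ⊠ₘ (f₂ ⊠ₘ f₃)) ≫ (assoc Y₁ Y₂ Y₃).inv =
      (assoc X₁ X₂ X₃).inv ≫ ((f₁ ⊠ₘ f₂) ⊠ₘ f₃) := by
  rw [Iso.comp_inv_eq, Category.assoc, assoc_naturality, Iso.inv_hom_id_assoc]

/-! Variants of the pentagon. -/

theorem pentagon₁ (W X Y Z : C) :
    (assoc (W ⊠ X) Y Z).hom ≫ (assoc W X (Y ⊠ Z)).hom ≫ (𝟙 W ⊠ₘ (assoc X Y Z).inv) =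
      ((assoc W X Y).hom ⊠ₘ 𝟙 Z) ≫ (assoc W (X ⊠ Y) Z).hom := by
  rw [← reassoc_of% pentagon, (lIso W (assoc X Y Z)).hom_inv_id, Category.comp_id]

theorem pentagon₂ (W X Y Z : C) :
    ((assoc W X Y).inv ⊠ₘ 𝟙 Z) ≫ (assoc (W ⊠ X) Y Z).hom ≫ (assoc W X (Y ⊠ Z)).hom =
      (assoc W (X ⊠ Y) Z).hom ≫ (𝟙 W ⊠ₘ (assoc X Y Z).hom) := by
  rw [← pentagon, (rIso (assoc W X Y) Z).inv_hom_id_assoc]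

theorem pentagon₃ (W X Y Z : C) :
    (𝟙 W ⊠ₘ (assoc X Y Z).inv) ≫ (assoc W (X ⊠ Y) Z).inv ≫ ((assoc W X Y).inv ⊠ₘ 𝟙 Z) =
      (assoc W X (Y ⊠ Z)).inv ≫ (assoc (W ⊠ X) Y Z).inv := by
  have h : (rIso (assoc W X Y) Z ≪≫ assoc W (X ⊠ Y) Z ≪≫ lIso W (assoc X Y Z)) =
      assoc (W ⊠ X) Y Z ≪≫ assoc W X (Y ⊠ Z) := Iso.ext (pentagon W X Y Z)
  have := congrArg Iso.inv h
  simpa using this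

theorem pentagon₄ (W X Y Z : C) :
    (assoc (W ⊠ X) Y Z).inv ≫ ((assoc W X Y).hom ⊠ₘ 𝟙 Z) ≫ (assoc W (X ⊠ Y) Z).hom =
      (assoc W X (Y ⊠ Z)).hom ≫ (𝟙 W ⊠ₘ (assoc X Y Z).inv) := by
  rw [← pentagon₁, Iso.inv_hom_id_assoc]

end lemmas

/-- A braiding on a non-unital monoidal category. -/
class Braiding (C : Type u) [Category.{v} C] [SemigroupalCategory C] where
  /-- The braiding isomorphism. -/
  braid : ∀ X Y : C, X ⊠ Y ≅ Y ⊠ X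
  braid_naturality : ∀ {X₁ Y₁ X₂ Y₂ : C} (f : X₁ ⟶ Y₁) (g : X₂ ⟶ Y₂),
    (f ⊠ₘ g) ≫ (braid Y₁ Y₂).hom = (braid X₁ X₂).hom ≫ (g ⊠ₘ f)
  hexagon_forward : ∀ X Y Z : C,
    (assoc X Y Z).hom ≫ (braid X (Y ⊠ Z)).hom ≫ (assoc Y Z X).hom =
      ((braid X Y).hom ⊠ₘ 𝟙 Z) ≫ (assoc Y X Z).hom ≫ (𝟙 Y ⊠ₘ (braid X Z).hom)
  hexagon_reverse : ∀ X Y Z : C,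
    (assoc X Y Z).inv ≫ (braid (X ⊠ Y) Z).hom ≫ (assoc Z X Y).inv =
      (𝟙 X ⊠ₘ (braid Y Z).hom) ≫ (assoc X Z Y).inv ≫ ((braid X Z).hom ⊠ₘ 𝟙 Y)

/-- A strong braided monoidal functor between non-unital braided monoidal categories. -/
structure StrongBraidedFunctor (C : Type*) [Category* C] [SemigroupalCategory C] [Braiding C]
    (D : Type*) [Category* D] [SemigroupalCategory D] [Braiding D] extends C ⥤ D where
  /-- The structure isomorphism. -/
  μ : ∀ X Y : C, obj X ⊠ obj Y ≅ obj (X ⊠ Y)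
  μ_naturality : ∀ {X₁ Y₁ X₂ Y₂ : C} (f : X₁ ⟶ Y₁) (g : X₂ ⟶ Y₂),
    (map f ⊠ₘ map g) ≫ (μ Y₁ Y₂).hom = (μ X₁ X₂).hom ≫ map (f ⊠ₘ g)
  associativity : ∀ X Y Z : C,
    ((μ X Y).hom ⊠ₘ 𝟙 (obj Z)) ≫ (μ (X ⊠ Y) Z).hom ≫ map (assoc X Y Z).hom =
      (assoc (obj X) (obj Y) (obj Z)).hom ≫ (𝟙 (obj X) ⊠ₘ (μ Y Z).hom) ≫ (μ X (Y ⊠ Z)).hom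
  braided : ∀ X Y : C,
    (μ X Y).hom ≫ map (Braiding.braid X Y).hom =
      (Braiding.braid (obj X) (obj Y)).hom ≫ (μ Y X).hom

/-- A half-braiding on an object `X` of a non-unital monoidal category. -/
@[ext]
structure HalfBraiding {C : Type u} [Category.{v} C] [SemigroupalCategory C] (X : C) where
  /-- The components `X ⊗ Y ≅ Y ⊗ X`. -/
  β : ∀ Y : C, X ⊠ Y ≅ Y ⊠ X
  naturality : ∀ {Y Z : C} (f : Y ⟶ Z),
    (𝟙 X ⊠ₘ f) ≫ (β Z).hom = (β Y).hom ≫ (f ⊠ₘ 𝟙 X)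
  hexagon : ∀ Y Z : C,
    (assoc X Y Z).hom ≫ (β (Y ⊠ Z)).hom ≫ (assoc Y Z X).hom =
      ((β Y).hom ⊠ₘ 𝟙 Z) ≫ (assoc Y X Z).hom ≫ (𝟙 Y ⊠ₘ (β Z).hom)

/-- The Drinfeld center of a non-unital monoidal category: the objects are the objects of the
category equipped with a half-braiding. -/
structure Center (C : Type u) [Category.{v} C] [SemigroupalCategory C] where
  /-- The underlying object. -/
  obj : C
  /-- The half-braiding. -/
  half : HalfBraiding obj

namespace Center

variable {C : Type u} [Category.{v} C] [SemigroupalCategory C]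

/-- The morphisms of the Drinfeld center are those compatible with the half-braidings. -/
@[ext]
structure Hom (X Y : Center C) where
  /-- The underlying morphism. -/
  hom : X.obj ⟶ Y.obj
  comm : ∀ Z : C, (hom ⊠ₘ 𝟙 Z) ≫ (Y.half.β Z).hom = (X.half.β Z).hom ≫ (𝟙 Z ⊠ₘ hom)

instance : Category (Center C) where
  Hom := Hom
  id X := ⟨𝟙 X.obj, fun Z => by simp [tensor_id]⟩
  comp f g := ⟨f.hom ≫ g.hom, fun Z => by
    rw [← r_comp, ← l_comp, Category.assoc, g.comm, ← Category.assoc, f.comm, Category.assoc]⟩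
  id_comp f := Hom.ext (Category.id_comp _)
  comp_id f := Hom.ext (Category.comp_id _)
  assoc f g h := Hom.ext (Category.assoc _ _ _)

theorem hom_ext {X Y : Center C} {f g : X ⟶ Y} (h : f.hom = g.hom) : f = g := Hom.ext h

theorem comp_hom {X Y Z : Center C} (f : X ⟶ Y) (g : Y ⟶ Z) : (f ≫ g).hom = f.hom ≫ g.hom := rfl

theorem id_hom (X : Center C) : (𝟙 X : X ⟶ X).hom = 𝟙 X.obj := rfl

/-- An isomorphism of the category compatible with the half-braidings. -/
def mkIso {X Y : Center C} (e : X.obj ≅ Y.obj)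
    (comm : ∀ Z : C, (e.hom ⊠ₘ 𝟙 Z) ≫ (Y.half.β Z).hom = (X.half.β Z).hom ≫ (𝟙 Z ⊠ₘ e.hom)) :
    X ≅ Y where
  hom := ⟨e.hom, comm⟩
  inv := ⟨e.inv, fun Z => by
    have h1 : (e.inv ⊠ₘ 𝟙 Z) ≫ (e.hom ⊠ₘ 𝟙 Z) = 𝟙 _ := (rIso e Z).inv_hom_id
    have h2 : (𝟙 Z ⊠ₘ e.hom) ≫ (𝟙 Z ⊠ₘ e.inv) = 𝟙 _ := (lIso Z e).hom_inv_id
    calc _ = (e.inv ⊠ₘ 𝟙 Z) ≫ ((X.half.β Z).hom ≫ (𝟙 Z ⊠ₘ e.hom)) ≫ (𝟙 Z ⊠ₘ e.inv) := by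
            rw [Category.assoc, h2, Category.comp_id]
      _ = _ := by rw [← comm, Category.assoc, reassoc_of% h1]⟩
  hom_inv_id := Hom.ext e.hom_inv_id
  inv_hom_id := Hom.ext e.inv_hom_id

/-- The half-braiding on the tensor product. -/
def tensorβ (X X' : Center C) (Y : C) : (X.obj ⊠ X'.obj) ⊠ Y ≅ Y ⊠ (X.obj ⊠ X'.obj) :=
  assoc _ _ _ ≪≫ lIso X.obj (X'.half.β Y) ≪≫ (assoc _ _ _).symm ≪≫
    rIso (X.half.β Y) X'.obj ≪≫ assoc _ _ _

theorem tensorβ_hom (X X' : Center C) (Y : C) : (tensorβ X X' Y).hom =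
    (assoc _ _ _).hom ≫ (𝟙 X.obj ⊠ₘ (X'.half.β Y).hom) ≫ (assoc _ _ _).inv ≫
      ((X.half.β Y).hom ⊠ₘ 𝟙 X'.obj) ≫ (assoc _ _ _).hom := rfl

theorem tensorβ_naturality (X X' : Center C) {Y Z : C} (f : Y ⟶ Z) :
    (𝟙 (X.obj ⊠ X'.obj) ⊠ₘ f) ≫ (tensorβ X X' Z).hom =
      (tensorβ X X' Y).hom ≫ (f ⊠ₘ 𝟙 (X.obj ⊠ X'.obj)) := by
  rw [tensorβ_hom, tensorβ_hom, ← tensor_id, reassoc_of% assoc_naturality, reassoc_of% l_comp,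
    X'.half.naturality, ← reassoc_of% l_comp, reassoc_of% assoc_inv_naturality, reassoc_of% r_comp,
    X.half.naturality, ← reassoc_of% r_comp, assoc_naturality]
  simp only [Category.assoc]

theorem tensorHom_comm {X X' Y Y' : Center C} (f : X ⟶ Y) (g : X' ⟶ Y') (Z : C) :
    ((f.hom ⊠ₘ g.hom) ⊠ₘ 𝟙 Z) ≫ (tensorβ Y Y' Z).hom =
      (tensorβ X X' Z).hom ≫ (𝟙 Z ⊠ₘ (f.hom ⊠ₘ g.hom)) := by
  rw [tensorβ_hom, tensorβ_hom, reassoc_of% assoc_naturality]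
  have h1 : (f.hom ⊠ₘ (g.hom ⊠ₘ 𝟙 Z)) ≫ (𝟙 Y.obj ⊠ₘ (Y'.half.β Z).hom) =
      (𝟙 X.obj ⊠ₘ (X'.half.β Z).hom) ≫ (f.hom ⊠ₘ (𝟙 Z ⊠ₘ g.hom)) := by
    rw [← tensor_comp, ← tensor_comp, g.comm]; simp
  have h2 : ((f.hom ⊠ₘ 𝟙 Z) ⊠ₘ g.hom) ≫ ((Y.half.β Z).hom ⊠ₘ 𝟙 Y'.obj) =
      ((X.half.β Z).hom ⊠ₘ 𝟙 X'.obj) ≫ ((𝟙 Z ⊠ₘ f.hom) ⊠ₘ g.hom) := by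
    rw [← tensor_comp, ← tensor_comp, f.comm]; simp
  rw [reassoc_of% h1, reassoc_of% assoc_inv_naturality, reassoc_of% h2, assoc_naturality]
  simp only [Category.assoc]

theorem half_hexagon' {X : C} (b : HalfBraiding X) (Y Z : C) : (b.β (Y ⊠ Z)).hom =
    (assoc X Y Z).inv ≫ ((b.β Y).hom ⊠ₘ 𝟙 Z) ≫ (assoc Y X Z).hom ≫ (𝟙 Y ⊠ₘ (b.β Z).hom) ≫
      (assoc Y Z X).inv := by
  rw [← reassoc_of% b.hexagon, Iso.inv_hom_id_assoc, Iso.hom_inv_id, Category.comp_id]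

theorem tensorβ_hexagon (X X' : Center C) (Y Z : C) :
    (assoc (X.obj ⊠ X'.obj) Y Z).hom ≫ (tensorβ X X' (Y ⊠ Z)).hom ≫
        (assoc Y Z (X.obj ⊠ X'.obj)).hom =
      ((tensorβ X X' Y).hom ⊠ₘ 𝟙 Z) ≫ (assoc Y (X.obj ⊠ X'.obj) Z).hom ≫
        (𝟙 Y ⊠ₘ (tensorβ X X' Z).hom) := by
  rw [tensorβ_hom, half_hexagon', half_hexagon', tensorβ_hom, tensorβ_hom]
  simp only [← l_comp, ← r_comp, Category.assoc]
  rw [reassoc_of% pentagon₁, pentagon₂, ← reassoc_of% assoc_naturality,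
    reassoc_of% assoc_naturality (𝟙 Y) (X.half.β Z).hom (𝟙 X'.obj), ← reassoc_of% pentagon₂, reassoc_of% pentagon₃, ← reassoc_of% assoc_naturality (𝟙 X.obj) (𝟙 Y),
    Iso.hom_inv_id_assoc, ← reassoc_of% assoc_inv_naturality, tensor_id, tensor_id,
    ← reassoc_of% exch, reassoc_of% pentagon, reassoc_of% assoc_naturality (X.half.β Y).hom (𝟙 X'.obj) (𝟙 Z),
    tensor_id, ← reassoc_of% assoc_naturality (𝟙 Y) (𝟙 X.obj) (X'.half.β Z).hom, tensor_id,
    ← reassoc_of% pentagon₄]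

/-- The tensor product of two objects of the Drinfeld center. -/
def tensor (X X' : Center C) : Center C where
  obj := X.obj ⊠ X'.obj
  half :=
    { β := tensorβ X X'
      naturality := tensorβ_naturality X X'
      hexagon := tensorβ_hexagon X X' }

theorem assoc_comm (X₁ X₂ X₃ : Center C) (Z : C) :
    ((assoc X₁.obj X₂.obj X₃.obj).hom ⊠ₘ 𝟙 Z) ≫ (tensorβ X₁ (tensor X₂ X₃) Z).hom =
      (tensorβ (tensor X₁ X₂) X₃ Z).hom ≫ (𝟙 Z ⊠ₘ (assoc X₁.obj X₂.obj X₃.obj).hom) := by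
  show ((assoc X₁.obj X₂.obj X₃.obj).hom ⊠ₘ 𝟙 Z) ≫ (assoc X₁.obj (X₂.obj ⊠ X₃.obj) Z).hom ≫
      (𝟙 X₁.obj ⊠ₘ (tensorβ X₂ X₃ Z).hom) ≫ (assoc X₁.obj Z (X₂.obj ⊠ X₃.obj)).inv ≫
      ((X₁.half.β Z).hom ⊠ₘ 𝟙 (X₂.obj ⊠ X₃.obj)) ≫ (assoc Z X₁.obj (X₂.obj ⊠ X₃.obj)).hom =
    ((assoc (X₁.obj ⊠ X₂.obj) X₃.obj Z).hom ≫ (𝟙 (X₁.obj ⊠ X₂.obj) ⊠ₘ (X₃.half.β Z).hom) ≫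
      (assoc (X₁.obj ⊠ X₂.obj) Z X₃.obj).inv ≫ ((tensorβ X₁ X₂ Z).hom ⊠ₘ 𝟙 X₃.obj) ≫
      (assoc Z (X₁.obj ⊠ X₂.obj) X₃.obj).hom) ≫ (𝟙 Z ⊠ₘ (assoc X₁.obj X₂.obj X₃.obj).hom)
  rw [tensorβ_hom, tensorβ_hom]
  simp only [← l_comp, ← r_comp, Category.assoc]
  have h : (assoc X₁.obj (Z ⊠ X₂.obj) X₃.obj).hom ≫ (𝟙 X₁.obj ⊠ₘ (assoc Z X₂.obj X₃.obj).hom) ≫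
      (assoc X₁.obj Z (X₂.obj ⊠ X₃.obj)).inv =
      ((assoc X₁.obj Z X₂.obj).inv ⊠ₘ 𝟙 X₃.obj) ≫ (assoc (X₁.obj ⊠ Z) X₂.obj X₃.obj).hom := by
    rw [← reassoc_of% pentagon₂, Iso.hom_inv_id, Category.comp_id]
  rw [reassoc_of% pentagon, ← reassoc_of% assoc_naturality (𝟙 X₁.obj) (𝟙 X₂.obj) (X₃.half.β Z).hom, tensor_id,
    ← reassoc_of% pentagon₄, ← reassoc_of% assoc_naturality (𝟙 X₁.obj) (X₂.half.β Z).hom (𝟙 X₃.obj),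
    reassoc_of% h, ← tensor_id X₂.obj X₃.obj,
    ← reassoc_of% assoc_naturality (X₁.half.β Z).hom (𝟙 X₂.obj) (𝟙 X₃.obj), pentagon]

instance : SemigroupalCategory (Center C) where
  tensorObj := tensor
  tensorHom f g := ⟨f.hom ⊠ₘ g.hom, tensorHom_comm f g⟩
  tensor_id _ _ := Hom.ext (tensor_id _ _)
  tensor_comp _ _ _ _ := Hom.ext (tensor_comp _ _ _ _)
  assoc X Y Z := mkIso (assoc X.obj Y.obj Z.obj) (assoc_comm X Y Z)
  assoc_naturality _ _ _ := Hom.ext (assoc_naturality _ _ _)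
  pentagon _ _ _ _ := Hom.ext (pentagon _ _ _ _)

theorem braid_comm (X X' : Center C) (Z : C) :
    ((X.half.β X'.obj).hom ⊠ₘ 𝟙 Z) ≫ (tensorβ X' X Z).hom =
      (tensorβ X X' Z).hom ≫ (𝟙 Z ⊠ₘ (X.half.β X'.obj).hom) := by
  rw [tensorβ_hom, tensorβ_hom, ← reassoc_of% X.half.hexagon]
  simp only [Category.assoc]
  rw [Iso.hom_inv_id_assoc, ← reassoc_of% X.half.naturality, ← X.half.hexagon, Iso.inv_hom_id_assoc]

/-- The braiding of the Drinfeld center is given by the half-braidings. -/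
instance : Braiding (Center C) where
  braid X Y := mkIso (X.half.β Y.obj) (braid_comm X Y)
  braid_naturality {X₁ Y₁ X₂ Y₂} f g := Hom.ext (by
    show (f.hom ⊠ₘ g.hom) ≫ (Y₁.half.β Y₂.obj).hom = (X₁.half.β X₂.obj).hom ≫ (g.hom ⊠ₘ f.hom)
    rw [hom_def, Category.assoc, Y₁.half.naturality, reassoc_of% f.comm, ← tensor_comp]
    simp)
  hexagon_forward X _ _ := Hom.ext (X.half.hexagon _ _)
  hexagon_reverse X Y Z := Hom.ext (by
    show (assoc X.obj Y.obj Z.obj).inv ≫ (tensorβ X Y Z.obj).hom ≫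
      (assoc Z.obj X.obj Y.obj).inv = _
    rw [tensorβ_hom]
    simp only [Category.assoc, Iso.hom_inv_id, Category.comp_id, Iso.inv_hom_id_assoc]
    rfl)

end Center
end SemigroupalCategory

/-! ### Algebras over `PaPB` -/

section algebras

open SemigroupalCategory

/-- The pair of categories `(M, N)`, of colors `closed` and `opened` respectively. -/
abbrev carrier (M N : Type u) : Color → Type u
  | .closed => M
  | .opened => N

instance carrierCategory (M N : Type u) [Category.{v} M] [Category.{v} N] :
    ∀ c : Color, Category.{v} (carrier M N c)
  | .closed => inferInstanceAs (Category.{v} M)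
  | .opened => inferInstanceAs (Category.{v} N)

/-- The structures of a `PaPB`-algebra on the pair of categories `(M, N)`: the morphisms of colored
operads from `PaPB` to the endomorphism operad of `(M, N)`. -/
abbrev PaPBAlgebra (M N : Type u) [Category.{v} M] [Category.{v} N] :=
  CatOperad.Hom PaPB (endOperad (carrier M N))

/-- On a pair of categories `(M, N)`: a non-unital monoidal structure on `N`, a non-unital braided
monoidal structure on `M`, and a strong braided monoidal functor from `M` to the Drinfeld center
of `N`. -/
structure CentralTriple (M N : Type u) [Category.{v} M] [Category.{v} N] where
  /-- The non-unital monoidal structure of `N`. -/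
  [monoidalN : SemigroupalCategory N]
  /-- The non-unital monoidal structure of `M`. -/
  [monoidalM : SemigroupalCategory M]
  /-- The braiding of `M`. -/
  [braidingM : Braiding M]
  /-- The functor to the Drinfeld center. -/
  F : StrongBraidedFunctor M (Center N)

/-! The generating objects and morphisms of `PaPB`. -/

namespace PaPB

/-- Two closed inputs. -/
abbrev cc : Fin 2 → Color := fun _ => .closed
/-- Two open inputs. -/
abbrev oo : Fin 2 → Color := fun _ => .opened
/-- A closed input followed by an open input. -/
abbrev co : Fin 2 → Color := ![.closed, .opened]
/-- Three closed inputs. -/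
abbrev ccc : Fin 3 → Color := fun _ => .closed
/-- Three open inputs. -/
abbrev ooo : Fin 3 → Color := fun _ => .opened
/-- One closed input. -/
abbrev c : Fin 1 → Color := fun _ => .closed

open Term

/-- The object of `PaPB` given by a term in which each input occurs exactly once. -/
abbrev ofTerm {n : ℕ} {κ : Fin n → Color} {d : Color} (t : Term κ d)
    (h : t.word.Nodup ∧ ∀ i, i ∈ t.word := by decide) : PaPB.Op (Fin n) κ d :=
  (⟨t, h.1, h.2⟩ : PaPBObj κ d)

/-- The morphism of `PaPB` given by a bicolored braid. -/
abbrev ofBraid {n : ℕ} {κ : Fin n → Color} {d : Color} {x y : PaPBObj κ d} (b : Braid)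
    (h : Bicolored κ x.word b y.word) : (show PaPB.Op (Fin n) κ d from x) ⟶ y :=
  (⟨b, h⟩ : PaPBObj.Hom x y)

/-- `μ_c(x₀, x₁)`. -/
def muC : PaPB.Op (Fin 2) cc .closed := ofTerm (mulC (leaf (κ := cc) 0) (leaf (κ := cc) 1))

/-- `μ_c(x₁, x₀)`. -/
def muC' : PaPB.Op (Fin 2) cc .closed := ofTerm (mulC (leaf (κ := cc) 1) (leaf (κ := cc) 0))

/-- `μ_o(y₀, y₁)`. -/
def muO : PaPB.Op (Fin 2) oo .opened := ofTerm (mulO (leaf (κ := oo) 0) (leaf (κ := oo) 1))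

/-- `f(x₀)`. -/
def fObj : PaPB.Op (Fin 1) c .opened := ofTerm (f (leaf (κ := c) 0))

/-- The associator `μ_c(μ_c(x₀, x₁), x₂) ⟶ μ_c(x₀, μ_c(x₁, x₂))`, given by the trivial braid. -/
def alphaC : (ofTerm (mulC (mulC (leaf (κ := ccc) 0) (leaf (κ := ccc) 1)) (leaf (κ := ccc) 2)) :
      PaPB.Op (Fin 3) ccc .closed) ⟶
    ofTerm (mulC (leaf (κ := ccc) 0) (mulC (leaf (κ := ccc) 1) (leaf (κ := ccc) 2))) :=
  ofBraid 1 (Bicolored.nil _)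

/-- The associator `μ_o(μ_o(y₀, y₁), y₂) ⟶ μ_o(y₀, μ_o(y₁, y₂))`, given by the trivial braid. -/
def alphaO : (ofTerm (mulO (mulO (leaf (κ := ooo) 0) (leaf (κ := ooo) 1)) (leaf (κ := ooo) 2)) :
      PaPB.Op (Fin 3) ooo .opened) ⟶
    ofTerm (mulO (leaf (κ := ooo) 0) (mulO (leaf (κ := ooo) 1) (leaf (κ := ooo) 2))) :=
  ofBraid 1 (Bicolored.nil _)

/-- The braiding `τ : μ_c(x₀, x₁) ⟶ μ_c(x₁, x₀)`, given by one crossing. -/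
def tau : muC ⟶ muC' :=
  ofBraid (1 * Braid.σ 0) (Bicolored.pos [] 0 1 [] (Bicolored.nil _) rfl)

/-- `p : μ_o(f(x₀), f(x₁)) ⟶ f(μ_c(x₀, x₁))`, given by the trivial braid. -/
def p : (ofTerm (mulO (f (leaf (κ := cc) 0)) (f (leaf (κ := cc) 1))) :
      PaPB.Op (Fin 2) cc .opened) ⟶
    ofTerm (f (mulC (leaf (κ := cc) 0) (leaf (κ := cc) 1))) :=
  ofBraid 1 (Bicolored.nil _)

/-- `ψ : μ_o(f(x₀), y₁) ⟶ μ_o(y₁, f(x₀))`, given by one crossing, the closed strand passing behind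
the open one. -/
def psi : (ofTerm (mulO (f (leaf (κ := co) 0)) (leaf (κ := co) 1)) :
      PaPB.Op (Fin 2) co .opened) ⟶
    ofTerm (mulO (leaf (κ := co) 1) (f (leaf (κ := co) 0))) :=
  ofBraid (1 * Braid.σ 0) (Bicolored.pos [] 0 1 [] (Bicolored.nil _) rfl)

end PaPB

/-- The tensor product of a non-unital monoidal category, as a functor on the product of two
copies of it. -/
def tensorFunctor (C : Type u) [Category.{v} C] [SemigroupalCategory C] :
    (∀ _ : Fin 2, C) ⥤ C where
  obj X := X 0 ⊠ X 1
  map f := f 0 ⊠ₘ f 1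
  map_id _ := tensor_id _ _
  map_comp _ _ := tensor_comp _ _ _ _

/-- The algebra `A` and the triple `T` correspond to each other: `A` sends the generators
`μ_c, μ_o, f, α_c, α_o, τ, p, ψ` of `PaPB` respectively to the tensor product of `M`, the tensor
product of `N`, the functor underlying `F`, the associators of `M` and of `N`, the braiding of `M`,
the structure isomorphisms of `F`, and the half-braidings of the objects `F(x)`.
(The endpoints of the two sides of each heterogeneous equality agree because `A` preserves the
operadic composition.) -/
structure Corresponds {M N : Type u} [Category.{v} M] [Category.{v} N]
    [SemigroupalCategory N] [SemigroupalCategory M] [Braiding M]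
    (A : PaPBAlgebra M N) (F : StrongBraidedFunctor M (Center N)) : Prop where
  muC : (A.app PaPB.cc .closed).obj PaPB.muC = tensorFunctor M
  muO : (A.app PaPB.oo .opened).obj PaPB.muO = tensorFunctor N
  fObj : (A.app PaPB.c .opened).obj PaPB.fObj =
    ({ obj := fun X => (F.obj (X 0)).obj
       map := fun g => (F.map (g 0)).hom
       map_id := fun X => congrArg Center.Hom.hom (F.map_id (X 0))
       map_comp := fun g h => congrArg Center.Hom.hom (F.map_comp (g 0) (h 0)) } :
      (∀ _ : Fin 1, M) ⥤ N)
  alphaC : ∀ X : Fin 3 → M, NatTrans.app ((A.app PaPB.ccc .closed).map PaPB.alphaC) X ≍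
    (assoc (X 0) (X 1) (X 2)).hom
  alphaO : ∀ Y : Fin 3 → N, NatTrans.app ((A.app PaPB.ooo .opened).map PaPB.alphaO) Y ≍
    (assoc (Y 0) (Y 1) (Y 2)).hom
  tau : ∀ X : Fin 2 → M, NatTrans.app ((A.app PaPB.cc .closed).map PaPB.tau) X ≍
    (Braiding.braid (X 0) (X 1)).hom
  p : ∀ X : Fin 2 → M, NatTrans.app ((A.app PaPB.cc .opened).map PaPB.p) X ≍
    (F.μ (X 0) (X 1)).hom.hom
  psi : ∀ Z : ∀ i : Fin 2, carrier M N (PaPB.co i),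
    NatTrans.app ((A.app PaPB.co .opened).map PaPB.psi) Z ≍
      ((F.obj (show M from Z 0)).half.β (show N from Z 1)).hom

/-- The algebra `A` and the triple `T` correspond to each other. -/
def CentralTriple.CorrespondsTo {M N : Type u} [Category.{v} M] [Category.{v} N]
    (T : CentralTriple M N) (A : PaPBAlgebra M N) : Prop :=
  @Corresponds M N _ _ T.monoidalN T.monoidalM T.braidingM A T.F

end algebras

/-!
An algebra over `PaPB` is the same as a central functor because `PaPB` is presented by its
generators `μ_c, μ_o, f, α_c, α_o, p, τ, ψ` and by the axioms of a strong braided functor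
`F : M ⥤ Z(N)`.  The relation `GenData.Rel` makes this presentation usable: given values on the
generators (`GenFunctors`, `GenData`), it consists of the composites of structure isomorphisms,
each recorded with the braid from which it comes.

*Generation.*  Every morphism of `PaPB` is the braid of such a composite
(`GenData.conn_of_bicolored`): every term is connected, over the trivial braid, to a normal form
that depends only on its word, and one crossing of neighbouring strands is `τ` if both are aerial
and `ψ` or its inverse if one of them is terrestrial.  So the values of an algebra on the
generators determine it (`Matches.val_heq`, `Matches.unique`).  The axioms of a central functor
hold for these values because both sides of each axiom come from the same morphism of `PaPB`
(`Matches.coherence`); this gives the triple of an algebra (`Matches.centralTriple`).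

*Coherence.*  Conversely, for a central functor, a composite of structure isomorphisms is
determined by its braid (`Rel.unique`), so that every morphism of `PaPB` has a well-defined value,
and the values form an algebra.  For composites with values in `N` the proof has three steps.

* Each term is identified with the tensor product of its word, whose letters are objects of the
  center `Z(N)` (closed letters) or of `N` (open letters).  The tensor product is written as an
  iterated action on `N` with a unit adjoined (`WithUnit`), which makes the associators between
  different bracketings canonical.  The structure isomorphisms become composites of single crossings
  (`Rel.compat`, `Interp`).
* The closed letters are moved to the left, behind the open ones (`stateOf`).  Since open strands
  never cross each other, and half-braidings are natural and compatible with tensor products, this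
  turns a crossing of a closed with an open letter into an identity, and a crossing of two closed
  letters into the same crossing of neighbours (`Cross.pre_stateOf`).
* The Yang–Baxter equation in the center makes the crossings of closed letters an action of the
  braid group.  Together with the deletion of the open strands (`Braid.delAction`) it gives an
  action of the bicolored braids (`stateAction`), which reproduces the given composite
  (`Interp.stateAction_apply`).  Hence the composite depends on its braid only (`Interp.unique`).

Composites with values in `M` are reduced to this case: the braiding of `M` makes the identity a
central functor `M ⥤ Z(M)`, which is faithful (`selfCentral`).

The two constructions are inverse to each other since an algebra is determined by its values on the
generators and a triple by the corresponding algebra (`CorrespondsTo.unique`).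
-/

/-! ### The values of an algebra on the generators -/

/-- The values that an algebra over `PaPB` on `(M, N)` takes on the generating objects
`μ_c, μ_o, f`. -/
structure GenFunctors (M N : Type u) [Category.{v} M] [Category.{v} N] where
  /-- The tensor product of `M`. -/
  mulC : M → M → M
  /-- The tensor product of morphisms of `M`. -/
  mapC : ∀ {X X' Y Y' : M}, (X ⟶ X') → (Y ⟶ Y') → (mulC X Y ⟶ mulC X' Y')
  mapC_id : ∀ X Y : M, mapC (𝟙 X) (𝟙 Y) = 𝟙 (mulC X Y)
  mapC_comp : ∀ {X X' X'' Y Y' Y'' : M} (f : X ⟶ X') (g : Y ⟶ Y') (f' : X' ⟶ X'') (g' : Y' ⟶ Y''),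
    mapC (f ≫ f') (g ≫ g') = mapC f g ≫ mapC f' g'
  /-- The tensor product of `N`. -/
  mulO : N → N → N
  /-- The tensor product of morphisms of `N`. -/
  mapO : ∀ {X X' Y Y' : N}, (X ⟶ X') → (Y ⟶ Y') → (mulO X Y ⟶ mulO X' Y')
  mapO_id : ∀ X Y : N, mapO (𝟙 X) (𝟙 Y) = 𝟙 (mulO X Y)
  mapO_comp : ∀ {X X' X'' Y Y' Y'' : N} (f : X ⟶ X') (g : Y ⟶ Y') (f' : X' ⟶ X'') (g' : Y' ⟶ Y''),
    mapO (f ≫ f') (g ≫ g') = mapO f g ≫ mapO f' g'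
  /-- The functor from `M` to `N`. -/
  F : M ⥤ N

namespace GenFunctors

variable {M N : Type u} [Category.{v} M] [Category.{v} N] (D : GenFunctors M N)

/-- The value of a term on objects. -/
def obj {I : Type} {κ : I → Color} : {d : Color} → Term κ d → (∀ i, carrier M N (κ i)) →
    carrier M N d
  | _, .leaf i, X => X i
  | _, .mulC s t, X => D.mulC (obj s X) (obj t X)
  | _, .mulO s t, X => D.mulO (obj s X) (obj t X)
  | _, .f s, X => D.F.obj (obj s X)

/-- The value of a term on morphisms. -/
def map {I : Type} {κ : I → Color} : {d : Color} → (t : Term κ d) →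
    {X Y : ∀ i, carrier M N (κ i)} → (X ⟶ Y) → (D.obj t X ⟶ D.obj t Y)
  | _, .leaf i, _, _, g => g i
  | _, .mulC s t, _, _, g => D.mapC (map s g) (map t g)
  | _, .mulO s t, _, _, g => D.mapO (map s g) (map t g)
  | _, .f s, _, _, g => D.F.map (map s g)

/-- The value of a term, as a functor. -/
def eval {I : Type} {κ : I → Color} {d : Color} (t : Term κ d) :
    (∀ i, carrier M N (κ i)) ⥤ carrier M N d where
  obj := D.obj t
  map g := D.map t g
  map_id X := by
    induction t with
    | leaf i => rfl
    | mulC s t hs ht => exact (congrArg₂ D.mapC hs ht).trans (D.mapC_id _ _)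
    | mulO s t hs ht => exact (congrArg₂ D.mapO hs ht).trans (D.mapO_id _ _)
    | f s hs => exact (congrArg D.F.map hs).trans (D.F.map_id _)
  map_comp g h := by
    induction t with
    | leaf i => rfl
    | mulC s t hs ht => exact (congrArg₂ D.mapC hs ht).trans (D.mapC_comp _ _ _ _)
    | mulO s t hs ht => exact (congrArg₂ D.mapO hs ht).trans (D.mapO_comp _ _ _ _)
    | f s hs => exact (congrArg D.F.map hs).trans (D.F.map_comp _ _)

/-- The simultaneous substitution of terms with inputs in one common set. -/
def _root_.Term.bind {I J : Type} {κ : I → Color} {κ' : J → Color}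
    (y : ∀ i, Term κ' (κ i)) : {d : Color} → Term κ d → Term κ' d
  | _, .leaf i => y i
  | _, .mulC s t => .mulC (bind y s) (bind y t)
  | _, .mulO s t => .mulO (bind y s) (bind y t)
  | _, .f s => .f (bind y s)

theorem obj_relabel {I J : Type} (e : I → J) (κ : J → Color) {d : Color} (t : Term (κ ∘ e) d)
    (X : ∀ j, carrier M N (κ j)) :
    D.obj (t.relabel e κ) X = D.obj t (fun i => X (e i)) := by
  induction t with
  | leaf i => rfl
  | mulC s t hs ht => exact congrArg₂ D.mulC hs ht
  | mulO s t hs ht => exact congrArg₂ D.mulO hs ht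
  | f s hs => exact congrArg D.F.obj hs

theorem mapC_heq {X X' Y Y' Z Z' W W' : M} {f : X ⟶ Y} {f' : X' ⟶ Y'} {g : Z ⟶ W} {g' : Z' ⟶ W'}
    (h₁ : X = X') (h₂ : Y = Y') (h₃ : Z = Z') (h₄ : W = W') (hf : f ≍ f') (hg : g ≍ g') :
    D.mapC f g ≍ D.mapC f' g' := by
  subst h₁ h₂ h₃ h₄ hf hg; rfl

theorem mapO_heq {X X' Y Y' Z Z' W W' : N} {f : X ⟶ Y} {f' : X' ⟶ Y'} {g : Z ⟶ W} {g' : Z' ⟶ W'}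
    (h₁ : X = X') (h₂ : Y = Y') (h₃ : Z = Z') (h₄ : W = W') (hf : f ≍ f') (hg : g ≍ g') :
    D.mapO f g ≍ D.mapO f' g' := by
  subst h₁ h₂ h₃ h₄ hf hg; rfl

theorem _root_.CategoryTheory.Functor.map_heq {C D : Type*} [Category* C] [Category* D] (G : C ⥤ D)
    {X X' Y Y' : C} {f : X ⟶ Y} {f' : X' ⟶ Y'} (h₁ : X = X') (h₂ : Y = Y') (hf : f ≍ f') :
    G.map f ≍ G.map f' := by
  subst h₁ h₂ hf; rfl

theorem map_relabel {I J : Type} (e : I → J) (κ : J → Color) {d : Color} (t : Term (κ ∘ e) d)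
    {X Y : ∀ j, carrier M N (κ j)} (g : X ⟶ Y) :
    D.map (t.relabel e κ) g ≍ D.map t (X := fun i => X (e i)) (Y := fun i => Y (e i))
      (fun i => g (e i)) := by
  induction t with
  | leaf i => rfl
  | mulC s t hs ht =>
    exact D.mapC_heq (D.obj_relabel _ _ _ _) (D.obj_relabel _ _ _ _)
      (D.obj_relabel _ _ _ _) (D.obj_relabel _ _ _ _) hs ht
  | mulO s t hs ht =>
    exact D.mapO_heq (D.obj_relabel _ _ _ _) (D.obj_relabel _ _ _ _)
      (D.obj_relabel _ _ _ _) (D.obj_relabel _ _ _ _) hs ht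
  | f s hs => exact D.F.map_heq (D.obj_relabel _ _ _ _) (D.obj_relabel _ _ _ _) hs

theorem obj_subst {I : Type} {κ : I → Color} {J : I → Type} (κJ : ∀ i, J i → Color)
    (y : ∀ i, Term (κJ i) (κ i)) {d : Color} (t : Term κ d)
    (X : ∀ p : Σ i, J i, carrier M N (κJ p.1 p.2)) :
    D.obj (t.subst κJ y) X = D.obj t (fun i => D.obj (y i) fun j => X ⟨i, j⟩) := by
  induction t with
  | leaf i => exact D.obj_relabel (Sigma.mk i) (fun p : Σ i, J i => κJ p.1 p.2) (y i) X
  | mulC s t hs ht => exact congrArg₂ D.mulC hs ht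
  | mulO s t hs ht => exact congrArg₂ D.mulO hs ht
  | f s hs => exact congrArg D.F.obj hs

theorem map_subst {I : Type} {κ : I → Color} {J : I → Type} (κJ : ∀ i, J i → Color)
    (y : ∀ i, Term (κJ i) (κ i)) {d : Color} (t : Term κ d)
    {X Y : ∀ p : Σ i, J i, carrier M N (κJ p.1 p.2)} (g : X ⟶ Y) :
    D.map (t.subst κJ y) g ≍ D.map t (X := fun i => D.obj (y i) fun j => X ⟨i, j⟩)
      (Y := fun i => D.obj (y i) fun j => Y ⟨i, j⟩)
      (fun i => D.map (y i) (X := fun j => X ⟨i, j⟩) (Y := fun j => Y ⟨i, j⟩)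
        fun j => g ⟨i, j⟩) := by
  induction t with
  | leaf i => exact D.map_relabel (Sigma.mk i) (fun p : Σ i, J i => κJ p.1 p.2) (y i) g
  | mulC s t hs ht =>
    exact D.mapC_heq (D.obj_subst _ _ _ _) (D.obj_subst _ _ _ _)
      (D.obj_subst _ _ _ _) (D.obj_subst _ _ _ _) hs ht
  | mulO s t hs ht =>
    exact D.mapO_heq (D.obj_subst _ _ _ _) (D.obj_subst _ _ _ _)
      (D.obj_subst _ _ _ _) (D.obj_subst _ _ _ _) hs ht
  | f s hs => exact D.F.map_heq (D.obj_subst _ _ _ _) (D.obj_subst _ _ _ _) hs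

end GenFunctors

/-- The values that an algebra over `PaPB` on `(M, N)` takes on the generating objects
`μ_c, μ_o, f` and on the generating morphisms `α_c, α_o, p, τ, ψ`.  Neither coherence nor the
naturality of the isomorphisms is imposed. -/
structure GenData (M N : Type u) [Category.{v} M] [Category.{v} N] extends GenFunctors M N where
  /-- The associator of `M`. -/
  αC : ∀ X Y Z : M, mulC (mulC X Y) Z ≅ mulC X (mulC Y Z)
  /-- The associator of `N`. -/
  αO : ∀ X Y Z : N, mulO (mulO X Y) Z ≅ mulO X (mulO Y Z)
  /-- The compatibility of `F` with the tensor products. -/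
  μ : ∀ X Y : M, mulO (F.obj X) (F.obj Y) ≅ F.obj (mulC X Y)
  /-- The braiding of `M`. -/
  τ : ∀ X Y : M, mulC X Y ≅ mulC Y X
  /-- The half-braidings of the objects in the image of `F`. -/
  ψ : ∀ (X : M) (Y : N), mulO (F.obj X) Y ≅ mulO Y (F.obj X)

/-! ### The morphisms generated by the data -/

namespace GenData

open GenFunctors

variable {M N : Type u} [Category.{v} M] [Category.{v} N] (D : GenData M N)

/-- `D.Rel full X t t' b φ`: the morphism `φ`, between the values on `X` of the terms `t` and `t'`,
is composed of the structure isomorphisms of `D` in the way in which the morphism `t ⟶ t'` of `PaPB`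
with the braid `b` is composed of the generators.  The inputs may be repeated or omitted in the
terms.  The endpoints `A` and `B` of `φ` are indices of their own, so that equations between
values of terms may be rewritten.

If `full` is false, then the isomorphisms `τ` and `ψ` are only allowed where a single strand
crosses a single strand. -/
inductive Rel (full : Prop) {I : Type} {κ : I → Color} (X : ∀ i, carrier M N (κ i)) :
    ∀ {d : Color}, Term κ d → Term κ d → Braid → ∀ {A B : carrier M N d}, (A ⟶ B) → Prop
  | id {d : Color} (t : Term κ d) : Rel full X t t 1 (𝟙 (D.obj t X))
  | comp {d : Color} {t t' t'' : Term κ d} {b b' : Braid} {A B C : carrier M N d} {φ : A ⟶ B}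
      {φ' : B ⟶ C} : Rel full X t t' b φ → Rel full X t' t'' b' φ' →
      Rel full X t t'' (b * b') (φ ≫ φ')
  | inv {d : Color} {t t' : Term κ d} {b : Braid} {A B : carrier M N d} (φ : A ≅ B) :
      Rel full X t t' b φ.hom → Rel full X t' t b⁻¹ φ.inv
  | mapC {s s' t t' : Term κ .closed} {b b' : Braid} {A B A' B' : M} {φ : A ⟶ B} {φ' : A' ⟶ B'} :
      Rel full X (d := .closed) s s' b φ → Rel full X (d := .closed) t t' b' φ' →
      Rel full X (d := .closed) (.mulC s t) (.mulC s' t') (b * Braid.shift s.word.length b')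
        (D.mapC φ φ')
  | mapO {s s' t t' : Term κ .opened} {b b' : Braid} {A B A' B' : N} {φ : A ⟶ B} {φ' : A' ⟶ B'} :
      Rel full X (d := .opened) s s' b φ → Rel full X (d := .opened) t t' b' φ' →
      Rel full X (d := .opened) (.mulO s t) (.mulO s' t') (b * Braid.shift s.word.length b')
        (D.mapO φ φ')
  | mapF {s s' : Term κ .closed} {b : Braid} {A B : M} {φ : A ⟶ B} :
      Rel full X (d := .closed) s s' b φ →
      Rel full X (d := .opened) (.f s) (.f s') b (D.F.map φ)
  | αC (s t r : Term κ .closed) : Rel full X (d := .closed) (.mulC (.mulC s t) r)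
      (.mulC s (.mulC t r)) 1 (D.αC (D.obj s X) (D.obj t X) (D.obj r X)).hom
  | αO (s t r : Term κ .opened) : Rel full X (d := .opened) (.mulO (.mulO s t) r)
      (.mulO s (.mulO t r)) 1 (D.αO (D.obj s X) (D.obj t X) (D.obj r X)).hom
  | μ (s t : Term κ .closed) : Rel full X (d := .opened) (.mulO (.f s) (.f t))
      (.f (.mulC s t)) 1 (D.μ (D.obj s X) (D.obj t X)).hom
  | τ (s t : Term κ .closed) (h : full ∨ s.word.length = 1 ∧ t.word.length = 1) :
      Rel full X (d := .closed) (.mulC s t) (.mulC t s)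
        (Braid.blockCross s.word.length t.word.length) (D.τ (D.obj s X) (D.obj t X)).hom
  | ψ (s : Term κ .closed) (t : Term κ .opened)
      (h : full ∨ s.word.length = 1 ∧ t.word.length = 1) :
      Rel full X (d := .opened) (.mulO (.f s) t) (.mulO t (.f s))
        (Braid.blockCross s.word.length t.word.length) (D.ψ (D.obj s X) (D.obj t X)).hom

/-- The tensor product of two isomorphisms of `M`. -/
abbrev isoC {X X' Y Y' : M} (e : X ≅ X') (e' : Y ≅ Y') : D.mulC X Y ≅ D.mulC X' Y' where
  hom := D.mapC e.hom e'.hom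
  inv := D.mapC e.inv e'.inv
  hom_inv_id := by rw [← D.mapC_comp, e.hom_inv_id, e'.hom_inv_id, D.mapC_id]
  inv_hom_id := by rw [← D.mapC_comp, e.inv_hom_id, e'.inv_hom_id, D.mapC_id]

/-- The tensor product of two isomorphisms of `N`. -/
abbrev isoO {X X' Y Y' : N} (e : X ≅ X') (e' : Y ≅ Y') : D.mulO X Y ≅ D.mulO X' Y' where
  hom := D.mapO e.hom e'.hom
  inv := D.mapO e.inv e'.inv
  hom_inv_id := by rw [← D.mapO_comp, e.hom_inv_id, e'.hom_inv_id, D.mapO_id]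
  inv_hom_id := by rw [← D.mapO_comp, e.inv_hom_id, e'.inv_hom_id, D.mapO_id]

namespace Rel

variable {D} {full : Prop} {I : Type} {κ : I → Color} {X : ∀ i, carrier M N (κ i)}

theorem source_eq {d : Color} {t t' : Term κ d} {b : Braid} {A B : carrier M N d} {φ : A ⟶ B}
    (h : D.Rel full X t t' b φ) : A = D.obj t X ∧ B = D.obj t' X := by
  induction h with
  | id t => exact ⟨rfl, rfl⟩
  | comp _ _ h h' => exact ⟨h.1, h'.2⟩
  | inv φ _ h => exact h.symm
  | mapC _ _ h h' => exact ⟨congrArg₂ D.mulC h.1 h'.1, congrArg₂ D.mulC h.2 h'.2⟩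
  | mapO _ _ h h' => exact ⟨congrArg₂ D.mulO h.1 h'.1, congrArg₂ D.mulO h.2 h'.2⟩
  | mapF _ h => exact ⟨congrArg D.F.obj h.1, congrArg D.F.obj h.2⟩
  | _ => exact ⟨rfl, rfl⟩

theorem exists_iso {d : Color} {t t' : Term κ d} {b : Braid} {A B : carrier M N d} {φ : A ⟶ B}
    (h : D.Rel full X t t' b φ) : ∃ e : A ≅ B, e.hom = φ := by
  induction h with
  | id t => exact ⟨Iso.refl _, rfl⟩
  | comp _ _ h h' =>
    obtain ⟨e, rfl⟩ := h
    obtain ⟨e', rfl⟩ := h'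
    exact ⟨e ≪≫ e', rfl⟩
  | inv φ _ h => exact ⟨φ.symm, rfl⟩
  | mapC _ _ h h' =>
    obtain ⟨e, rfl⟩ := h
    obtain ⟨e', rfl⟩ := h'
    exact ⟨D.isoC e e', rfl⟩
  | mapO _ _ h h' =>
    obtain ⟨e, rfl⟩ := h
    obtain ⟨e', rfl⟩ := h'
    exact ⟨D.isoO e e', rfl⟩
  | mapF _ h =>
    obtain ⟨e, rfl⟩ := h
    exact ⟨D.F.mapIso e, rfl⟩
  | αC => exact ⟨_, rfl⟩
  | αO => exact ⟨_, rfl⟩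
  | μ => exact ⟨_, rfl⟩
  | τ => exact ⟨_, rfl⟩
  | ψ => exact ⟨_, rfl⟩

theorem bicolored {d : Color} {t t' : Term κ d} {b : Braid} {A B : carrier M N d} {φ : A ⟶ B}
    (h : D.Rel full X t t' b φ) : Bicolored κ t.word b t'.word := by
  have append {w₁ w₁' w₂ w₂' : List I} {b b' : Braid} (h : Bicolored κ w₁ b w₁')
      (h' : Bicolored κ w₂ b' w₂') :
      Bicolored κ (w₁ ++ w₂) (b * Braid.shift w₁.length b') (w₁' ++ w₂') := by
    rw [h.perm.length_eq]
    exact (h.append_right _).trans (h'.append_left _)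
  induction h with
  | id t => exact Bicolored.nil _
  | comp _ _ h h' => exact h.trans h'
  | inv φ _ h => exact h.symm
  | mapC _ _ h h' => exact append h h'
  | mapO _ _ h h' => exact append h h'
  | mapF _ h => exact h
  | αC s t r => rw [show (Term.mulC (.mulC s t) r).word = (Term.mulC s (.mulC t r)).word from
      List.append_assoc _ _ _]; exact Bicolored.nil _
  | αO s t r => rw [show (Term.mulO (.mulO s t) r).word = (Term.mulO s (.mulO t r)).word from
      List.append_assoc _ _ _]; exact Bicolored.nil _
  | μ s t => exact Bicolored.nil _
  | τ s t => exact Bicolored.block _ _ (s.closed_of_mem rfl)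
  | ψ s t => exact Bicolored.block _ _ (s.closed_of_mem rfl)

theorem congr_braid {d : Color} {t t' : Term κ d} {b b' : Braid} {A B : carrier M N d} {φ : A ⟶ B}
    (h : D.Rel full X t t' b φ) (hb : b = b') : D.Rel full X t t' b' φ := hb ▸ h

theorem toFull {d : Color} {t t' : Term κ d} {b : Braid} {A B : carrier M N d} {φ : A ⟶ B}
    (h : D.Rel full X t t' b φ) : D.Rel True X t t' b φ := by
  induction h with
  | id t => exact .id t
  | comp _ _ h h' => exact .comp h h'
  | inv φ _ h => exact .inv φ h
  | mapC _ _ h h' => exact .mapC h h'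
  | mapO _ _ h h' => exact .mapO h h'
  | mapF _ h => exact .mapF h
  | αC s t r => exact .αC s t r
  | αO s t r => exact .αO s t r
  | μ s t => exact .μ s t
  | τ s t => exact .τ s t (Or.inl trivial)
  | ψ s t => exact .ψ s t (Or.inl trivial)

theorem relabel {J : Type} (e : I → J) (κ : J → Color) (X : ∀ j, carrier M N (κ j)) {d : Color}
    {t t' : Term (κ ∘ e) d} {b : Braid} {A B : carrier M N d} {φ : A ⟶ B}
    (h : D.Rel full (fun i => X (e i)) t t' b φ) :
    D.Rel full X (t.relabel e κ) (t'.relabel e κ) b φ := by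
  have len {d : Color} (t : Term (κ ∘ e) d) : (t.relabel e κ).word.length = t.word.length := by
    rw [Term.word_relabel, List.length_map]
  induction h with
  | id t =>
    have := Rel.id (D := D) (full := full) (X := X) (t.relabel e κ)
    rwa [obj_relabel] at this
  | comp _ _ h h' => exact .comp h h'
  | inv φ _ h => exact .inv φ h
  | mapC _ _ h h' => exact (Rel.mapC h h').congr_braid (by rw [len])
  | mapO _ _ h h' => exact (Rel.mapO h h').congr_braid (by rw [len])
  | mapF _ h => exact .mapF h
  | αC s t r =>
    have := Rel.αC (D := D) (full := full) (X := X) (s.relabel e κ) (t.relabel e κ) (r.relabel e κ)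
    rwa [obj_relabel, obj_relabel, obj_relabel] at this
  | αO s t r =>
    have := Rel.αO (D := D) (full := full) (X := X) (s.relabel e κ) (t.relabel e κ) (r.relabel e κ)
    rwa [obj_relabel, obj_relabel, obj_relabel] at this
  | μ s t =>
    have := Rel.μ (D := D) (full := full) (X := X) (s.relabel e κ) (t.relabel e κ)
    rwa [obj_relabel, obj_relabel] at this
  | τ s t hl =>
    have := Rel.τ (D := D) (full := full) (X := X) (s.relabel e κ) (t.relabel e κ)
      (by rwa [len, len])
    rwa [obj_relabel, obj_relabel, len, len] at this
  | ψ s t hl =>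
    have := Rel.ψ (D := D) (full := full) (X := X) (s.relabel e κ) (t.relabel e κ)
      (by rwa [len, len])
    rwa [obj_relabel, obj_relabel, len, len] at this

theorem length_subst {J : I → Type} {κJ : ∀ i, J i → Color} (y : ∀ i, Term (κJ i) (κ i))
    {d : Color} (t : Term κ d) :
    (t.subst κJ y).word.length = (t.word.map fun i => (y i).word.length).sum := by
  rw [Term.word_subst]
  exact length_substWord (fun i => (y i).word) t.word

/-- Substituting terms for the inputs turns the braid into its cabling. -/
theorem subst {J : I → Type} {κJ : ∀ i, J i → Color} (y : ∀ i, Term (κJ i) (κ i))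
    (X : ∀ p : Σ i, J i, carrier M N (κJ p.1 p.2)) {d : Color}
    {t t' : Term κ d} {b : Braid} {A B : carrier M N d} {φ : A ⟶ B}
    (h : D.Rel True (fun i => D.obj (y i) fun j => X ⟨i, j⟩) t t' b φ) :
    D.Rel True X (t.subst κJ y) (t'.subst κJ y)
      (Braid.cable (blockSizes (fun i => (y i).word.length) t.word) b) φ := by
  have key {w₁ w₁' w₂ w₂' : List I} {b b' : Braid} (h : Bicolored κ w₁ b w₁')
      (h' : Bicolored κ w₂ b' w₂') (ℓ : I → ℕ) :
      Braid.cable (blockSizes ℓ w₁) b *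
          Braid.shift (w₁.map ℓ).sum (Braid.cable (blockSizes ℓ w₂) b')
        = Braid.cable (blockSizes ℓ (w₁ ++ w₂)) (b * Braid.shift w₁.length b') := by
    rw [cable_trans ℓ (h.append_right w₂), cable_append_right ℓ h, h.perm.length_eq,
      cable_append_left ℓ h', (h.perm.map ℓ).sum_eq]
  induction h with
  | id t =>
    have := Rel.id (D := D) (full := True) (X := X) (t.subst κJ y)
    rwa [obj_subst, ← Braid.cable_one (blockSizes (fun i => (y i).word.length) t.word)] at this
  | comp h₁ h₂ h h' => exact (Rel.comp h h').congr_braid (cable_trans _ h₁.bicolored _).symm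
  | @inv d t t' b A B φ h₁ h =>
    refine (Rel.inv φ h).congr_braid ?_
    have := cable_trans (fun i => (y i).word.length) h₁.bicolored.symm b
    rw [inv_mul_cancel, Braid.cable_one] at this
    exact (eq_inv_of_mul_eq_one_left this.symm).symm
  | mapC h₁ h₂ h h' =>
    refine (Rel.mapC h h').congr_braid ?_
    rw [length_subst]
    exact key h₁.bicolored h₂.bicolored _
  | mapO h₁ h₂ h h' =>
    refine (Rel.mapO h h').congr_braid ?_
    rw [length_subst]
    exact key h₁.bicolored h₂.bicolored _
  | mapF _ h => exact .mapF h
  | αC s t r =>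
    have := Rel.αC (D := D) (full := True) (X := X) (s.subst κJ y) (t.subst κJ y) (r.subst κJ y)
    rw [obj_subst, obj_subst, obj_subst] at this
    exact this.congr_braid (Braid.cable_one _).symm
  | αO s t r =>
    have := Rel.αO (D := D) (full := True) (X := X) (s.subst κJ y) (t.subst κJ y) (r.subst κJ y)
    rw [obj_subst, obj_subst, obj_subst] at this
    exact this.congr_braid (Braid.cable_one _).symm
  | μ s t =>
    have := Rel.μ (D := D) (full := True) (X := X) (s.subst κJ y) (t.subst κJ y)
    rw [obj_subst, obj_subst] at this
    exact this.congr_braid (Braid.cable_one _).symm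
  | τ s t hl =>
    have := Rel.τ (D := D) (full := True) (X := X) (s.subst κJ y) (t.subst κJ y) (Or.inl trivial)
    rw [obj_subst, obj_subst, length_subst, length_subst] at this
    exact this.congr_braid (cable_blockCross _ _ _).symm
  | ψ s t hl =>
    have := Rel.ψ (D := D) (full := True) (X := X) (s.subst κJ y) (t.subst κJ y) (Or.inl trivial)
    rw [obj_subst, obj_subst, length_subst, length_subst] at this
    exact this.congr_braid (cable_blockCross _ _ _).symm

/-- Morphisms inserted in the inputs of a term. -/
theorem juxtapose {J : I → Type} {κJ : ∀ i, J i → Color} {y y' : ∀ i, Term (κJ i) (κ i)}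
    (X : ∀ p : Σ i, J i, carrier M N (κJ p.1 p.2)) {β : I → Braid}
    {γ : ∀ i, D.obj (y i) (fun j => X ⟨i, j⟩) ⟶ D.obj (y' i) (fun j => X ⟨i, j⟩)}
    (h : ∀ i, D.Rel full (fun j => X ⟨i, j⟩) (y i) (y' i) (β i) (γ i)) {d : Color} (t : Term κ d) :
    D.Rel full X (t.subst κJ y) (t.subst κJ y')
      (_root_.juxtapose (fun i => (y i).word.length) β t.word)
      (D.map t (X := fun i => D.obj (y i) fun j => X ⟨i, j⟩) γ) := by
  induction t with
  | leaf i =>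
    refine (Rel.relabel (Sigma.mk i) (fun p : Σ i, J i => κJ p.1 p.2) X (h i)).congr_braid ?_
    simp [_root_.juxtapose, Term.word]
  | mulC s t hs ht =>
    refine (Rel.mapC hs ht).congr_braid ?_
    rw [length_subst]
    exact (juxtapose_append _ _ _ _).symm
  | mulO s t hs ht =>
    refine (Rel.mapO hs ht).congr_braid ?_
    rw [length_subst]
    exact (juxtapose_append _ _ _ _).symm
  | f s hs => exact .mapF hs

end Rel

end GenData

/-! ### Every bicolored braid is generated -/

namespace Term

variable {I : Type} {κ : I → Color} {d : Color}

theorem word_ne_nil (t : Term κ d) : t.word ≠ [] := by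
  induction t with
  | leaf i => simp [word]
  | mulC s t hs ht => simp [word, hs]
  | mulO s t hs ht => simp [word, hs]
  | f s hs => exact hs

theorem length_word_pos (t : Term κ d) : 0 < t.word.length :=
  List.length_pos_iff.2 t.word_ne_nil

/-- The terms with a single input are the inputs `i` and their images `f i`. -/
theorem eq_of_word_eq_singleton (t : Term κ d) {i : I} (h : t.word = [i]) :
    (∃ hd : κ i = d, t = hd ▸ leaf i) ∨
      ∃ (hd : d = .opened) (hi : κ i = .closed), t = hd ▸ f (hi ▸ leaf i) := by
  induction t with
  | leaf j =>
    obtain rfl : j = i := by simpa [word] using h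
    exact Or.inl ⟨rfl, rfl⟩
  | mulC s t hs ht =>
    have := congrArg List.length h
    have h₁ := s.length_word_pos
    have h₂ := t.length_word_pos
    simp only [word, List.length_append, List.length_singleton] at this
    omega
  | mulO s t hs ht =>
    have := congrArg List.length h
    have h₁ := s.length_word_pos
    have h₂ := t.length_word_pos
    simp only [word, List.length_append, List.length_singleton] at this
    omega
  | f s hs =>
    rcases hs h with ⟨hd, rfl⟩ | ⟨hd, -⟩
    · exact Or.inr ⟨rfl, hd, rfl⟩
    · cases hd

/-- A term with a single input is determined by its color and the input. -/
theorem letter_ext {t t' : Term κ d} {i : I} (h : t.word = [i]) (h' : t'.word = [i]) : t = t' := by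
  rcases t.eq_of_word_eq_singleton h with ⟨hd, rfl⟩ | ⟨hd, hi, rfl⟩ <;>
    rcases t'.eq_of_word_eq_singleton h' with ⟨hd', rfl⟩ | ⟨hd', hi', rfl⟩
  · rfl
  · rw [hi', hd'] at hd; cases hd
  · rw [hi, hd] at hd'; cases hd'
  · rfl

theorem letters_ext {l l' : List (Term κ d)} (hl : ∀ t ∈ l, t.word.length = 1)
    (hl' : ∀ t ∈ l', t.word.length = 1) (h : l.flatMap word = l'.flatMap word) : l = l' := by
  induction l generalizing l' with
  | nil =>
    cases l' with
    | nil => rfl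
    | cons t' l' => exact absurd h (by simp [word_ne_nil])
  | cons t l ih =>
    cases l' with
    | nil => exact absurd h (by simp [word_ne_nil])
    | cons t' l' =>
      obtain ⟨i, hi⟩ := List.length_eq_one_iff.1 (hl t (by simp))
      obtain ⟨i', hi'⟩ := List.length_eq_one_iff.1 (hl' t' (by simp))
      simp only [List.flatMap_cons, hi, hi', List.singleton_append, List.cons.injEq] at h
      obtain ⟨rfl, h⟩ := h
      rw [letter_ext hi hi', ih (fun t ht => hl t (by simp [ht]))
        (fun t ht => hl' t (by simp [ht])) h]

/-- The product of two terms of the same color. -/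
def mul : {d : Color} → Term κ d → Term κ d → Term κ d
  | .closed, s, t => mulC s t
  | .opened, s, t => mulO s t

theorem word_mul (s t : Term κ d) : (mul s t).word = s.word ++ t.word := by
  cases d <;> rfl

/-- The product, bracketed to the right, of a nonempty list of terms. -/
def comb : Term κ d → List (Term κ d) → Term κ d
  | a, [] => a
  | a, b :: l => mul a (comb b l)

end Term

namespace GenData

variable {M N : Type u} [Category.{v} M] [Category.{v} N] (D : GenData M N)
  {I : Type} {κ : I → Color} (X : ∀ i, carrier M N (κ i))

open Term

/-- Some composite of structure isomorphisms goes from `t` to `t'` with the braid `b`. -/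
def Conn {d : Color} (t t' : Term κ d) (b : Braid) : Prop :=
  ∃ φ : D.obj t X ⟶ D.obj t' X, D.Rel False X t t' b φ

namespace Conn

variable {D X} {d : Color}

theorem refl (t : Term κ d) : D.Conn X t t 1 := ⟨_, .id t⟩

theorem trans {t t' t'' : Term κ d} {b b' : Braid} (h : D.Conn X t t' b) (h' : D.Conn X t' t'' b') :
    D.Conn X t t'' (b * b') := by
  obtain ⟨φ, h⟩ := h
  obtain ⟨φ', h'⟩ := h'
  exact ⟨_, h.comp h'⟩

theorem symm {t t' : Term κ d} {b : Braid} (h : D.Conn X t t' b) : D.Conn X t' t b⁻¹ := by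
  obtain ⟨φ, h⟩ := h
  obtain ⟨e, rfl⟩ := h.exists_iso
  exact ⟨_, .inv e h⟩

theorem mul {s s' t t' : Term κ d} {b b' : Braid} (h : D.Conn X s s' b) (h' : D.Conn X t t' b') :
    D.Conn X (mul s t) (mul s' t') (b * Braid.shift s.word.length b') := by
  obtain ⟨φ, h⟩ := h
  obtain ⟨φ', h'⟩ := h'
  cases d with
  | closed => exact ⟨_, h.mapC h'⟩
  | opened => exact ⟨_, h.mapO h'⟩

theorem assoc (s t r : Term κ d) :
    D.Conn X (Term.mul (Term.mul s t) r) (Term.mul s (Term.mul t r)) 1 := by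
  cases d with
  | closed => exact ⟨_, .αC s t r⟩
  | opened => exact ⟨_, .αO s t r⟩

theorem trans_one {t t' t'' : Term κ d} {b : Braid} (h : D.Conn X t t' 1) (h' : D.Conn X t' t'' b) :
    D.Conn X t t'' b := by simpa using h.trans h'

theorem symm_one {t t' : Term κ d} (h : D.Conn X t t' 1) : D.Conn X t' t 1 := by
  simpa using h.symm

theorem mul_left (s : Term κ d) {t t' : Term κ d} {b : Braid} (h : D.Conn X t t' b) :
    D.Conn X (Term.mul s t) (Term.mul s t') (Braid.shift s.word.length b) := by
  simpa using (refl s).mul h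

theorem mul_right {s s' : Term κ d} (t : Term κ d) {b : Braid} (h : D.Conn X s s' b) :
    D.Conn X (Term.mul s t) (Term.mul s' t) b := by
  simpa using h.mul (refl t)

theorem mul_comb (a : Term κ d) (l : List (Term κ d)) (a' : Term κ d) (l' : List (Term κ d)) :
    D.Conn X (Term.mul (comb a l) (comb a' l')) (comb a (l ++ a' :: l')) 1 := by
  induction l generalizing a with
  | nil => exact refl _
  | cons b l ih =>
    refine (assoc _ _ _).trans_one ?_
    have := (ih b).mul_left a
    rwa [map_one] at this

theorem f_comb (a : Term κ .closed) (l : List (Term κ .closed)) :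
    D.Conn X (f (comb a l)) (comb (f a) (l.map f)) 1 := by
  induction l generalizing a with
  | nil => exact refl _
  | cons b l ih =>
    have h : D.Conn X (.mulO (f a) (f (comb b l))) (f (.mulC a (comb b l))) 1 := ⟨_, .μ _ _⟩
    refine h.symm_one.trans_one ?_
    have := (ih b).mul_left (f a)
    rwa [map_one] at this

/-- Every term may be bracketed to the right, and `f` moved to the inputs. -/
theorem exists_comb (t : Term κ d) : ∃ (a : Term κ d) (l : List (Term κ d)),
    (∀ x ∈ a :: l, x.word.length = 1) ∧ (a :: l).flatMap word = t.word ∧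
      D.Conn X t (comb a l) 1 := by
  have aux {d : Color} {s t : Term κ d} {a : Term κ d} {l : List (Term κ d)} {a' : Term κ d}
      {l' : List (Term κ d)} (hs : ∀ x ∈ a :: l, x.word.length = 1)
      (ht : ∀ x ∈ a' :: l', x.word.length = 1) (hs' : (a :: l).flatMap word = s.word)
      (ht' : (a' :: l').flatMap word = t.word) (h : D.Conn X s (comb a l) 1)
      (h' : D.Conn X t (comb a' l') 1) : ∃ (b : Term κ d) (m : List (Term κ d)),
      (∀ x ∈ b :: m, x.word.length = 1) ∧ (b :: m).flatMap word = (Term.mul s t).word ∧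
        D.Conn X (Term.mul s t) (comb b m) 1 := by
    refine ⟨a, l ++ a' :: l', ?_, ?_, ?_⟩
    · rw [← List.cons_append]
      exact fun x hx => (List.mem_append.1 hx).elim (hs x) (ht x)
    · rw [← List.cons_append, List.flatMap_append, hs', ht', word_mul]
    · refine trans_one ?_ (mul_comb a l a' l')
      have := h.mul h'
      rwa [map_one, mul_one] at this
  induction t with
  | leaf i => exact ⟨leaf i, [], by simp [word], by simp [word], refl _⟩
  | mulC s t hs ht =>
    obtain ⟨a, l, h₁, h₂, h₃⟩ := hs
    obtain ⟨a', l', h₁', h₂', h₃'⟩ := ht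
    exact aux h₁ h₁' h₂ h₂' h₃ h₃'
  | mulO s t hs ht =>
    obtain ⟨a, l, h₁, h₂, h₃⟩ := hs
    obtain ⟨a', l', h₁', h₂', h₃'⟩ := ht
    exact aux h₁ h₁' h₂ h₂' h₃ h₃'
  | f s hs =>
    obtain ⟨a, l, h₁, h₂, φ, h₃⟩ := hs
    refine ⟨f a, l.map f, ?_, ?_, ?_⟩
    · rw [← List.map_cons]
      intro x hx
      obtain ⟨y, hy, rfl⟩ := List.mem_map.1 hx
      exact h₁ y hy
    · rw [← List.map_cons, List.flatMap_map]
      exact h₂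
    · exact trans_one ⟨_, .mapF h₃⟩ (f_comb a l)

/-- The crossing of two inputs, the first of which is closed. -/
theorem cross_letters {x y : Term κ d} {i : I} (hx : x.word = [i]) (hi : κ i = .closed)
    (hy : y.word.length = 1) : D.Conn X (Term.mul x y) (Term.mul y x) (Braid.σ 0) := by
  rw [← Braid.blockCross_one_one]
  have hx' : x.word.length = 1 := by rw [hx]; rfl
  cases d with
  | closed =>
    have := Rel.τ (D := D) (full := False) (X := X) x y (Or.inr ⟨hx', hy⟩)
    rw [hx', hy] at this
    exact ⟨_, this⟩
  | opened =>
    rcases x.eq_of_word_eq_singleton hx with ⟨hd, -⟩ | ⟨hd, hi, rfl⟩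
    · rw [hi] at hd; cases hd
    · have := Rel.ψ (D := D) (full := False) (X := X) (hi ▸ leaf i) y (Or.inr ⟨hx', hy⟩)
      rw [show (hi ▸ leaf i : Term κ .closed).word.length = 1 from hx', hy] at this
      exact ⟨_, this⟩

/-- The crossing of two neighbouring inputs in a product bracketed to the right. -/
theorem cross_comb {x y : Term κ d} {i : I} (hx : x.word = [i]) (hi : κ i = .closed)
    (hy : y.word.length = 1) (u v : List (Term κ d)) (hu : ∀ t ∈ u, t.word.length = 1)
    {a : Term κ d} {l : List (Term κ d)} (h : a :: l = u ++ x :: y :: v)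
    {a' : Term κ d} {l' : List (Term κ d)} (h' : a' :: l' = u ++ y :: x :: v) :
    D.Conn X (comb a l) (comb a' l') (Braid.σ u.length) := by
  induction u generalizing a l a' l' with
  | nil =>
    have hc := cross_letters (D := D) (X := X) hx hi hy
    simp only [List.nil_append, List.cons.injEq] at h h'
    rw [h.1, h.2, h'.1, h'.2]
    cases v with
    | nil => exact hc
    | cons z v =>
      have := ((assoc x y (comb z v)).symm_one.trans_one (hc.mul_right _)).trans
        (assoc y x (comb z v))
      rw [mul_one] at this
      exact this
  | cons t u ih =>
    rw [List.cons_append, List.cons.injEq] at h h'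
    obtain ⟨b, m, hb⟩ : ∃ b m, b :: m = u ++ x :: y :: v := by cases u <;> simp
    obtain ⟨b', m', hb'⟩ : ∃ b m, b :: m = u ++ y :: x :: v := by cases u <;> simp
    have := (ih (fun t ht => hu t (by simp [ht])) hb hb').mul_left t
    rw [h.1, h.2, h'.1, h'.2, ← hb, ← hb', comb, comb, List.length_cons, add_comm]
    rwa [hu t (by simp), Braid.shift_σ] at this

theorem exists_split {l : List (Term κ d)} (hl : ∀ x ∈ l, x.word.length = 1) {u : List I}
    {x y : I} {v : List I} (h : l.flatMap word = u ++ x :: y :: v) :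
    ∃ (lu : List (Term κ d)) (a b : Term κ d) (lv : List (Term κ d)), l = lu ++ a :: b :: lv ∧
      lu.length = u.length ∧ lu.flatMap word = u ∧ a.word = [x] ∧ b.word = [y] ∧
      lv.flatMap word = v := by
  have cons {l : List (Term κ d)} (hl : ∀ x ∈ l, x.word.length = 1) {x : I} {v : List I}
      (h : l.flatMap word = x :: v) : ∃ a m, l = a :: m ∧ a.word = [x] ∧ m.flatMap word = v := by
    cases l with
    | nil => simp at h
    | cons a m =>
      obtain ⟨i, hi⟩ := List.length_eq_one_iff.1 (hl a (by simp))
      rw [List.flatMap_cons, hi, List.singleton_append, List.cons.injEq] at h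
      exact ⟨a, m, rfl, h.1 ▸ hi, h.2⟩
  induction u generalizing l with
  | nil =>
    obtain ⟨a, m, rfl, ha, h⟩ := cons hl h
    obtain ⟨b, m, rfl, hb, h⟩ := cons (fun x hx => hl x (by simp [hx])) h
    exact ⟨[], a, b, m, rfl, rfl, rfl, ha, hb, h⟩
  | cons z u ih =>
    obtain ⟨a, m, rfl, ha, h⟩ := cons hl h
    obtain ⟨lu, b, c, lv, rfl, h₁, h₂, h₃⟩ := ih (fun x hx => hl x (by simp [hx])) h
    exact ⟨a :: lu, b, c, lv, rfl, by simp [h₁], by simp [h₂, ha], h₃⟩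

/-- A bicolored braid may be realized on the products bracketed to the right, one crossing at a
time. -/
theorem exists_comb_of_bicolored (t : Term κ d) {w : List I} {b : Braid}
    (h : Bicolored κ t.word b w) : ∃ (a : Term κ d) (l : List (Term κ d)),
      (∀ x ∈ a :: l, x.word.length = 1) ∧ (a :: l).flatMap word = w ∧
        D.Conn X t (comb a l) b := by
  induction h with
  | nil => exact exists_comb t
  | pos u x y v h hx ih =>
    obtain ⟨a, l, hl, hal, hc⟩ := ih
    obtain ⟨lu, c, c', lv, e, h₁, h₂, h₃, h₄, h₅⟩ := exists_split hl hal
    obtain ⟨a', l', e'⟩ : ∃ a' l', a' :: l' = lu ++ c' :: c :: lv := by cases lu <;> simp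
    refine ⟨a', l', ?_, ?_, ?_⟩
    · intro z hz
      rw [e'] at hz
      refine hl z ?_
      rw [e]
      simp only [List.mem_append, List.mem_cons] at hz ⊢
      tauto
    · simp [e', h₂, h₃, h₄, h₅]
    · rw [← h₁]
      exact hc.trans (cross_comb h₃ hx (by rw [h₄]; rfl) lu lv
        (fun z hz => hl z (by rw [e]; simp [hz])) e e')
  | neg u x y v h hx ih =>
    obtain ⟨a, l, hl, hal, hc⟩ := ih
    obtain ⟨lu, c, c', lv, e, h₁, h₂, h₃, h₄, h₅⟩ := exists_split hl hal
    obtain ⟨a', l', e'⟩ : ∃ a' l', a' :: l' = lu ++ c' :: c :: lv := by cases lu <;> simp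
    refine ⟨a', l', ?_, ?_, ?_⟩
    · intro z hz
      rw [e'] at hz
      refine hl z ?_
      rw [e]
      simp only [List.mem_append, List.mem_cons] at hz ⊢
      tauto
    · simp [e', h₂, h₃, h₄, h₅]
    · rw [← h₁]
      exact hc.trans (cross_comb h₄ hx (by rw [h₃]; rfl) lu lv
        (fun z hz => hl z (by rw [e]; simp [hz])) e' e).symm

end Conn

/-- Every bicolored braid between the words of two terms is a composite of the structure
isomorphisms, with crossings of single strands only. -/
theorem conn_of_bicolored {d : Color} {t t' : Term κ d} {b : Braid}
    (h : Bicolored κ t.word b t'.word) : D.Conn X t t' b := by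
  obtain ⟨a, l, hl, hw, hc⟩ := Conn.exists_comb_of_bicolored (D := D) (X := X) t h
  obtain ⟨a', l', hl', hw', hc'⟩ := Conn.exists_comb (D := D) (X := X) t'
  have e := letters_ext hl hl' (hw.trans hw'.symm)
  rw [List.cons.injEq] at e
  obtain ⟨rfl, rfl⟩ := e
  simpa using hc.trans hc'.symm_one

end GenData

/-! ### Deletion of strands -/

namespace Braid

/-- The indicator functions `k` of the subsets of `ℕ` with at most `n` elements: the strands at the
positions `j` with `k j = 1` are kept, the others are deleted.  The bound ensures that only the
relations of the braid group on `n` strands are needed of the kept strands. -/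
abbrev Kept (n : ℕ) : Type :=
  {k : ℕ → ℕ // (∀ j, k j ≤ 1) ∧ ∀ m, ∑ j ∈ Finset.range m, k j ≤ n}

theorem sum_swapAt_le_of_forall {n : ℕ} {k : ℕ → ℕ} (h : ∀ m, ∑ j ∈ Finset.range m, k j ≤ n)
    (i m : ℕ) : ∑ j ∈ Finset.range m, swapAt i k j ≤ n := by
  rcases lt_trichotomy m (i + 1) with hm | rfl | hm
  · rw [sum_swapAt_le k (by omega)]; exact h m
  · have := h (i + 2)
    rw [Finset.sum_range_succ, Finset.sum_range_succ] at this
    rw [Finset.sum_range_succ, sum_swapAt_le k le_rfl, swapAt_left]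
    omega
  · rw [sum_swapAt_ge k (by omega)]; exact h m

/-- The action of the transposition of `i` and `i + 1` on the kept positions. -/
def Kept.swap {n : ℕ} (i : ℕ) (k : Kept n) : Kept n :=
  ⟨swapAt i k.1, fun _ => k.2.1 _, sum_swapAt_le_of_forall k.2.2 i⟩

section deletion

variable {n : ℕ} {G : Type*} [Group G] (s : ℕ → G)

/-- What becomes of `σ i` when strands are deleted: either a generator, or trivial. -/
def delGen (k : ℕ → ℕ) (i : ℕ) : G :=
  if k i = 1 ∧ k (i + 1) = 1 then s (∑ j ∈ Finset.range i, k j) else 1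

theorem delGen_far (hf : ∀ i j, i + 2 ≤ j → s i * s j = s j * s i) {i j : ℕ} (k : ℕ → ℕ)
    (h : i + 2 ≤ j) :
    delGen s k i * delGen s (swapAt i k) j = delGen s k j * delGen s (swapAt j k) i := by
  have e₁ : delGen s (swapAt i k) j = delGen s k j := by
    simp only [delGen]
    rw [sum_swapAt_ge k h, swapAt_ne k (by omega) (by omega), swapAt_ne k (by omega) (by omega)]
  have e₂ : delGen s (swapAt j k) i = delGen s k i := by
    simp only [delGen]
    rw [sum_swapAt_le k (by omega), swapAt_ne k (by omega) (by omega),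
      swapAt_ne k (by omega) (by omega)]
  rw [e₁, e₂]
  simp only [delGen]
  split_ifs with h₁ h₂
  · refine hf _ _ ?_
    rw [← Finset.sum_range_add_sum_Ico k h, Finset.sum_range_succ, Finset.sum_range_succ, h₁.1,
      h₁.2]
    omega
  all_goals simp

theorem delGen_yb (hy : ∀ i, i + 2 < n → s i * s (i + 1) * s i = s (i + 1) * s i * s (i + 1))
    (i : ℕ) (k : Kept n) :
    delGen s k.1 i * delGen s (swapAt i k.1) (i + 1) *
        delGen s (swapAt (i + 1) (swapAt i k.1)) i =
      delGen s k.1 (i + 1) * delGen s (swapAt (i + 1) k.1) i *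
        delGen s (swapAt i (swapAt (i + 1) k.1)) (i + 1) := by
  obtain ⟨k, hk, hn⟩ := k
  have e (k : ℕ → ℕ) : swapAt (i + 1) k i = k i := swapAt_ne k (by omega) (by omega)
  have e' (k : ℕ → ℕ) : swapAt i k (i + 2) = k (i + 2) := swapAt_ne k (by omega) (by omega)
  have s₁ (k : ℕ → ℕ) : ∑ j ∈ Finset.range i, swapAt i k j = ∑ j ∈ Finset.range i, k j :=
    sum_swapAt_le k le_rfl
  have s₂ (k : ℕ → ℕ) : ∑ j ∈ Finset.range i, swapAt (i + 1) k j = ∑ j ∈ Finset.range i, k j :=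
    sum_swapAt_le k (by omega)
  have a : i + 1 + 1 = i + 2 := rfl
  simp only [delGen, a, Finset.sum_range_succ, s₁, s₂, swapAt_left, swapAt_right, e, e']
  have h₃ := hn (i + 3)
  rw [Finset.sum_range_succ, Finset.sum_range_succ, Finset.sum_range_succ] at h₃
  rcases Nat.le_one_iff_eq_zero_or_eq_one.1 (hk i) with h₀ | h₀ <;>
  rcases Nat.le_one_iff_eq_zero_or_eq_one.1 (hk (i + 1)) with h₁ | h₁ <;>
  rcases Nat.le_one_iff_eq_zero_or_eq_one.1 (hk (i + 2)) with h₂ | h₂ <;>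
  simp only [h₀, h₁, h₂, zero_ne_one, and_false, and_true, if_true, if_false, mul_one, one_mul,
    add_zero]
  rw [a] at h₃
  exact hy _ (by omega)

/-- The permutation of the pairs (kept positions, element of `G`) that appends the image of
`σ i`. -/
def delStep (i : ℕ) : Equiv.Perm (Kept n × G) where
  toFun x := (x.1.swap i, x.2 * delGen s x.1.1 i)
  invFun x := (x.1.swap i, x.2 * (delGen s (swapAt i x.1.1) i)⁻¹)
  left_inv x := Prod.ext (Subtype.ext (swapAt_swapAt i _)) (by simp [Kept.swap, swapAt_swapAt])
  right_inv x := Prod.ext (Subtype.ext (swapAt_swapAt i _)) (by simp [Kept.swap])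

/-- The right action of the braid group on the pairs (kept positions, element of `G`), when `G` is
generated by elements `s i` satisfying the relations of the braid group on `n` strands.  Its
existence expresses that deleting all but `n` strands is compatible with the braid relations. -/
def delAction (hf : ∀ i j, i + 2 ≤ j → s i * s j = s j * s i)
    (hy : ∀ i, i + 2 < n → s i * s (i + 1) * s i = s (i + 1) * s i * s (i + 1)) :
    Braid →* (Equiv.Perm (Kept n × G))ᵐᵒᵖ :=
  lift (fun i => MulOpposite.op (delStep s i))
    (fun i j h => by
      rw [← MulOpposite.op_mul, ← MulOpposite.op_mul]
      congr 1
      ext1 x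
      refine Prod.ext (Subtype.ext (swapAt_comm x.1.1 h)) ?_
      simpa [delStep, mul_assoc, Kept.swap] using delGen_far s hf x.1.1 h)
    (fun i => by
      rw [← MulOpposite.op_mul, ← MulOpposite.op_mul, ← MulOpposite.op_mul, ← MulOpposite.op_mul]
      congr 1
      ext1 x
      refine Prod.ext (Subtype.ext (swapAt_yb i x.1.1)) ?_
      simpa [delStep, mul_assoc, Kept.swap] using delGen_yb s hy i x.1)

end deletion

end Braid

/-! ### Adjoining a unit to a non-unital monoidal category -/

namespace SemigroupalCategory

/-- The objects of a category together with one new object, which plays the role of a unit.  It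
serves as the innermost factor of a tensor product bracketed to the right. -/
inductive WithUnit (C : Type u) : Type u
  | one
  | of (Y : C)

namespace WithUnit

variable {C : Type u} [Category.{v} C]

/-- The morphisms of `C`, and the identity of the new object. -/
def Hom : WithUnit C → WithUnit C → Type v
  | one, one => PUnit
  | of X, of Y => X ⟶ Y
  | one, of _ => PEmpty
  | of _, one => PEmpty

instance : Category (WithUnit C) where
  Hom := Hom
  id
    | one => PUnit.unit
    | of X => 𝟙 X
  comp {X Y Z} f g :=
    match X, Y, Z, f, g with
    | one, one, one, _, _ => PUnit.unit
    | of _, of _, of _, f, g => CategoryStruct.comp (obj := C) f g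
  id_comp {X Y} f :=
    match X, Y, f with
    | one, one, _ => rfl
    | of _, of _, f => Category.id_comp (obj := C) f
  comp_id {X Y} f :=
    match X, Y, f with
    | one, one, _ => rfl
    | of _, of _, f => Category.comp_id (obj := C) f
  assoc {X Y Z W} f g h :=
    match X, Y, Z, W, f, g, h with
    | one, one, one, one, _, _, _ => rfl
    | of _, of _, of _, of _, f, g, h => Category.assoc (obj := C) f g h

variable [SemigroupalCategory C]

/-- The tensor product `A ⊗ Z` of an object of `C` with an object of `C` or the new unit. -/
def act (A : C) : WithUnit C → WithUnit C
  | one => of A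
  | of Z => of (A ⊠ Z)

/-- The tensor product of a morphism of `C` with a morphism of `WithUnit C`. -/
def actHom {A B : C} (f : A ⟶ B) : {Z W : WithUnit C} → (Z ⟶ W) → (act A Z ⟶ act B W)
  | one, one, _ => f
  | of _, of _, g => tensorHom (C := C) f g

theorem actHom_id (A : C) (Z : WithUnit C) : actHom (𝟙 A) (𝟙 Z) = 𝟙 (act A Z) :=
  match Z with
  | one => rfl
  | of Z => tensor_id A Z

theorem actHom_comp {A B D : C} (f : A ⟶ B) (f' : B ⟶ D) {Z W V : WithUnit C} (g : Z ⟶ W)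
    (g' : W ⟶ V) : actHom (f ≫ f') (g ≫ g') = actHom f g ≫ actHom f' g' :=
  match Z, W, V, g, g' with
  | one, one, one, _, _ => rfl
  | of _, of _, of _, g, g' => tensor_comp (C := C) f g f' g'

/-- The associativity isomorphism `(A ⊗ B) ⊗ Z ≅ A ⊗ (B ⊗ Z)`. -/
def actAssoc (A B : C) : (Z : WithUnit C) → (act (A ⊠ B) Z ≅ act A (act B Z))
  | one => Iso.refl (of (A ⊠ B))
  | of Z =>
    { hom := (assoc A B Z).hom
      inv := (assoc A B Z).inv
      hom_inv_id := (assoc A B Z).hom_inv_id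
      inv_hom_id := (assoc A B Z).inv_hom_id }

theorem actAssoc_naturality {A A' B B' : C} (f : A ⟶ A') (g : B ⟶ B') {Z W : WithUnit C}
    (h : Z ⟶ W) : actHom (f ⊠ₘ g) h ≫ (actAssoc A' B' W).hom =
      (actAssoc A B Z).hom ≫ actHom f (actHom g h) :=
  match Z, W, h with
  | one, one, _ => (Category.comp_id (obj := C) _).trans (Category.id_comp (obj := C) _).symm
  | of _, of _, h => assoc_naturality (C := C) f g h

/-- Tensoring with the new unit is faithful. -/
theorem actHom_one_injective {A B : C} {f g : A ⟶ B}
    (h : actHom f (𝟙 (one : WithUnit C)) = actHom g (𝟙 one)) : f = g := h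

/-- The functor `A ⊗ -`. -/
def actFunctor (A : C) : WithUnit C ⥤ WithUnit C where
  obj := act A
  map := actHom (𝟙 A)
  map_id := actHom_id A
  map_comp g g' := by rw [← actHom_comp, Category.comp_id]

/-- Whiskering `A ◁ g`. -/
abbrev whiskL (A : C) {Z W : WithUnit C} (g : Z ⟶ W) : act A Z ⟶ act A W := actHom (𝟙 A) g

/-- Whiskering `f ▷ Z`. -/
abbrev whiskR {A B : C} (f : A ⟶ B) (Z : WithUnit C) : act A Z ⟶ act B Z := actHom f (𝟙 Z)

theorem whiskL_comp (A : C) {Z W V : WithUnit C} (g : Z ⟶ W) (g' : W ⟶ V) :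
    whiskL A (g ≫ g') = whiskL A g ≫ whiskL A g' := (actFunctor A).map_comp g g'

theorem whiskR_comp {A B D : C} (f : A ⟶ B) (f' : B ⟶ D) (Z : WithUnit C) :
    whiskR (f ≫ f') Z = whiskR f Z ≫ whiskR f' Z := by
  rw [← actHom_comp, Category.comp_id]

theorem whiskR_whiskL {A B : C} (f : A ⟶ B) {Z W : WithUnit C} (g : Z ⟶ W) :
    whiskR f Z ≫ whiskL B g = whiskL A g ≫ whiskR f W := by
  rw [← actHom_comp, ← actHom_comp]; simp

/-- Whiskering of isomorphisms. -/
abbrev whiskLIso (A : C) {Z W : WithUnit C} (e : Z ≅ W) : act A Z ≅ act A W :=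
  (actFunctor A).mapIso e

/-- Whiskering of isomorphisms. -/
abbrev whiskRIso {A B : C} (e : A ≅ B) (Z : WithUnit C) : act A Z ≅ act B Z where
  hom := whiskR e.hom Z
  inv := whiskR e.inv Z
  hom_inv_id := by rw [← whiskR_comp, e.hom_inv_id]; exact actHom_id _ _
  inv_hom_id := by rw [← whiskR_comp, e.inv_hom_id]; exact actHom_id _ _

theorem actAssoc_pentagon (A B D : C) (Z : WithUnit C) :
    whiskR (assoc A B D).hom Z ≫ (actAssoc A (B ⊠ D) Z).hom ≫ whiskL A (actAssoc B D Z).hom =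
      (actAssoc (A ⊠ B) D Z).hom ≫ (actAssoc A B (act D Z)).hom :=
  match Z with
  | one => by
    have h : tensorHom (𝟙 A) (𝟙 (B ⊠ D)) = 𝟙 (A ⊠ (B ⊠ D)) := tensor_id _ _
    refine (congrArg (fun x => (assoc A B D).hom ≫ 𝟙 (A ⊠ (B ⊠ D)) ≫ x) h).trans ?_
    refine (congrArg ((assoc A B D).hom ≫ ·) (Category.id_comp _)).trans ?_
    exact (Category.comp_id _).trans (Category.id_comp (assoc A B D).hom).symm
  | of Z => pentagon A B D Z

theorem actAssoc_whiskL (A B : C) {Z W : WithUnit C} (g : Z ⟶ W) :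
    whiskL (A ⊠ B) g ≫ (actAssoc A B W).hom = (actAssoc A B Z).hom ≫ whiskL A (whiskL B g) := by
  rw [← actAssoc_naturality, tensor_id]

theorem actAssoc_inv_whiskL (A B : C) {Z W : WithUnit C} (g : Z ⟶ W) :
    (actAssoc A B Z).inv ≫ whiskL (A ⊠ B) g = whiskL A (whiskL B g) ≫ (actAssoc A B W).inv := by
  rw [Iso.inv_comp_eq, ← Category.assoc, ← actAssoc_whiskL, Category.assoc, Iso.hom_inv_id,
    Category.comp_id]

/-! The action of an object of the Drinfeld center, and its crossings with other objects. -/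

/-- The crossing `c ⊗ (Y ⊗ Z) ≅ Y ⊗ (c ⊗ Z)`, given by the half-braiding of `c`. -/
def crossing (c : Center C) (Y : C) (Z : WithUnit C) :
    act c.obj (act Y Z) ≅ act Y (act c.obj Z) :=
  (actAssoc c.obj Y Z).symm ≪≫ whiskRIso (c.half.β Y) Z ≪≫ actAssoc Y c.obj Z

theorem crossing_hom (c : Center C) (Y : C) (Z : WithUnit C) : (crossing c Y Z).hom =
    (actAssoc c.obj Y Z).inv ≫ whiskR (c.half.β Y).hom Z ≫ (actAssoc Y c.obj Z).hom := rfl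

theorem crossing_whiskL (c : Center C) (Y : C) {Z W : WithUnit C} (g : Z ⟶ W) :
    whiskL c.obj (whiskL Y g) ≫ (crossing c Y W).hom =
      (crossing c Y Z).hom ≫ whiskL Y (whiskL c.obj g) := by
  rw [crossing_hom, crossing_hom, Category.assoc, Category.assoc, ← actAssoc_whiskL,
    reassoc_of% whiskR_whiskL, reassoc_of% actAssoc_inv_whiskL]

theorem crossing_inv_whiskL (c : Center C) (Y : C) {Z W : WithUnit C} (g : Z ⟶ W) :
    whiskL Y (whiskL c.obj g) ≫ (crossing c Y W).inv =
      (crossing c Y Z).inv ≫ whiskL c.obj (whiskL Y g) := by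
  rw [Iso.comp_inv_eq, Category.assoc, crossing_whiskL, Iso.inv_hom_id_assoc]

theorem actAssoc_whiskR (A : C) {Y Y' : C} (f : Y ⟶ Y') (Z : WithUnit C) :
    whiskR (𝟙 A ⊠ₘ f) Z ≫ (actAssoc A Y' Z).hom = (actAssoc A Y Z).hom ≫ whiskL A (whiskR f Z) :=
  actAssoc_naturality _ _ _

theorem actAssoc_whiskR_left {A A' : C} (f : A ⟶ A') (Y : C) (Z : WithUnit C) :
    whiskR (f ⊠ₘ 𝟙 Y) Z ≫ (actAssoc A' Y Z).hom = (actAssoc A Y Z).hom ≫ whiskR f (act Y Z) := by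
  rw [actAssoc_naturality, actHom_id]

/-- The crossing is natural in the object that is crossed. -/
theorem crossing_naturality (c : Center C) {Y Y' : C} (f : Y ⟶ Y') (Z : WithUnit C) :
    whiskL c.obj (whiskR f Z) ≫ (crossing c Y' Z).hom =
      (crossing c Y Z).hom ≫ whiskR f (act c.obj Z) := by
  rw [crossing_hom, crossing_hom]
  simp only [Category.assoc]
  rw [← actAssoc_whiskR_left, ← reassoc_of% whiskR_comp, ← c.half.naturality,
    reassoc_of% whiskR_comp, Iso.eq_inv_comp, ← reassoc_of% actAssoc_whiskR, Iso.hom_inv_id_assoc]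

/-- The crossing of a tensor product. -/
theorem crossing_tensor (c : Center C) (Y Y' : C) (Z : WithUnit C) :
    (crossing c (Y ⊠ Y') Z).hom ≫ (actAssoc Y Y' (act c.obj Z)).hom =
      whiskL c.obj (actAssoc Y Y' Z).hom ≫ (crossing c Y (act Y' Z)).hom ≫
        whiskL Y (crossing c Y' Z).hom := by
  have p₁ := actAssoc_pentagon c.obj Y Y' Z
  have p₂ := actAssoc_pentagon Y c.obj Y' Z
  have p₃ := actAssoc_pentagon Y Y' c.obj Z
  have h := congrArg (fun x => whiskR x Z) (c.half.hexagon Y Y')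
  simp only [whiskR_comp] at h
  simp only [crossing_hom, whiskL_comp, Category.assoc]
  -- Both sides are brought into the form of the hexagon, applied to `Z`.
  rw [← cancel_epi (actAssoc c.obj (Y ⊠ Y') Z).hom, Iso.hom_inv_id_assoc]
  refine (Iso.cancel_iso_hom_left (whiskRIso (assoc c.obj Y Y') Z) _ _).1 ?_
  change whiskR (assoc c.obj Y Y').hom Z ≫ _ = whiskR (assoc c.obj Y Y').hom Z ≫ _
  rw [← p₃, reassoc_of% h, reassoc_of% p₁,
    Iso.hom_inv_id_assoc, ← reassoc_of% actAssoc_whiskR_left, ← reassoc_of% p₂,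
    reassoc_of% actAssoc_whiskR, ← whiskL_comp, ← whiskL_comp, ← whiskL_comp,
    Iso.hom_inv_id_assoc, whiskL_comp]

/-- The Yang–Baxter equation for two objects of the Drinfeld center and one further object. -/
theorem crossing_yb (c c' : Center C) (Y : C) (Z : WithUnit C) :
    (crossing c c'.obj (act Y Z)).hom ≫ whiskL c'.obj (crossing c Y Z).hom ≫
        (crossing c' Y (act c.obj Z)).hom =
      whiskL c.obj (crossing c' Y Z).hom ≫ (crossing c Y (act c'.obj Z)).hom ≫
        whiskL Y (crossing c c'.obj Z).hom := by
  have h₁ := crossing_tensor c c'.obj Y Z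
  have h₂ := crossing_tensor c Y c'.obj Z
  have h₃ := crossing_naturality c (c'.half.β Y).hom Z
  refine (Iso.cancel_iso_hom_left (whiskLIso c.obj (actAssoc c'.obj Y Z)) _ _).1 ?_
  change whiskL c.obj _ ≫ _ = whiskL c.obj _ ≫ _
  rw [← reassoc_of% h₁, crossing_hom c' Y (act c.obj Z), Iso.hom_inv_id_assoc, ← reassoc_of% h₃,
    h₂, crossing_hom c' Y Z, ← reassoc_of% whiskL_comp, ← reassoc_of% whiskL_comp,
    Iso.hom_inv_id_assoc]

end WithUnit

end SemigroupalCategory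

/-! ### Braids acting on tensor products of words -/

namespace SemigroupalCategory

open WithUnit

variable {C : Type u} [Category.{v} C] [SemigroupalCategory C]

/-- The letters of a word: objects of the center, for the closed strands, and objects of the
category, for the open strands. -/
inductive Letter (C : Type u) [Category.{v} C] [SemigroupalCategory C] : Type (max u v)
  | closed (c : Center C)
  | opened (Y : C)

namespace Letter

/-- The object underlying a letter. -/
def obj : Letter C → C
  | closed c => c.obj
  | opened Y => Y

/-- The indicator function of the closed letters. -/
def count : Letter C → ℕ
  | closed _ => 1
  | opened _ => 0

/-- The tensor product of the letters of a word, bracketed to the right, with `Z`. -/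
@[reducible] def prod : List (Letter C) → WithUnit C → WithUnit C
  | [], Z => Z
  | x :: w, Z => act x.obj (prod w Z)

/-- Concatenation of words. -/
def prodAppend : (w w' : List (Letter C)) → (Z : WithUnit C) →
    (prod (w ++ w') Z ≅ prod w (prod w' Z))
  | [], _, _ => Iso.refl _
  | x :: w, w', Z => whiskLIso x.obj (prodAppend w w' Z)

/-- `Cross p w w' e`: the word `w'` arises from `w` when the closed letter at the position `p`
passes behind the next letter, and `e` is the crossing. -/
inductive Cross {Z : WithUnit C} :
    ℕ → ∀ w w' : List (Letter C), (prod w Z ≅ prod w' Z) → Prop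
  | here (c : Center C) (x : Letter C) (w : List (Letter C)) :
      Cross 0 (closed c :: x :: w) (x :: closed c :: w) (crossing c x.obj (prod w Z))
  | there {p : ℕ} (x : Letter C) {w w' : List (Letter C)}
      {e : prod w Z ≅ prod w' Z} : Cross p w w' e →
      Cross (p + 1) (x :: w) (x :: w') (whiskLIso x.obj e)

/-- `Interp w b w' φ`: the morphism `φ` is a composite of crossings, according to a diagram of the
braid `b`, in which only closed letters pass behind other letters. -/
inductive Interp {Z : WithUnit C} (w : List (Letter C)) :
    Braid → ∀ w' : List (Letter C), (prod w Z ≅ prod w' Z) → Prop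
  | nil : Interp w 1 w (Iso.refl _)
  | pos {b : Braid} {w' w'' : List (Letter C)} {φ : prod w Z ≅ prod w' Z} {p : ℕ}
      {e : prod w' Z ≅ prod w'' Z} : Interp w b w' φ → Cross p w' w'' e →
      Interp w (b * Braid.σ p) w'' (φ ≪≫ e)
  | neg {b : Braid} {w' w'' : List (Letter C)} {φ : prod w Z ≅ prod w' Z} {p : ℕ}
      {e : prod w'' Z ≅ prod w' Z} : Interp w b w' φ → Cross p w'' w' e →
      Interp w (b * (Braid.σ p)⁻¹) w'' (φ ≪≫ e.symm)

namespace Interp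

variable {Z : WithUnit C} {w w' w'' : List (Letter C)} {b b' : Braid}

theorem of_cross {p : ℕ} {e : prod w Z ≅ prod w' Z} (h : Cross p w w' e) :
    Interp w (Braid.σ p) w' e := by
  have := Interp.nil.pos h
  rwa [one_mul, Iso.refl_trans] at this

theorem of_cross_symm {p : ℕ} {e : prod w Z ≅ prod w' Z} (h : Cross p w w' e) :
    Interp w' (Braid.σ p)⁻¹ w e.symm := by
  have := Interp.nil.neg h
  rwa [one_mul, Iso.refl_trans] at this

theorem trans {φ : prod w Z ≅ prod w' Z} {φ' : prod w' Z ≅ prod w'' Z} (h : Interp w b w' φ)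
    (h' : Interp w' b' w'' φ') : Interp w (b * b') w'' (φ ≪≫ φ') := by
  induction h' with
  | nil => rwa [mul_one, Iso.trans_refl]
  | pos _ hc ih => rw [← mul_assoc, ← Iso.trans_assoc]; exact ih.pos hc
  | neg _ hc ih => rw [← mul_assoc, ← Iso.trans_assoc]; exact ih.neg hc

theorem symm {φ : prod w Z ≅ prod w' Z} (h : Interp w b w' φ) : Interp w' b⁻¹ w φ.symm := by
  induction h with
  | nil => rw [inv_one]; exact Interp.nil
  | pos _ hc ih => rw [mul_inv_rev, Iso.trans_symm]; exact (of_cross_symm hc).trans ih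
  | neg _ hc ih =>
    rw [mul_inv_rev, inv_inv, Iso.trans_symm, Iso.symm_symm_eq]
    exact (of_cross hc).trans ih

theorem cons (x : Letter C) {φ : prod w Z ≅ prod w' Z} (h : Interp w b w' φ) :
    Interp (x :: w) (Braid.shift 1 b) (x :: w') (whiskLIso x.obj φ) := by
  induction h with
  | nil =>
    have : whiskLIso x.obj (Iso.refl (prod w Z)) = Iso.refl _ := (actFunctor x.obj).mapIso_refl _
    rw [map_one, this]
    exact Interp.nil
  | @pos b w' w'' φ p e _ hc ih =>
    have : whiskLIso x.obj (φ ≪≫ e) = whiskLIso x.obj φ ≪≫ whiskLIso x.obj e :=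
      (actFunctor x.obj).mapIso_trans _ _
    rw [map_mul, this, Braid.shift_σ, add_comm]
    exact ih.pos (.there x hc)
  | @neg b w' w'' φ p e _ hc ih =>
    have : whiskLIso x.obj (φ ≪≫ e.symm) = whiskLIso x.obj φ ≪≫ (whiskLIso x.obj e).symm :=
      (actFunctor x.obj).mapIso_trans _ _
    rw [map_mul, this, map_inv, Braid.shift_σ, add_comm]
    exact ih.neg (.there x hc)

end Interp

/-- Whiskering of an isomorphism with a word. -/
def prodIso : (w : List (Letter C)) → {Z Z' : WithUnit C} → (Z ≅ Z') → (prod w Z ≅ prod w Z')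
  | [], _, _, e => e
  | x :: w, _, _, e => whiskLIso x.obj (prodIso w e)

namespace Interp

variable {Z : WithUnit C} {w w' w'' : List (Letter C)} {b b' : Braid}

theorem append_left (u : List (Letter C)) {φ : prod w Z ≅ prod w' Z} (h : Interp w b w' φ) :
    Interp (u ++ w) (Braid.shift u.length b) (u ++ w')
      (prodAppend u w Z ≪≫ prodIso u φ ≪≫ (prodAppend u w' Z).symm) := by
  induction u with
  | nil =>
    rw [List.length_nil, Braid.shift_zero]
    change Interp w b w' (Iso.refl _ ≪≫ φ ≪≫ Iso.refl _)
    rwa [Iso.refl_trans, Iso.trans_refl]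
  | cons x u ih =>
    have := ih.cons x
    rw [Braid.shift_shift, add_comm 1] at this
    refine Eq.mp ?_ this
    congr 1
    refine Iso.ext ?_
    exact (whiskL_comp _ _ _).trans (congrArg (_ ≫ ·) (whiskL_comp _ _ _))

theorem _root_.SemigroupalCategory.Letter.Cross.append_right {p : ℕ} (v : List (Letter C))
    {φ : prod w (prod v Z) ≅ prod w' (prod v Z)} (h : Cross p w w' φ) :
    Cross p (w ++ v) (w' ++ v) (prodAppend w v Z ≪≫ φ ≪≫ (prodAppend w' v Z).symm) := by
  induction h with
  | here c x w =>
    refine Eq.mp ?_ (Cross.here (Z := Z) c x (w ++ v))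
    congr 1
    refine Iso.ext ?_
    have := crossing_whiskL c x.obj (prodAppend w v Z).hom
    refine (Iso.eq_comp_inv (whiskLIso x.obj (whiskLIso c.obj (prodAppend w v Z)))).2 this.symm
      |>.trans ?_
    exact Category.assoc _ _ _
  | there x h ih =>
    refine Eq.mp ?_ (Cross.there x ih)
    congr 1
    refine Iso.ext ?_
    exact (whiskL_comp _ _ _).trans (congrArg (_ ≫ ·) (whiskL_comp _ _ _))

theorem append_right (v : List (Letter C)) {φ : prod w (prod v Z) ≅ prod w' (prod v Z)}
    (h : Interp w b w' φ) :
    Interp (w ++ v) b (w' ++ v) (prodAppend w v Z ≪≫ φ ≪≫ (prodAppend w' v Z).symm) := by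
  induction h with
  | nil =>
    rw [Iso.refl_trans, Iso.self_symm_id]
    exact Interp.nil
  | pos _ hc ih =>
    have := ih.pos (hc.append_right v)
    simpa only [Iso.trans_assoc, Iso.symm_self_id_assoc] using this
  | neg _ hc ih =>
    have := ih.neg (hc.append_right v)
    simpa only [Iso.trans_symm, Iso.symm_symm_eq, Iso.trans_assoc, Iso.symm_self_id_assoc]
      using this

end Interp

/-! ### Moving the closed letters to the left -/

/-- The tensor product of some objects of the center with `Z`. -/
@[reducible] def centerProd : List (Center C) → WithUnit C → WithUnit C
  | [], Z => Z
  | c :: l, Z => act c.obj (centerProd l Z)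

/-- The tensor product of some objects with `Z`. -/
@[reducible] def openProd : List C → WithUnit C → WithUnit C
  | [], Z => Z
  | Y :: l, Z => act Y (openProd l Z)

/-- The transposition of the entries at the positions `p` and `p + 1`, if there are such. -/
@[reducible] def adjSwap {α : Type*} : ℕ → List α → List α
  | 0, [] => []
  | 0, [x] => [x]
  | 0, x :: y :: l => y :: x :: l
  | _ + 1, [] => []
  | p + 1, x :: l => x :: adjSwap p l

theorem length_adjSwap {α : Type*} (p : ℕ) (l : List α) : (adjSwap p l).length = l.length := by
  fun_induction adjSwap p l <;> simp_all

/-- The crossing of two objects of the center, the first passing behind the second if `ε` is true,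
and the second behind the first otherwise. -/
def cross : Bool → (c c' : Center C) → (Z : WithUnit C) →
    (act c.obj (act c'.obj Z) ⟶ act c'.obj (act c.obj Z))
  | true, c, c', Z => (crossing c c'.obj Z).hom
  | false, c, c', Z => (crossing c' c.obj Z).inv

theorem cross_cross (ε : Bool) (c c' : Center C) (Z : WithUnit C) :
    cross ε c c' Z ≫ cross (!ε) c' c Z = 𝟙 _ := by
  cases ε
  · exact Iso.inv_hom_id _
  · exact Iso.hom_inv_id _

theorem cross_whiskL (ε : Bool) (c c' : Center C) {Z W : WithUnit C} (g : Z ⟶ W) :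
    whiskL c.obj (whiskL c'.obj g) ≫ cross ε c c' W =
      cross ε c c' Z ≫ whiskL c'.obj (whiskL c.obj g) := by
  cases ε
  · exact crossing_inv_whiskL _ _ _
  · exact crossing_whiskL _ _ _

/-- The crossing of the objects at the positions `p` and `p + 1`, if there are such. -/
def crossAt (ε : Bool) : (p : ℕ) → (l : List (Center C)) → (Z : WithUnit C) →
    (centerProd l Z ⟶ centerProd (adjSwap p l) Z)
  | 0, [], _ => 𝟙 _
  | 0, [_], _ => 𝟙 _
  | 0, c :: c' :: l, Z => cross ε c c' (centerProd l Z)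
  | _ + 1, [], _ => 𝟙 _
  | p + 1, c :: l, Z => whiskL c.obj (crossAt ε p l Z)

/-- Moving an open letter to the right, past the closed letters. -/
def past (Y : C) : (l : List (Center C)) → (Z : WithUnit C) →
    (act Y (centerProd l Z) ≅ centerProd l (act Y Z))
  | [], _ => Iso.refl _
  | c :: l, Z => (crossing c Y (centerProd l Z)).symm ≪≫ whiskLIso c.obj (past Y l Z)

theorem past_cons (Y : C) (c : Center C) (l : List (Center C)) (Z : WithUnit C) :
    (past Y (c :: l) Z).hom =
      (crossing c Y (centerProd l Z)).inv ≫ whiskL c.obj (past Y l Z).hom :=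
  rfl

/-- The Yang–Baxter equation, with the open object moved from the left to the right. -/
theorem crossing_yb_inv (c c' : Center C) (Y : C) (Z : WithUnit C) :
    whiskL Y (crossing c c'.obj Z).hom ≫ (crossing c' Y (act c.obj Z)).inv ≫
        whiskL c'.obj (crossing c Y Z).inv =
      (crossing c Y (act c'.obj Z)).inv ≫ whiskL c.obj (crossing c' Y Z).inv ≫
        (crossing c c'.obj (act Y Z)).hom := by
  have h := crossing_yb c c' Y Z
  rw [Iso.eq_inv_comp]
  refine (Iso.eq_inv_comp (whiskLIso c.obj (crossing c' Y Z))).2 ?_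
  change whiskL c.obj (crossing c' Y Z).hom ≫ _ = _
  rw [← reassoc_of% h, Iso.hom_inv_id_assoc, ← whiskL_comp, Iso.hom_inv_id]
  exact (congrArg (_ ≫ ·) (actHom_id _ _)).trans (Category.comp_id _)

theorem past_cross (Y : C) (ε : Bool) (c c' : Center C) (l : List (Center C)) (Z : WithUnit C) :
    whiskL Y (cross ε c c' (centerProd l Z)) ≫ (past Y (c' :: c :: l) Z).hom =
      (past Y (c :: c' :: l) Z).hom ≫ cross ε c c' (centerProd l (act Y Z)) := by
  have main (c c' : Center C) :
      whiskL Y (crossing c c'.obj (centerProd l Z)).hom ≫ (past Y (c' :: c :: l) Z).hom =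
        (past Y (c :: c' :: l) Z).hom ≫ (crossing c c'.obj (centerProd l (act Y Z))).hom := by
    simp only [past_cons, whiskL_comp, Category.assoc]
    rw [crossing_whiskL, ← reassoc_of% crossing_yb_inv]
  cases ε
  · refine (Iso.eq_comp_inv (crossing c' c.obj (centerProd l (act Y Z)))).2 ?_
    rw [Category.assoc]
    refine (Iso.inv_comp_eq (whiskLIso Y (crossing c' c.obj (centerProd l Z)))).2 ?_
    exact (main c' c).symm
  · exact main c c'

/-- Crossings of closed letters commute with moving an open letter past them. -/
theorem past_crossAt (Y : C) (ε : Bool) (p : ℕ) (l : List (Center C)) (Z : WithUnit C) :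
    whiskL Y (crossAt ε p l Z) ≫ (past Y (adjSwap p l) Z).hom =
      (past Y l Z).hom ≫ crossAt ε p l (act Y Z) := by
  have triv {A B : WithUnit C} (g : act Y A ⟶ B) : whiskL Y (𝟙 A) ≫ g = g ≫ 𝟙 B := by
    rw [show whiskL Y (𝟙 A) = 𝟙 _ from actHom_id _ _, Category.id_comp, Category.comp_id]
  induction p generalizing l with
  | zero =>
    match l with
    | [] => exact triv _
    | [c] => exact triv _
    | c :: c' :: l => exact past_cross Y ε c c' l Z
  | succ p ih =>
    match l with
    | [] => exact triv _
    | c :: l =>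
      have h := congrArg (whiskL c.obj) (ih l)
      rw [whiskL_comp, whiskL_comp] at h
      simp only [adjSwap, crossAt, past_cons, Category.assoc]
      rw [← h, reassoc_of% crossing_inv_whiskL]

/-- A morphism from `A` to the tensor product of some closed letters, some open letters, and `Z`.
The letters are part of the state, as crossings permute the closed ones. -/
@[ext]
structure State (A Z : WithUnit C) where
  /-- The closed letters. -/
  closedPart : List (Center C)
  /-- The open letters. -/
  openPart : List C
  /-- The morphism. -/
  hom : A ⟶ centerProd closedPart (openProd openPart Z)

namespace State

variable {A B Z : WithUnit C}

/-- The identity, as a state. -/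
def base (l : List (Center C)) (o : List C) (Z : WithUnit C) :
    State (centerProd l (openProd o Z)) Z := ⟨l, o, 𝟙 _⟩

/-- Precomposition. -/
def pre (g : A ⟶ B) (s : State B Z) : State A Z := ⟨s.closedPart, s.openPart, g ≫ s.hom⟩

/-- Tensoring with a closed letter on the left. -/
def consClosed (c : Center C) (s : State A Z) : State (act c.obj A) Z :=
  ⟨c :: s.closedPart, s.openPart, whiskL c.obj s.hom⟩

/-- Tensoring with an open letter on the left, which is moved past the closed letters. -/
def consOpen (Y : C) (s : State A Z) : State (act Y A) Z :=
  ⟨s.closedPart, Y :: s.openPart, whiskL Y s.hom ≫ (past Y s.closedPart _).hom⟩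

/-- Crossing of closed letters. -/
def step (ε : Bool) (p : ℕ) (s : State A Z) : State A Z :=
  ⟨adjSwap p s.closedPart, s.openPart, s.hom ≫ crossAt ε p s.closedPart _⟩

theorem pre_comp {D : WithUnit C} (g : A ⟶ B) (h : B ⟶ D) (s : State D Z) :
    pre (g ≫ h) s = pre g (pre h s) := by
  simp only [pre, Category.assoc]

theorem pre_id (s : State A Z) : pre (𝟙 A) s = s := by simp only [pre, Category.id_comp]

/-- Every state arises by precomposition from an identity, so that equations between composites of
steps need only be checked on identities. -/
theorem pre_base (s : State A Z) : pre s.hom (base s.closedPart s.openPart Z) = s := by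
  simp only [pre, base, Category.comp_id]

theorem step_pre (ε : Bool) (p : ℕ) (g : A ⟶ B) (s : State B Z) :
    step ε p (pre g s) = pre g (step ε p s) := by
  simp only [pre, step, Category.assoc]

theorem consClosed_pre (c : Center C) (g : A ⟶ B) (s : State B Z) :
    consClosed c (pre g s) = pre (whiskL c.obj g) (consClosed c s) := by
  simp only [pre, consClosed, whiskL_comp]

theorem consOpen_pre (Y : C) (g : A ⟶ B) (s : State B Z) :
    consOpen Y (pre g s) = pre (whiskL Y g) (consOpen Y s) := by
  simp only [pre, consOpen, whiskL_comp, Category.assoc]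

theorem base_cons (c : Center C) (l : List (Center C)) (o : List C) :
    base (c :: l) o Z = consClosed c (base l o Z) :=
  State.ext rfl rfl (heq_of_eq (actHom_id _ _).symm)

theorem step_consClosed (ε : Bool) (p : ℕ) (c : Center C) (s : State A Z) :
    step ε (p + 1) (consClosed c s) = consClosed c (step ε p s) := by
  simp only [step, consClosed, adjSwap, crossAt, whiskL_comp]

theorem step_consOpen (ε : Bool) (p : ℕ) (Y : C) (s : State A Z) :
    step ε p (consOpen Y s) = consOpen Y (step ε p s) := by
  simp only [step, consOpen, whiskL_comp, Category.assoc, past_crossAt]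

/-- The first crossing, brought into the form of a precomposition. -/
theorem step_zero_cons_cons (ε : Bool) (c c' : Center C) (s : State A Z) :
    step ε 0 (consClosed c (consClosed c' s)) =
      pre (cross ε c c' A) (consClosed c' (consClosed c s)) := by
  simp only [step, consClosed, pre, adjSwap, crossAt, cross_whiskL]

/-- The crossing of a closed letter with an open one is absorbed by the normal form. -/
theorem consOpen_consClosed (Y : C) (c : Center C) (s : State A Z) :
    pre (crossing c Y A).hom (consOpen Y (consClosed c s)) = consClosed c (consOpen Y s) := by
  simp only [consOpen, consClosed, pre, past_cons, whiskL_comp]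
  rw [← reassoc_of% crossing_whiskL, Iso.hom_inv_id_assoc]

/-- Crossings at positions beyond the closed letters do nothing. -/
theorem step_of_length_le (ε : Bool) (p : ℕ) (s : State A Z) (h : s.closedPart.length ≤ p + 1) :
    step ε p s = s := by
  rw [← pre_base s, step_pre]
  congr 1
  generalize s.closedPart = l, s.openPart = o at h ⊢
  induction p generalizing l with
  | zero =>
    match l, h with
    | [], _ => simp only [step, base, adjSwap, crossAt, Category.comp_id]
    | [c], _ => simp only [step, base, adjSwap, crossAt, Category.comp_id]
  | succ p ih =>
    match l, h with
    | [], _ => simp only [step, base, adjSwap, crossAt, Category.comp_id]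
    | c :: l, h => rw [base_cons, step_consClosed, ih l (by simpa using h)]

theorem step_step (ε : Bool) (p : ℕ) (s : State A Z) : step (!ε) p (step ε p s) = s := by
  rw [← pre_base s, step_pre, step_pre]
  congr 1
  generalize s.closedPart = l, s.openPart = o
  induction p generalizing l with
  | zero =>
    match l with
    | [] => rw [step_of_length_le, step_of_length_le] <;> simp [step, base, adjSwap]
    | [c] => rw [step_of_length_le, step_of_length_le] <;> simp [step, base, adjSwap]
    | c :: c' :: l =>
      rw [base_cons, base_cons, step_zero_cons_cons, step_pre, step_zero_cons_cons, ← pre_comp,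
        cross_cross, pre_id]
  | succ p ih =>
    match l with
    | [] => rw [step_of_length_le, step_of_length_le] <;> simp [step, base, adjSwap]
    | c :: l => rw [base_cons, step_consClosed, step_consClosed, ih]

theorem step_far {i j : ℕ} (h : i + 2 ≤ j) (s : State A Z) :
    step true j (step true i s) = step true i (step true j s) := by
  rw [← pre_base s, step_pre, step_pre, step_pre, step_pre]
  congr 1
  generalize s.closedPart = l, s.openPart = o
  have short {i : ℕ} (hl : l.length ≤ j + 1) :
      step true j (step true i (base l o Z)) = step true i (step true j (base l o Z)) := by
    rw [step_of_length_le true j (base l o Z) hl, step_of_length_le]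
    simpa [step, base, length_adjSwap] using hl
  induction i generalizing l j with
  | zero =>
    obtain ⟨j, rfl⟩ : ∃ k, j = k + 1 + 1 := ⟨j - 2, by omega⟩
    match l with
    | [] => exact short (by simp)
    | [c] => exact short (by simp)
    | c :: c' :: l =>
      rw [base_cons, base_cons, step_zero_cons_cons, step_pre, step_consClosed, step_consClosed,
        step_consClosed, step_consClosed, step_zero_cons_cons]
  | succ i ih =>
    obtain ⟨j, rfl⟩ : ∃ k, j = k + 1 := ⟨j - 1, by omega⟩
    match l with
    | [] => exact short (by simp)
    | c :: l =>
      rw [base_cons, step_consClosed, step_consClosed, step_consClosed, step_consClosed,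
        ih (by omega) l]
      intro i hl
      rw [step_of_length_le true j (base l o Z) hl, step_of_length_le]
      simpa [step, base, length_adjSwap] using hl

/-- The braid relation.  It needs three closed letters: the steps at the last position do nothing,
and if there are only two letters from `i` on, the two sides differ. -/
theorem step_yb {i : ℕ} (s : State A Z) (h : i + 2 < s.closedPart.length) :
    step true i (step true (i + 1) (step true i s)) =
      step true (i + 1) (step true i (step true (i + 1) s)) := by
  rw [← pre_base s, step_pre, step_pre, step_pre, step_pre, step_pre, step_pre]
  congr 1
  generalize s.closedPart = l, s.openPart = o at h ⊢
  induction i generalizing l with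
  | zero =>
    match l, h with
    | a :: b :: c :: l, _ =>
      rw [base_cons, base_cons, base_cons]
      simp only [step_zero_cons_cons, step_consClosed, step_pre, consClosed_pre, ← pre_comp]
      congr 1
      exact (Category.assoc _ _ _).trans
        ((crossing_yb a b c.obj _).trans (Category.assoc _ _ _).symm)
  | succ i ih =>
    match l, h with
    | c :: l, h =>
      simp only [base_cons, step_consClosed]
      rw [ih l (Nat.lt_of_succ_lt_succ h)]

end State

end Letter
end SemigroupalCategory

/-! ### Composites of crossings are determined by their braids -/

namespace SemigroupalCategory
namespace Letter

open WithUnit State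

variable {C : Type u} [Category.{v} C] [SemigroupalCategory C]

/-- Moving the closed letters of a word to the left, behind the open letters. -/
def stateOf : (w : List (Letter C)) → (Z : WithUnit C) → State (prod w Z) Z
  | [], Z => ⟨[], [], 𝟙 Z⟩
  | closed c :: w, Z => consClosed c (stateOf w Z)
  | opened Y :: w, Z => consOpen Y (stateOf w Z)

theorem isIso_stateOf_hom (w : List (Letter C)) (Z : WithUnit C) : IsIso (stateOf w Z).hom := by
  induction w with
  | nil => exact inferInstanceAs (IsIso (𝟙 Z))
  | cons x w ih =>
    cases x with
    | closed c => exact ((actFunctor c.obj).mapIso (asIso (stateOf w Z).hom)).isIso_hom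
    | opened Y =>
      exact ((actFunctor Y).mapIso (asIso (stateOf w Z).hom) ≪≫ past Y _ _).isIso_hom

/-- The indicator function of the positions of the closed letters. -/
def kept : List (Letter C) → ℕ → ℕ
  | [], _ => 0
  | x :: _, 0 => x.count
  | _ :: w, p + 1 => kept w p

theorem kept_le_one (w : List (Letter C)) (p : ℕ) : kept w p ≤ 1 := by
  fun_induction kept w p with
  | case1 => exact Nat.zero_le _
  | case2 x => cases x <;> simp [count]
  | case3 x w p ih => exact ih

theorem sum_kept_succ (x : Letter C) (w : List (Letter C)) (m : ℕ) :
    ∑ j ∈ Finset.range (m + 1), kept (x :: w) j = ∑ j ∈ Finset.range m, kept w j + x.count :=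
  Finset.sum_range_succ' _ _

theorem sum_kept_le (w : List (Letter C)) (Z : WithUnit C) (m : ℕ) :
    ∑ j ∈ Finset.range m, kept w j ≤ (stateOf w Z).closedPart.length := by
  induction w generalizing m with
  | nil => simp [kept]
  | cons x w ih =>
    cases m with
    | zero => simp
    | succ m =>
      rw [sum_kept_succ]
      cases x with
      | closed c => exact Nat.succ_le_succ (ih m)
      | opened Y => exact ih m

theorem swapAt_succ_kept (p : ℕ) (x : Letter C) (w : List (Letter C)) {w' : List (Letter C)}
    (h : Braid.swapAt p (kept w) = kept w') :
    Braid.swapAt (p + 1) (kept (x :: w)) = kept (x :: w') := by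
  funext j
  cases j with
  | zero => exact Braid.swapAt_ne _ (by omega) (by omega)
  | succ j =>
    refine Eq.trans ?_ (congrFun h j)
    have : Equiv.swap (p + 1) (p + 1 + 1) (j + 1) = Equiv.swap p (p + 1) j + 1 := by
      simp only [Equiv.swap_apply_def]
      split_ifs <;> omega
    simp only [Braid.swapAt, this, kept]

theorem Cross.swapAt_kept {p : ℕ} {Z : WithUnit C} {w w' : List (Letter C)}
    {e : prod w Z ≅ prod w' Z} (h : Cross p w w' e) : Braid.swapAt p (kept w) = kept w' := by
  induction h with
  | here c x w =>
    funext j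
    match j with
    | 0 => exact Braid.swapAt_left _ _
    | 1 => exact Braid.swapAt_right _ _
    | j + 2 => exact Braid.swapAt_ne _ (by omega) (by omega)
  | there x _ ih => exact swapAt_succ_kept _ _ _ ih

/-- Up to the crossings of closed letters with open letters, a crossing is a crossing of two closed
letters, or trivial. -/
theorem Cross.pre_stateOf {p : ℕ} {Z : WithUnit C} {w w' : List (Letter C)}
    {e : prod w Z ≅ prod w' Z} (h : Cross p w w' e) :
    pre e.hom (stateOf w' Z) = if kept w p = 1 ∧ kept w (p + 1) = 1 then
      step true (∑ j ∈ Finset.range p, kept w j) (stateOf w Z) else stateOf w Z := by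
  induction h with
  | here c x w =>
    cases x with
    | closed c' =>
      rw [if_pos ⟨rfl, rfl⟩, Finset.sum_range_zero]
      exact (step_zero_cons_cons true c c' (stateOf w Z)).symm
    | opened Y =>
      rw [if_neg (by simp [kept, count])]
      exact consOpen_consClosed Y c (stateOf w Z)
  | @there p x w w' e _ ih =>
    rw [sum_kept_succ]
    change _ = if kept w p = 1 ∧ kept w (p + 1) = 1 then _ else _
    cases x with
    | closed c =>
      refine (consClosed_pre c e.hom (stateOf w' Z)).symm.trans ((congrArg _ ih).trans ?_)
      split_ifs
      · exact (step_consClosed true _ c (stateOf w Z)).symm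
      · rfl
    | opened Y =>
      refine (consOpen_pre Y e.hom (stateOf w' Z)).symm.trans ((congrArg _ ih).trans ?_)
      split_ifs
      · exact (step_consOpen true _ Y (stateOf w Z)).symm
      · rfl

/-- The crossing at the position `p`, as a permutation of the states with `n` closed letters. -/
def stepPerm (n : ℕ) (A Z : WithUnit C) (p : ℕ) :
    Equiv.Perm {s : State A Z // s.closedPart.length = n} where
  toFun s := ⟨step true p s.1, (length_adjSwap _ _).trans s.2⟩
  invFun s := ⟨step false p s.1, (length_adjSwap _ _).trans s.2⟩
  left_inv s := Subtype.ext (step_step true p s.1)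
  right_inv s := Subtype.ext (step_step false p s.1)

/-- The action of braids with `n` closed strands on states, where the open strands are deleted.  As
`step` satisfies the braid relations only on states with `n` closed letters, the group on which the
braids act consists of the permutations of these states. -/
def stateAction (n : ℕ) (A Z : WithUnit C) : Braid →*
    (Equiv.Perm (Braid.Kept n × (Equiv.Perm {s : State A Z // s.closedPart.length = n})ᵐᵒᵖ))ᵐᵒᵖ :=
  Braid.delAction (n := n) (fun p => MulOpposite.op (stepPerm n A Z p))
    (fun i j h => by
      rw [← MulOpposite.op_mul, ← MulOpposite.op_mul]
      congr 1
      ext1 s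
      exact Subtype.ext (step_far h s.1))
    (fun i h => by
      rw [← MulOpposite.op_mul, ← MulOpposite.op_mul, ← MulOpposite.op_mul, ← MulOpposite.op_mul]
      congr 1
      ext1 s
      exact Subtype.ext (step_yb s.1 (by rw [s.2]; exact h)))

namespace Interp

variable {Z : WithUnit C} {w w' : List (Letter C)}

/-- The action of the braid of a composite of crossings reproduces that composite, up to the
isomorphisms that move the closed letters to the left. -/
theorem stateAction_apply {b : Braid} {φ : prod w Z ≅ prod w' Z} (h : Interp w b w' φ) :
    ∃ x, (stateAction (stateOf w Z).closedPart.length (prod w Z) Z b).unop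
        (⟨kept w, kept_le_one w, sum_kept_le w Z⟩, 1) = x ∧
      x.1.1 = kept w' ∧ (x.2.unop ⟨stateOf w Z, rfl⟩).1 = pre φ.hom (stateOf w' Z) := by
  have gen {n : ℕ} {A : WithUnit C} (w : List (Letter C)) (p : ℕ)
      (s : {s : State A Z // s.closedPart.length = n}) :
      ((Braid.delGen (fun p => MulOpposite.op (stepPerm n A Z p)) (kept w) p).unop s).1 =
        if kept w p = 1 ∧ kept w (p + 1) = 1 then
          step true (∑ j ∈ Finset.range p, kept w j) s.1 else s.1 := by
    rw [Braid.delGen]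
    split_ifs <;> rfl
  have pre_ite {A B : WithUnit C} (g : A ⟶ B) (q : Prop) [Decidable q] (m : ℕ) (s : State B Z) :
      (if q then step true m (pre g s) else pre g s) = pre g (if q then step true m s else s) := by
    split_ifs
    · exact step_pre _ _ _ _
    · rfl
  induction h with
  | nil => exact ⟨_, rfl, by simp, by simp [pre_id]⟩
  | @pos b w' w'' φ p e _ hc ih =>
    obtain ⟨x, hx, hk, hg⟩ := ih
    refine ⟨_, rfl, ?_⟩
    rw [map_mul, MulOpposite.unop_mul, Equiv.Perm.mul_apply, hx, stateAction, Braid.delAction,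
      Braid.lift_σ]
    constructor
    · exact (congrArg (Braid.swapAt p) hk).trans hc.swapAt_kept
    · change ((Braid.delGen (fun p => MulOpposite.op
        (stepPerm (stateOf w Z).closedPart.length (prod w Z) Z p)) x.1.1 p).unop (x.2.unop _)).1 = _
      rw [hk, gen, hg, Iso.trans_hom, pre_comp, hc.pre_stateOf, pre_ite]
  | @neg b w' w'' φ p e _ hc ih =>
    obtain ⟨x, hx, hk, hg⟩ := ih
    refine ⟨_, rfl, ?_⟩
    rw [map_mul, MulOpposite.unop_mul, Equiv.Perm.mul_apply, hx, map_inv, MulOpposite.unop_inv,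
      stateAction, Braid.delAction, Braid.lift_σ]
    have hk' : Braid.swapAt p x.1.1 = kept w'' := by
      rw [hk, ← hc.swapAt_kept, Braid.swapAt_swapAt]
    constructor
    · exact hk'
    · change ((Braid.delGen (fun p => MulOpposite.op
        (stepPerm (stateOf w Z).closedPart.length (prod w Z) Z p)) (Braid.swapAt p x.1.1) p).unop⁻¹
        (x.2.unop _)).1 = _
      rw [hk']
      have e₁ : x.2.unop ⟨stateOf w Z, rfl⟩ = (Braid.delGen (fun p => MulOpposite.op
          (stepPerm (stateOf w Z).closedPart.length (prod w Z) Z p)) (kept w'') p).unop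
          ⟨pre (φ ≪≫ e.symm).hom (stateOf w'' Z), by
            have h₁ := (x.2.unop ⟨stateOf w Z, rfl⟩).2
            rw [hg] at h₁
            have h₂ := congrArg (fun s => s.closedPart.length) hc.pre_stateOf
            refine Eq.trans ?_ h₁
            refine Eq.trans ?_ h₂.symm
            change (stateOf w'' Z).closedPart.length = _
            split_ifs
            · exact (length_adjSwap _ _).symm
            · rfl⟩ := by
        refine Subtype.ext ?_
        refine hg.trans ?_
        rw [gen, pre_ite, ← hc.pre_stateOf, ← pre_comp]
        simp
      rw [e₁]
      exact congrArg Subtype.val (Equiv.symm_apply_apply _ _)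

/-- A composite of crossings is determined by its braid. -/
theorem unique {b : Braid} {φ φ' : prod w Z ≅ prod w' Z} (h : Interp w b w' φ)
    (h' : Interp w b w' φ') : φ = φ' := by
  obtain ⟨x, hx, -, hg⟩ := h.stateAction_apply
  obtain ⟨x', hx', -, hg'⟩ := h'.stateAction_apply
  obtain rfl : x = x' := hx.symm.trans hx'
  have e := hg.symm.trans hg'
  have := isIso_stateOf_hom w' Z
  refine Iso.ext ((cancel_mono (stateOf w' Z).hom).1 ?_)
  have e' := (State.ext_iff.1 e).2.2
  exact eq_of_heq e'

end Interp

end Letter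
end SemigroupalCategory

/-! ### Objects as tensor products of words -/

namespace SemigroupalCategory
namespace Letter

open WithUnit

variable {C : Type u} [Category.{v} C] [SemigroupalCategory C]

theorem prodAppend_naturality (w w' : List (Letter C)) {Z Z' : WithUnit C} (e : Z ≅ Z') :
    (prodIso (w ++ w') e).hom ≫ (prodAppend w w' Z').hom =
      (prodAppend w w' Z).hom ≫ (prodIso w (prodIso w' e)).hom := by
  induction w with
  | nil => exact (Category.comp_id _).trans (Category.id_comp _).symm
  | cons x w ih =>
    exact (whiskL_comp _ _ _).symm.trans ((congrArg (whiskL x.obj) ih).trans (whiskL_comp _ _ _))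

theorem prodIso_symm (w : List (Letter C)) {Z Z' : WithUnit C} (e : Z ≅ Z') :
    prodIso w e.symm = (prodIso w e).symm := by
  induction w with
  | nil => rfl
  | cons x w ih => exact congrArg (whiskLIso x.obj) ih

theorem prodAppend_assoc (w w' w'' : List (Letter C)) (Z : WithUnit C) :
    (prodAppend (w ++ w') w'' Z).hom ≫ (prodAppend w w' (prod w'' Z)).hom =
      eqToHom (by rw [List.append_assoc]) ≫ (prodAppend w (w' ++ w'') Z).hom ≫
        (prodIso w (prodAppend w' w'' Z)).hom := by
  induction w with
  | nil =>
    refine (Category.comp_id _).trans ?_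
    exact ((Category.id_comp _).trans (Category.id_comp _)).symm
  | cons x w ih =>
    have h := congrArg (whiskL x.obj) ih
    have e {A B : WithUnit C} (h : A = B) :
        whiskL x.obj (eqToHom h) = eqToHom (congrArg (act x.obj) h) := by
      subst h
      exact actHom_id _ _
    simp only [whiskL_comp, e] at h
    exact h

theorem Interp.of_eq {Z : WithUnit C} {w w' : List (Letter C)} (h : w = w') :
    Interp w 1 w' (eqToIso (congrArg (prod · Z) h)) := by
  subst h
  exact .nil

/-- A natural identification of the tensor product with `A` and the tensor product with the letters
of the word `w`.  For the new unit it identifies `A` itself with the product of the letters, and the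
further factor `Z` is what allows for words to be concatenated. -/
structure Realization (w : List (Letter C)) (A : C) where
  /-- The identification. -/
  iso : ∀ Z : WithUnit C, act A Z ≅ prod w Z
  naturality : ∀ {Z Z' : WithUnit C} (e : Z ≅ Z'),
    whiskL A e.hom ≫ (iso Z').hom = (iso Z).hom ≫ (prodIso w e).hom

namespace Realization

variable {w w' w'' : List (Letter C)} {A A' A'' B B' : C}

/-- A single letter. -/
def single (x : Letter C) : Realization [x] x.obj where
  iso _ := Iso.refl _
  naturality _ := (Category.comp_id _).trans (Category.id_comp _).symm

/-- The tensor product of realizations. -/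
def tensor (r : Realization w A) (r' : Realization w' A') : Realization (w ++ w') (A ⊠ A') where
  iso Z := actAssoc A A' Z ≪≫ whiskLIso A (r'.iso Z) ≪≫ r.iso (prod w' Z) ≪≫
    (prodAppend w w' Z).symm
  naturality {Z Z'} e := by
    have h₁ : whiskL A (whiskL A' e.hom) ≫ whiskL A (r'.iso Z').hom =
        whiskL A (r'.iso Z).hom ≫ whiskL A (prodIso w' e).hom := by
      rw [← whiskL_comp, r'.naturality, whiskL_comp]
    have h₂ : (prodIso w (prodIso w' e)).hom ≫ (prodAppend w w' Z').inv =
        (prodAppend w w' Z).inv ≫ (prodIso (w ++ w') e).hom := by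
      rw [Iso.comp_inv_eq, Category.assoc, prodAppend_naturality, Iso.inv_hom_id_assoc]
    change whiskL (A ⊠ A') e.hom ≫ (actAssoc A A' Z').hom ≫ whiskL A (r'.iso Z').hom ≫
        (r.iso (prod w' Z')).hom ≫ (prodAppend w w' Z').inv =
      ((actAssoc A A' Z).hom ≫ whiskL A (r'.iso Z).hom ≫ (r.iso (prod w' Z)).hom ≫
        (prodAppend w w' Z).inv) ≫ (prodIso (w ++ w') e).hom
    rw [reassoc_of% actAssoc_whiskL, reassoc_of% h₁, reassoc_of% r.naturality, h₂]
    simp only [Category.assoc]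

/-- Transport along an isomorphism. -/
def ofIso (r : Realization w A) (e : A ≅ B) : Realization w B where
  iso Z := whiskRIso e.symm Z ≪≫ r.iso Z
  naturality {Z Z'} e' := by
    change whiskL B e'.hom ≫ whiskR e.inv Z' ≫ (r.iso Z').hom =
      (whiskR e.inv Z ≫ (r.iso Z).hom) ≫ (prodIso w e').hom
    rw [← reassoc_of% whiskR_whiskL, r.naturality, Category.assoc]

/-- The isomorphism `e` acts on the letters by crossings, according to the braid `b`. -/
def Compat (r : Realization w A) (r' : Realization w' A') (b : Braid) (e : A ≅ A') : Prop :=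
  ∀ Z, Interp w b w' ((r.iso Z).symm ≪≫ whiskRIso e Z ≪≫ r'.iso Z)

namespace Compat

variable {r : Realization w A} {r' : Realization w' A'} {r'' : Realization w'' A''}
  {b b' : Braid} {e : A ≅ A'} {e' : A' ≅ A''}

theorem refl (r : Realization w A) : Compat r r 1 (Iso.refl A) := fun Z => by
  have : (r.iso Z).symm ≪≫ whiskRIso (Iso.refl A) Z ≪≫ r.iso Z = Iso.refl _ := by
    ext1
    change (r.iso Z).inv ≫ whiskR (𝟙 A) Z ≫ (r.iso Z).hom = 𝟙 _
    rw [show whiskR (𝟙 A) Z = 𝟙 _ from actHom_id A Z, Category.id_comp, Iso.inv_hom_id]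
  rw [this]
  exact .nil

theorem trans (h : Compat r r' b e) (h' : Compat r' r'' b' e') :
    Compat r r'' (b * b') (e ≪≫ e') := fun Z => by
  refine Eq.mp ?_ ((h Z).trans (h' Z))
  congr 1
  ext1
  change ((r.iso Z).inv ≫ whiskR e.hom Z ≫ (r'.iso Z).hom) ≫ (r'.iso Z).inv ≫ whiskR e'.hom Z ≫
    (r''.iso Z).hom = (r.iso Z).inv ≫ whiskR (e.hom ≫ e'.hom) Z ≫ (r''.iso Z).hom
  simp only [Category.assoc, Iso.hom_inv_id_assoc, whiskR_comp]

theorem symm (h : Compat r r' b e) : Compat r' r b⁻¹ e.symm := fun Z => by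
  refine Eq.mp ?_ (h Z).symm
  congr 1
  ext1
  exact Category.assoc _ _ _

theorem ofIso (r : Realization w A) (e : A ≅ A') : Compat r (r.ofIso e) 1 e := fun Z => by
  refine Eq.mp ?_ (refl r Z)
  congr 1
  ext1
  change (r.iso Z).inv ≫ whiskR (𝟙 A) Z ≫ (r.iso Z).hom =
    (r.iso Z).inv ≫ whiskR e.hom Z ≫ whiskR e.inv Z ≫ (r.iso Z).hom
  rw [← reassoc_of% whiskR_comp, Iso.hom_inv_id]

/-- The first isomorphism is applied first, hence the length of the word `w₁'`. -/
theorem tensor {w₁ w₁' w₂ w₂' : List (Letter C)} {A₁ A₁' A₂ A₂' : C} {r₁ : Realization w₁ A₁}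
    {r₁' : Realization w₁' A₁'} {r₂ : Realization w₂ A₂} {r₂' : Realization w₂' A₂'}
    {e₁ : A₁ ≅ A₁'} {e₂ : A₂ ≅ A₂'} (h₁ : Compat r₁ r₁' b e₁) (h₂ : Compat r₂ r₂' b' e₂) :
    Compat (r₁.tensor r₂) (r₁'.tensor r₂') (b * Braid.shift w₁'.length b')
      (rIso e₁ A₂ ≪≫ lIso A₁' e₂) := fun Z => by
  refine Eq.mp ?_ (((h₁ (prod w₂ Z)).append_right w₂).trans ((h₂ Z).append_left w₁'))
  congr 1
  ext1
  have hn := r₁'.naturality ((r₂.iso Z).symm ≪≫ whiskRIso e₂ Z ≪≫ r₂'.iso Z)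
  have hn' : (r₁'.iso (prod w₂ Z)).hom ≫
      (prodIso w₁' ((r₂.iso Z).symm ≪≫ whiskRIso e₂ Z ≪≫ r₂'.iso Z)).hom =
      whiskL A₁' (r₂.iso Z).inv ≫ whiskL A₁' (whiskR e₂.hom Z) ≫ whiskL A₁' (r₂'.iso Z).hom ≫
        (r₁'.iso (prod w₂' Z)).hom := by
    rw [← hn, ← Category.assoc, ← Category.assoc, ← whiskL_comp, ← whiskL_comp]
    simp only [Category.assoc, Iso.trans_hom, Iso.symm_hom]
  change ((prodAppend w₁ w₂ Z).hom ≫ ((r₁.iso _).inv ≫ whiskR e₁.hom (prod w₂ Z) ≫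
      (r₁'.iso (prod w₂ Z)).hom) ≫ (prodAppend w₁' w₂ Z).inv) ≫ (prodAppend w₁' w₂ Z).hom ≫
      (prodIso w₁' ((r₂.iso Z).symm ≪≫ whiskRIso e₂ Z ≪≫ r₂'.iso Z)).hom ≫
      (prodAppend w₁' w₂' Z).inv =
    ((((prodAppend w₁ w₂ Z).hom ≫ (r₁.iso _).inv) ≫ whiskL A₁ (r₂.iso Z).inv) ≫
      (actAssoc A₁ A₂ Z).inv) ≫ whiskR ((e₁.hom ⊠ₘ 𝟙 A₂) ≫ (𝟙 A₁' ⊠ₘ e₂.hom)) Z ≫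
      (actAssoc A₁' A₂' Z).hom ≫ whiskL A₁' (r₂'.iso Z).hom ≫ (r₁'.iso _).hom ≫
      (prodAppend w₁' w₂' Z).inv
  simp only [Category.assoc, Iso.inv_hom_id_assoc, whiskR_comp]
  rw [reassoc_of% hn', reassoc_of% actAssoc_whiskR, reassoc_of% actAssoc_whiskR_left,
    Iso.inv_hom_id_assoc, ← reassoc_of% whiskR_whiskL]

theorem congr (h : Compat r r' b e) (hb : b = b') {e' : A ≅ A'} (he : e = e') :
    Compat r r' b' e' :=
  hb ▸ he ▸ h

theorem tensor_right (h : Compat r r' b e) (s : Realization w'' A'') :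
    Compat (r.tensor s) (r'.tensor s) b (rIso e A'') :=
  (h.tensor (.refl s)).congr (by simp) (Iso.ext (by simp [tensor_id]))

theorem tensor_left (s : Realization w'' A'') (h : Compat r r' b e) :
    Compat (s.tensor r) (s.tensor r') (Braid.shift w''.length b) (lIso A'' e) :=
  (tensor (.refl s) h).congr (by simp) (Iso.ext (by simp [tensor_id]))

theorem assoc (r : Realization w A) (r' : Realization w' A') (r'' : Realization w'' A'') :
    Compat ((r.tensor r').tensor r'') (r.tensor (r'.tensor r'')) 1
      (SemigroupalCategory.assoc A A' A'') := fun Z => by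
  refine Eq.mp ?_ (Interp.of_eq (Z := Z) (List.append_assoc w w' w''))
  congr 1
  ext1
  refine ((Iso.inv_comp_eq (((r.tensor r').tensor r'').iso Z)).2 ?_).symm
  have h₁ := prodAppend_assoc w w' w'' Z
  have h₂ := r.naturality (prodAppend w' w'' Z).symm
  have h₃ := actAssoc_pentagon A A' A'' Z
  have h₄ := actAssoc_whiskL A A' (r''.iso Z).hom
  rw [prodIso_symm] at h₂
  change whiskR (SemigroupalCategory.assoc A A' A'').hom Z ≫ (actAssoc A (A' ⊠ A'') Z).hom ≫
      whiskL A ((actAssoc A' A'' Z).hom ≫ whiskL A' (r''.iso Z).hom ≫ (r'.iso (prod w'' Z)).hom ≫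
        (prodAppend w' w'' Z).inv) ≫ (r.iso _).hom ≫ (prodAppend w (w' ++ w'') Z).inv =
    ((actAssoc (A ⊠ A') A'' Z).hom ≫ whiskL (A ⊠ A') (r''.iso Z).hom ≫
      ((actAssoc A A' (prod w'' Z)).hom ≫ whiskL A (r'.iso (prod w'' Z)).hom ≫
        (r.iso (prod w' (prod w'' Z))).hom ≫ (prodAppend w w' (prod w'' Z)).inv) ≫
      (prodAppend (w ++ w') w'' Z).inv) ≫ (eqToIso _).hom
  have h₅ : (prodAppend w w' (prod w'' Z)).inv ≫ (prodAppend (w ++ w') w'' Z).inv ≫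
      eqToHom (by rw [List.append_assoc]) =
      (prodIso w (prodAppend w' w'' Z)).inv ≫ (prodAppend w (w' ++ w'') Z).inv := by
    rw [Iso.inv_comp_eq, Iso.inv_comp_eq, ← Category.assoc, h₁]
    simp
  change whiskL A (prodAppend w' w'' Z).inv ≫ _ = _ ≫ (prodIso w (prodAppend w' w'' Z)).inv at h₂
  simp only [whiskL_comp, Category.assoc, eqToIso.hom]
  rw [h₅, reassoc_of% h₄, reassoc_of% h₂, reassoc_of% h₃]

/-- A half-braiding of a closed letter acts on two letters as one crossing. -/
theorem of_crossing (c : Center C) (x : Letter C) :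
    Compat ((single (closed c)).tensor (single x)) ((single x).tensor (single (closed c)))
      (Braid.σ 0) (c.half.β x.obj) := fun Z => by
  refine Eq.mp ?_ (Interp.of_cross (Cross.here (Z := Z) c x []))
  congr 1
  ext1
  have e (y y' : Letter C) : (((single y).tensor (single y')).iso Z).hom =
      (actAssoc y.obj y'.obj Z).hom := by
    change (actAssoc y.obj y'.obj Z).hom ≫ whiskL y.obj (𝟙 _) ≫ 𝟙 _ ≫
      ((actFunctor y.obj).mapIso (Iso.refl _)).inv = _
    rw [show whiskL y.obj (𝟙 _) = 𝟙 _ from actHom_id y.obj _, Functor.mapIso_refl]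
    change (actAssoc y.obj y'.obj Z).hom ≫ 𝟙 _ ≫ 𝟙 _ ≫ 𝟙 (act y.obj (act y'.obj Z)) = _
    rw [Category.comp_id, Category.comp_id, Category.comp_id]
  have h : ((single (closed c)).tensor (single x)).iso Z = actAssoc c.obj x.obj Z :=
    Iso.ext (e (closed c) x)
  rw [h]
  exact congrArg (fun g : act (x.obj ⊠ c.obj) Z ⟶ act x.obj (act c.obj Z) =>
      (actAssoc c.obj x.obj Z).inv ≫ whiskR (c.half.β x.obj).hom Z ≫ g)
    (e x (closed c)).symm

/-- An isomorphism is determined by its braid. -/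
theorem unique {e e' : A ≅ A'} (h : Compat r r' b e) (h' : Compat r r' b e') : e = e' := by
  have := (h one).unique (h' one)
  have e₁ := (Iso.cancel_iso_hom_left (r.iso one).symm _ _).1 (congrArg Iso.hom this)
  have e₂ := (Iso.cancel_iso_hom_right _ _ (r'.iso one)).1 e₁
  exact Iso.ext (actHom_one_injective e₂)

end Compat

end Realization

end Letter
end SemigroupalCategory

/-! ### Coherence for central functors -/

namespace Term

variable {I : Type} {κ : I → Color}

theorem word_cast {d d' : Color} (h : d = d') (t : Term κ d) :
    (h ▸ t : Term κ d').word = t.word := by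
  subst h
  rfl

/-- Closed terms are products of terms with a single input. -/
theorem closed_induction {P : Term κ .closed → Prop} (single : ∀ t, t.word.length = 1 → P t)
    (mulC : ∀ s t, P s → P t → P (mulC s t)) (t : Term κ .closed) : P t := by
  have main {d : Color} (t : Term κ d) (hd : d = .closed) : P (hd ▸ t) := by
    induction t with
    | leaf i => exact single _ (by rw [word_cast]; rfl)
    | mulC s t hs ht => exact mulC s t (hs rfl) (ht rfl)
    | mulO => cases hd
    | f => cases hd
  exact main t rfl

/-- Open terms are built by products from terms with a single input, and images under `f` of
products. -/
theorem opened_induction {P : Term κ .opened → Prop} (single : ∀ t, t.word.length = 1 → P t)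
    (f : ∀ s t, P (.f s) → P (.f t) → P (.f (.mulC s t)))
    (mulO : ∀ s t, P s → P t → P (mulO s t)) (t : Term κ .opened) : P t := by
  have main {d : Color} (t : Term κ d) (hd : d = .opened) : P (hd ▸ t) := by
    induction t with
    | leaf i => exact single _ (by rw [word_cast]; rfl)
    | mulC => cases hd
    | mulO s t hs ht => exact mulO s t (hs rfl) (ht rfl)
    | f s => exact closed_induction (P := fun s => P (.f s)) (fun s hs => single _ hs) f s
  exact main t rfl

end Term

namespace SemigroupalCategory

variable {C : Type u} [Category.{v} C] [SemigroupalCategory C]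

theorem braid_tensor_left [Braiding C] (X Y Z : C) : (Braiding.braid (X ⊠ Y) Z).hom =
    (assoc X Y Z).hom ≫ (𝟙 X ⊠ₘ (Braiding.braid Y Z).hom) ≫ (assoc X Z Y).inv ≫
      ((Braiding.braid X Z).hom ⊠ₘ 𝟙 Y) ≫ (assoc Z X Y).hom := by
  rw [← reassoc_of% Braiding.hexagon_reverse, Iso.hom_inv_id_assoc, Iso.inv_hom_id,
    Category.comp_id]

theorem braid_tensor_right [Braiding C] (X Y Z : C) : (Braiding.braid X (Y ⊠ Z)).hom =
    (assoc X Y Z).inv ≫ ((Braiding.braid X Y).hom ⊠ₘ 𝟙 Z) ≫ (assoc Y X Z).hom ≫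
      (𝟙 Y ⊠ₘ (Braiding.braid X Z).hom) ≫ (assoc Y Z X).inv := by
  rw [← reassoc_of% Braiding.hexagon_forward, Iso.inv_hom_id_assoc, Iso.hom_inv_id,
    Category.comp_id]

theorem Center.half_of_iso {X Y : Center C} (e : X ≅ Y) (Z : C) : (Y.half.β Z).hom =
    (e.inv.hom ⊠ₘ 𝟙 Z) ≫ (X.half.β Z).hom ≫ (𝟙 Z ⊠ₘ e.hom.hom) := by
  rw [← e.hom.comm, ← Category.assoc, r_comp, ← Center.comp_hom, e.inv_hom_id, Center.id_hom,
    tensor_id, Category.id_comp]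

theorem Center.half_of_tensor_iso {X X' Y : Center C} (e : X ⊠ X' ≅ Y) (Z : C) :
    (Y.half.β Z).hom = (e.inv.hom ⊠ₘ 𝟙 Z) ≫ (assoc X.obj X'.obj Z).hom ≫
      (𝟙 X.obj ⊠ₘ (X'.half.β Z).hom) ≫ (assoc X.obj Z X'.obj).inv ≫
      ((X.half.β Z).hom ⊠ₘ 𝟙 X'.obj) ≫ (assoc Z X.obj X'.obj).hom ≫ (𝟙 Z ⊠ₘ e.hom.hom) := by
  have h {W : C} (g : Z ⊠ (X.obj ⊠ X'.obj) ⟶ W) : (tensorβ X X' Z).hom ≫ g =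
      (assoc X.obj X'.obj Z).hom ≫ (𝟙 X.obj ⊠ₘ (X'.half.β Z).hom) ≫ (assoc X.obj Z X'.obj).inv ≫
      ((X.half.β Z).hom ⊠ₘ 𝟙 X'.obj) ≫ (assoc Z X.obj X'.obj).hom ≫ g := by
    rw [tensorβ_hom]
    simp only [Category.assoc]
  exact (half_of_iso e Z).trans (congrArg ((e.inv.hom ⊠ₘ 𝟙 Z) ≫ ·) (h _))

theorem HalfBraiding.of_iso {X : C} (b : HalfBraiding X) {Y Z : C} (e : Y ≅ Z) : (b.β Z).hom =
    (𝟙 X ⊠ₘ e.inv) ≫ (b.β Y).hom ≫ (e.hom ⊠ₘ 𝟙 X) := by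
  rw [← b.naturality, ← Category.assoc, l_comp, e.inv_hom_id, tensor_id, Category.id_comp]

end SemigroupalCategory

namespace GenData

open SemigroupalCategory

variable {M N : Type u} [Category.{v} M] [Category.{v} N]

namespace Rel

theorem congr {D : GenData M N} {full : Prop} {I : Type} {κ : I → Color}
    {X : ∀ i, carrier M N (κ i)} {d : Color} {t t' : Term κ d} {b b' : Braid}
    {A B : carrier M N d} {φ φ' : A ⟶ B}
    (h : D.Rel full X t t' b φ) (hb : b = b') (hφ : φ = φ') : D.Rel full X t t' b' φ' :=
  hb ▸ hφ ▸ h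

end Rel

variable [SemigroupalCategory N] [SemigroupalCategory M] [Braiding M]
  (F : StrongBraidedFunctor M (Center N))

/-- The values on the generators determined by a central functor. -/
@[reducible] def ofFunctor : GenData M N where
  mulC X Y := X ⊠ Y
  mapC f g := f ⊠ₘ g
  mapC_id := tensor_id
  mapC_comp f g f' g' := tensor_comp f g f' g'
  mulO X Y := X ⊠ Y
  mapO f g := f ⊠ₘ g
  mapO_id := tensor_id
  mapO_comp f g f' g' := tensor_comp f g f' g'
  F :=
    { obj := fun X => (F.obj X).obj
      map := fun f => (F.map f).hom
      map_id := fun X => congrArg Center.Hom.hom (F.map_id X)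
      map_comp := fun f g => congrArg Center.Hom.hom (F.map_comp f g) }
  αC := assoc
  αO := assoc
  μ X Y :=
    { hom := (F.μ X Y).hom.hom
      inv := (F.μ X Y).inv.hom
      hom_inv_id := congrArg Center.Hom.hom (F.μ X Y).hom_inv_id
      inv_hom_id := congrArg Center.Hom.hom (F.μ X Y).inv_hom_id }
  τ := Braiding.braid
  ψ X Y := (F.obj X).half.β Y

variable {F} {I : Type} {κ : I → Color} {X : ∀ i, carrier M N (κ i)}

/-- By the hexagons, the braiding is generated by the braidings of single inputs. -/
theorem rel_τ (s t : Term κ .closed) :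
    (ofFunctor F).Rel False X (d := .closed) (.mulC s t) (.mulC t s)
      (Braid.blockCross s.word.length t.word.length)
      ((ofFunctor F).τ ((ofFunctor F).obj s X) ((ofFunctor F).obj t X)).hom := by
  induction t using Term.closed_induction with
  | single t ht =>
    induction s using Term.closed_induction with
    | single s hs => exact .τ s t (Or.inr ⟨hs, ht⟩)
    | mulC s₁ s₂ h₁ h₂ =>
      refine ((Rel.αC s₁ s₂ t).comp ((Rel.mapC (.id s₁) h₂).comp ((Rel.inv _ (.αC s₁ t s₂)).comp
        ((Rel.mapC h₁ (.id s₂)).comp (Rel.αC t s₁ s₂))))).congr ?_ ?_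
      · simp [Term.word, Braid.blockCross_add_left]
      · exact (braid_tensor_left (C := M) _ _ _).symm
  | mulC t₁ t₂ h₁ h₂ =>
    refine ((Rel.inv _ (Rel.αC s t₁ t₂)).comp ((Rel.mapC h₁ (.id t₂)).comp ((Rel.αC t₁ s t₂).comp
      ((Rel.mapC (.id t₁) h₂).comp (Rel.inv _ (Rel.αC t₁ t₂ s)))))).congr ?_ ?_
    · simp [Term.word, Braid.blockCross_add_right]
    · exact (braid_tensor_right (C := M) _ _ _).symm

/-- By the hexagons, the half-braidings are generated by those of single inputs with respect to
single inputs. -/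
theorem rel_ψ (s : Term κ .closed) (t : Term κ .opened) :
    (ofFunctor F).Rel False X (d := .opened) (.mulO (.f s) t) (.mulO t (.f s))
      (Braid.blockCross s.word.length t.word.length)
      ((ofFunctor F).ψ ((ofFunctor F).obj s X) ((ofFunctor F).obj t X)).hom := by
  have mul {t₁ t₂ : Term κ .opened}
      (h₁ : (ofFunctor F).Rel False X (d := .opened) (.mulO (.f s) t₁) (.mulO t₁ (.f s))
        (Braid.blockCross s.word.length t₁.word.length)
        ((ofFunctor F).ψ ((ofFunctor F).obj s X) ((ofFunctor F).obj t₁ X)).hom)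
      (h₂ : (ofFunctor F).Rel False X (d := .opened) (.mulO (.f s) t₂) (.mulO t₂ (.f s))
        (Braid.blockCross s.word.length t₂.word.length)
        ((ofFunctor F).ψ ((ofFunctor F).obj s X) ((ofFunctor F).obj t₂ X)).hom) :
      (ofFunctor F).Rel False X (d := .opened) (.mulO (.f s) (.mulO t₁ t₂))
        (.mulO (.mulO t₁ t₂) (.f s))
        (Braid.blockCross s.word.length (t₁.word.length + t₂.word.length))
        ((ofFunctor F).ψ ((ofFunctor F).obj s X) ((ofFunctor F).obj (.mulO t₁ t₂) X)).hom := by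
    refine ((Rel.inv _ (Rel.αO (.f s) t₁ t₂)).comp ((Rel.mapO h₁ (.id t₂)).comp
      ((Rel.αO t₁ (.f s) t₂).comp
      ((Rel.mapO (.id t₁) h₂).comp (Rel.inv _ (Rel.αO t₁ t₂ (.f s))))))).congr ?_ ?_
    · simp [Term.word, Braid.blockCross_add_right]
    · exact (Center.half_hexagon' (C := N) _ _ _).symm
  induction t using Term.opened_induction with
  | single t ht =>
    clear mul
    induction s using Term.closed_induction with
    | single s hs => exact .ψ s t (Or.inr ⟨hs, ht⟩)
    | mulC s₁ s₂ h₁ h₂ =>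
      refine ((Rel.mapO (Rel.inv _ (.μ s₁ s₂)) (.id t)).comp ((Rel.αO (.f s₁) (.f s₂) t).comp
        ((Rel.mapO (.id (.f s₁)) h₂).comp
        ((Rel.inv _ (.αO (.f s₁) t (.f s₂))).comp ((Rel.mapO h₁ (.id (.f s₂))).comp
        ((Rel.αO t (.f s₁) (.f s₂)).comp (Rel.mapO (.id t) (.μ s₁ s₂)))))))).congr ?_ ?_
      · simp [Term.word, Braid.blockCross_add_left]
      · exact (Center.half_of_tensor_iso (C := N) (F.μ _ _) _).symm
  | mulO t₁ t₂ h₁ h₂ => exact (mul h₁ h₂).congr (by simp [Term.word]) rfl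
  | f t₁ t₂ h₁ h₂ =>
    refine ((Rel.mapO (.id (.f s)) (Rel.inv _ (.μ t₁ t₂))).comp ((mul h₁ h₂).comp
      (Rel.mapO (.μ t₁ t₂) (.id (.f s))))).congr ?_ ?_
    · simp [Term.word]
    · exact (HalfBraiding.of_iso (C := N) _ ((ofFunctor F).μ _ _)).symm

/-- For a central functor, crossings of single strands suffice. -/
theorem Rel.ofFunctor_letters {d : Color} {t t' : Term κ d} {b : Braid} {A B : carrier M N d}
    {φ : A ⟶ B} {full : Prop} (h : (ofFunctor F).Rel full X t t' b φ) :
    (ofFunctor F).Rel False X t t' b φ := by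
  induction h with
  | id t => exact .id t
  | comp _ _ h h' => exact .comp h h'
  | inv φ _ h => exact .inv φ h
  | mapC _ _ h h' => exact .mapC h h'
  | mapO _ _ h h' => exact .mapO h h'
  | mapF _ h => exact .mapF h
  | αC s t r => exact .αC s t r
  | αO s t r => exact .αO s t r
  | μ s t => exact .μ s t
  | τ s t => exact rel_τ s t
  | ψ s t => exact rel_ψ s t

end GenData

namespace GenData

open SemigroupalCategory Letter

variable {M N : Type u} [Category.{v} M] [Category.{v} N]
  [SemigroupalCategory N] [SemigroupalCategory M] [Braiding M]
  (F : StrongBraidedFunctor M (Center N)) {I : Type} {κ : I → Color}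
  (X : ∀ i, carrier M N (κ i))

/-- The object of `N` underlying an object of either color. -/
def under : ∀ d : Color, carrier M N d ⥤ N
  | .closed => (ofFunctor F).F
  | .opened => 𝟭 N

/-- The letter given by an object. -/
def letterOf : ∀ d : Color, carrier M N d → Letter N
  | .closed, x => closed (F.obj x)
  | .opened, y => opened y

/-- The letters of the value of a term. -/
def letters : {d : Color} → Term κ d → List (Letter N)
  | _, .leaf i => [letterOf F (κ i) (X i)]
  | _, .mulC s t => letters s ++ letters t
  | _, .mulO s t => letters s ++ letters t
  | _, .f s => letters s

theorem length_letters {d : Color} (t : Term κ d) : (letters F X t).length = t.word.length := by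
  induction t with
  | leaf i => rfl
  | mulC s t hs ht => simp [letters, Term.word, hs, ht]
  | mulO s t hs ht => simp [letters, Term.word, hs, ht]
  | f s hs => exact hs

/-- An object as the tensor product of a single letter. -/
def realizeLetter : ∀ (d : Color) (x : carrier M N d),
    Realization [letterOf F d x] ((under F d).obj x)
  | .closed, x => .single (closed (F.obj x))
  | .opened, y => .single (opened y)

/-- The value of a term as the tensor product of its letters. -/
def realize : {d : Color} → (t : Term κ d) →
    Realization (letters F X t) ((under F d).obj ((ofFunctor F).obj t X))
  | _, .leaf i => realizeLetter F (κ i) (X i)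
  | _, .mulC s t => ((realize s).tensor (realize t)).ofIso ((ofFunctor F).μ _ _)
  | _, .mulO s t => (realize s).tensor (realize t)
  | _, .f s => realize s

/-- The realization is that of the single letter `x`.  (The word `[x]` and the object `x.obj` are
indices, as they agree with those of `realize` only propositionally.) -/
inductive _root_.SemigroupalCategory.Letter.Realization.IsSingle {C : Type u} [Category.{v} C]
    [SemigroupalCategory C] (x : Letter C) :
    ∀ {w : List (Letter C)} {A : C}, Realization w A → Prop
  | mk : IsSingle x (.single x)

theorem isSingle_realize {d : Color} (t : Term κ d) (h : t.word.length = 1) :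
    ∃ x, Realization.IsSingle x (realize F X t) ∧
      ∀ _ : d = .closed, x = letterOf F d ((ofFunctor F).obj t X) := by
  have letter (d : Color) (x : carrier M N d) :
      Realization.IsSingle (letterOf F d x) (realizeLetter F d x) := by
    cases d <;> exact .mk
  have long {s s' : List I} (h : (s ++ s').length = 1) (hs : 0 < s.length) (hs' : 0 < s'.length) :
      False := by
    rw [List.length_append] at h
    omega
  induction t with
  | leaf i => exact ⟨_, letter _ _, fun _ => rfl⟩
  | mulC s t => exact (long h s.length_word_pos t.length_word_pos).elim
  | mulO s t => exact (long h s.length_word_pos t.length_word_pos).elim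
  | f s hs =>
    obtain ⟨x, hx, -⟩ := hs h
    exact ⟨x, hx, nofun⟩

theorem _root_.SemigroupalCategory.Letter.Realization.Compat.of_isSingle {C : Type u}
    [Category.{v} C] [SemigroupalCategory C] {c : Center C} {x : Letter C}
    {w w' : List (Letter C)} {A : C} {r : Realization w c.obj} {r' : Realization w' A}
    (h : Realization.IsSingle (closed c) r) (h' : Realization.IsSingle x r') :
    (r.tensor r').Compat (r'.tensor r) (Braid.σ 0) (c.half.β A) := by
  cases h
  cases h'
  exact .of_crossing c x

variable {F X}

/-- The structure isomorphisms act on the letters by crossings. -/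
theorem Rel.compat {d : Color} {t t' : Term κ d} {b : Braid} {A B : carrier M N d} {φ : A ⟶ B}
    (h : (ofFunctor F).Rel False X t t' b φ) :
    ∃ e : (ofFunctor F).obj t X ≅ (ofFunctor F).obj t' X, e.hom ≍ φ ∧
      (realize F X t).Compat (realize F X t') b ((under F d).mapIso e) := by
  induction h with
  | id t =>
    refine ⟨Iso.refl _, HEq.rfl, ?_⟩
    rw [Functor.mapIso_refl]
    exact .refl _
  | comp h h' ih ih' =>
    obtain ⟨rfl, rfl⟩ := h.source_eq
    obtain ⟨-, rfl⟩ := h'.source_eq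
    obtain ⟨e, rfl, hc⟩ := ih
    obtain ⟨e', rfl, hc'⟩ := ih'
    refine ⟨e ≪≫ e', HEq.rfl, ?_⟩
    rw [Functor.mapIso_trans]
    exact hc.trans hc'
  | inv φ h ih =>
    obtain ⟨rfl, rfl⟩ := h.source_eq
    obtain ⟨e, he, hc⟩ := ih
    obtain rfl : e = φ := Iso.ext (eq_of_heq he)
    exact ⟨e.symm, HEq.rfl, hc.symm⟩
  | mapC h h' ih ih' =>
    obtain ⟨rfl, rfl⟩ := h.source_eq
    obtain ⟨rfl, rfl⟩ := h'.source_eq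
    obtain ⟨e, rfl, hc⟩ := ih
    obtain ⟨e', rfl, hc'⟩ := ih'
    refine ⟨(ofFunctor F).isoC e e', HEq.rfl, ?_⟩
    refine (((Realization.Compat.ofIso _ ((ofFunctor F).μ _ _)).symm.trans
      (hc.tensor hc')).trans (.ofIso _ ((ofFunctor F).μ _ _))).congr ?_ (Iso.ext ?_)
    · rw [length_letters, h.bicolored.perm.length_eq]
      simp
    · refine (congrArg (· ≫ _) (congrArg (_ ≫ ·) (hom_def (C := N) _ _).symm)).trans ?_
      refine (Category.assoc _ _ _).trans ((Iso.inv_comp_eq ((ofFunctor F).μ _ _)).2 ?_)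
      exact congrArg Center.Hom.hom (F.μ_naturality e.hom e'.hom)
  | mapO h h' ih ih' =>
    obtain ⟨rfl, rfl⟩ := h.source_eq
    obtain ⟨rfl, rfl⟩ := h'.source_eq
    obtain ⟨e, rfl, hc⟩ := ih
    obtain ⟨e', rfl, hc'⟩ := ih'
    refine ⟨(ofFunctor F).isoO e e', HEq.rfl, ?_⟩
    refine (hc.tensor hc').congr ?_ (Iso.ext (hom_def (C := N) _ _).symm)
    rw [length_letters, h.bicolored.perm.length_eq]
  | mapF h ih =>
    obtain ⟨rfl, rfl⟩ := h.source_eq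
    obtain ⟨e, rfl, hc⟩ := ih
    exact ⟨(ofFunctor F).F.mapIso e, HEq.rfl, hc⟩
  | αC s t r =>
    refine ⟨_, HEq.rfl, ?_⟩
    have c (s t : Term κ .closed) := Realization.Compat.ofIso
      ((realize F X s).tensor (realize F X t)) ((ofFunctor F).μ _ _)
    refine ((c (.mulC s t) r).symm.trans (((c s t).symm.tensor_right (realize F X r)).trans
      ((Realization.Compat.assoc _ _ _).trans (((c t r).tensor_left (realize F X s)).trans
        (c s (.mulC t r)))))).congr (by simp) (Iso.ext ?_)
    refine (Iso.inv_comp_eq ((ofFunctor F).μ _ _)).2 ((Iso.inv_comp_eq (rIso (C := N)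
      ((ofFunctor F).μ ((ofFunctor F).obj s X) ((ofFunctor F).obj t X))
      ((ofFunctor F).F.obj ((ofFunctor F).obj r X)))).2 ?_)
    exact (congrArg Center.Hom.hom (F.associativity _ _ _)).symm
  | αO s t r => exact ⟨_, HEq.rfl, .assoc _ _ _⟩
  | μ s t => exact ⟨_, HEq.rfl, .ofIso _ _⟩
  | τ s t h =>
    obtain ⟨hs, ht⟩ := h.resolve_left not_false
    obtain ⟨x, hx, hx'⟩ := isSingle_realize F X s hs
    obtain ⟨y, hy, -⟩ := isSingle_realize F X t ht
    obtain rfl := hx' rfl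
    refine ⟨_, HEq.rfl, ?_⟩
    rw [hs, ht, Braid.blockCross_one_one]
    refine (((Realization.Compat.ofIso _ ((ofFunctor F).μ _ _)).symm.trans
      (Realization.Compat.of_isSingle hx hy)).trans (.ofIso _ ((ofFunctor F).μ _ _))).congr
      (by simp) (Iso.ext ?_)
    refine (Category.assoc _ _ _).trans ((Iso.inv_comp_eq ((ofFunctor F).μ _ _)).2 ?_)
    exact (congrArg Center.Hom.hom (F.braided _ _)).symm
  | ψ s t h =>
    obtain ⟨hs, ht⟩ := h.resolve_left not_false
    obtain ⟨x, hx, hx'⟩ := isSingle_realize F X s hs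
    obtain ⟨y, hy, -⟩ := isSingle_realize F X t ht
    obtain rfl := hx' rfl
    refine ⟨_, HEq.rfl, ?_⟩
    rw [hs, ht, Braid.blockCross_one_one]
    exact Realization.Compat.of_isSingle hx hy

/-- Coherence for morphisms of `N`. -/
theorem Rel.unique_opened {full : Prop} {t t' : Term κ .opened} {b : Braid} {A B : N}
    {φ φ' : A ⟶ B} (h : (ofFunctor F).Rel full X (d := .opened) t t' b φ)
    (h' : (ofFunctor F).Rel full X (d := .opened) t t' b φ') : φ = φ' := by
  obtain ⟨rfl, rfl⟩ := h.source_eq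
  obtain ⟨e, rfl, hc⟩ := h.ofFunctor_letters.compat
  obtain ⟨e', rfl, hc'⟩ := h'.ofFunctor_letters.compat
  exact congrArg Iso.hom (hc.unique hc')

/-! Morphisms with values in `M`: the braiding of `M` is a central functor `M ⥤ Z(M)` that is
faithful. -/

variable (M) in
/-- The central functor `M ⥤ Z(M)` given by the braiding. -/
def _root_.SemigroupalCategory.selfCentral : StrongBraidedFunctor M (Center M) where
  obj X :=
    { obj := X
      half :=
        { β := Braiding.braid X
          naturality := Braiding.braid_naturality (𝟙 X)
          hexagon := Braiding.hexagon_forward X } }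
  map f := ⟨f, fun Z => Braiding.braid_naturality f (𝟙 Z)⟩
  μ X Y := Center.mkIso (Iso.refl (X ⊠ Y)) fun Z => by
    change (𝟙 (X ⊠ Y) ⊠ₘ 𝟙 Z) ≫ (Braiding.braid (X ⊠ Y) Z).hom = _ ≫ (𝟙 Z ⊠ₘ 𝟙 (X ⊠ Y))
    rw [tensor_id, tensor_id, Category.id_comp, braid_tensor_left]
    exact (Category.comp_id _).symm
  μ_naturality f g := Center.hom_ext ((Category.comp_id _).trans (Category.id_comp _).symm)
  associativity X Y Z := Center.hom_ext (by
    change (𝟙 _ ⊠ₘ 𝟙 _) ≫ 𝟙 _ ≫ (assoc X Y Z).hom = (assoc X Y Z).hom ≫ (𝟙 _ ⊠ₘ 𝟙 _) ≫ 𝟙 _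
    rw [tensor_id, tensor_id]
    simp)
  braided X Y := Center.hom_ext ((Category.id_comp _).trans (Category.comp_id _).symm)

/-- Replacing the objects of `N` by an object of `M`; open inputs do not occur in closed terms. -/
def toSelf (x : M) : ∀ d : Color, carrier M N d → carrier M M d
  | .closed, y => y
  | .opened, _ => x

/-- Replacing the morphisms of `N` by an identity of `M`. -/
def toSelfHom (x : M) : ∀ {d : Color} {A B : carrier M N d}, (A ⟶ B) →
    (toSelf x d A ⟶ toSelf x d B)
  | .closed, _, _, g => g
  | .opened, _, _, _ => 𝟙 (show M from x)

theorem obj_toSelf (x : M) {d : Color} (t : Term κ d) (hd : d = .closed) :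
    (ofFunctor (selfCentral M)).obj t (fun i => toSelf x (κ i) (X i)) =
      toSelf x d ((ofFunctor F).obj t X) := by
  induction t with
  | leaf i => rfl
  | mulC s t hs ht => exact congrArg₂ _ (hs rfl) (ht rfl)
  | mulO => cases hd
  | f => cases hd

/-- The morphisms of `M` composed of structure isomorphisms for `F` are those for the central
functor `M ⥤ Z(M)`. -/
theorem Rel.toSelf {full : Prop} (x : M) {d : Color} {t t' : Term κ d} {b : Braid}
    {A B : carrier M N d} {φ : A ⟶ B} (h : (ofFunctor F).Rel full X t t' b φ)
    (hd : d = .closed) :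
    (ofFunctor (selfCentral M)).Rel full (fun i => GenData.toSelf x (κ i) (X i)) t t' b
      (toSelfHom x φ) := by
  induction h with
  | id t =>
    subst hd
    have := Rel.id (D := ofFunctor (selfCentral M)) (full := full)
      (X := fun i => GenData.toSelf x (κ i) (X i)) t
    rw [obj_toSelf (F := F) x t rfl] at this
    exact this
  | comp h h' ih ih' =>
    subst hd
    exact (ih rfl).comp (ih' rfl)
  | @inv d t t' b A B φ h ih =>
    subst hd
    exact Rel.inv (D := ofFunctor (selfCentral M)) (d := .closed) (A := A) (B := B) φ (ih rfl)
  | mapC h h' ih ih' => exact (ih rfl).mapC (ih' rfl)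
  | αC s t r =>
    have := Rel.αC (D := ofFunctor (selfCentral M)) (full := full)
      (X := fun i => GenData.toSelf x (κ i) (X i)) s t r
    rw [obj_toSelf (F := F) x s rfl, obj_toSelf (F := F) x t rfl,
      obj_toSelf (F := F) x r rfl] at this
    exact this
  | τ s t h =>
    have := Rel.τ (D := ofFunctor (selfCentral M)) (full := full)
      (X := fun i => GenData.toSelf x (κ i) (X i)) s t h
    rw [obj_toSelf (F := F) x s rfl, obj_toSelf (F := F) x t rfl] at this
    exact this
  | _ => cases hd

/-- Coherence: for a central functor, a composite of structure isomorphisms is determined by its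
braid. -/
theorem Rel.unique {full : Prop} {d : Color} {t t' : Term κ d} {b : Braid} {A B : carrier M N d}
    {φ φ' : A ⟶ B} (h : (ofFunctor F).Rel full X t t' b φ)
    (h' : (ofFunctor F).Rel full X t t' b φ') : φ = φ' := by
  cases d with
  | closed => exact (Rel.mapF (h.toSelf A rfl)).unique_opened (Rel.mapF (h'.toSelf A rfl))
  | opened => exact h.unique_opened h'

end GenData

/-! ### The algebra of a central functor -/

theorem CategoryTheory.NatTrans.heq_of_app {C D : Type*} [Category* C] [Category* D]
    {F G F' G' : C ⥤ D} (hF : F = F') (hG : G = G') {α : F ⟶ G} {α' : F' ⟶ G'}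
    (h : ∀ X, α.app X ≍ α'.app X) : α ≍ α' := by
  subst hF hG
  exact heq_of_eq (NatTrans.ext (funext fun X => eq_of_heq (h X)))

theorem CategoryTheory.NatTrans.app_heq {C D : Type*} [Category* C] [Category* D]
    {F G F' G' : C ⥤ D} (hF : F = F') (hG : G = G') {α : F ⟶ G} {α' : F' ⟶ G'} (h : α ≍ α')
    (X : C) : α.app X ≍ α'.app X := by
  subst hF hG h
  rfl

theorem SemigroupalCategory.Center.half_naturality {C : Type u} [Category.{v} C]
    [SemigroupalCategory C] {X Y : Center C} (f : X ⟶ Y) {Z W : C} (k : Z ⟶ W) :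
    (f.hom ⊠ₘ k) ≫ (Y.half.β W).hom = (X.half.β Z).hom ≫ (k ⊠ₘ f.hom) := by
  rw [hom_def, Category.assoc, Y.half.naturality, reassoc_of% f.comm, ← tensor_comp,
    Category.id_comp, Category.comp_id]

namespace GenFunctors

variable {M N : Type u} [Category.{v} M] [Category.{v} N] (D : GenFunctors M N)

theorem eval_relabel {I J : Type} (e : I → J) (κ : J → Color) {d : Color}
    (t : Term (κ ∘ e) d) : D.eval (t.relabel e κ) =
      Pi.comap (fun j => carrier M N (κ j)) e ⋙ D.eval t :=
  Functor.hext (fun X => D.obj_relabel e κ t X) (fun _ _ g => D.map_relabel e κ t g)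

theorem eval_subst {I : Type} [Finite I] {κ : I → Color} {J : I → Type} [∀ i, Finite (J i)]
    (κJ : ∀ i, J i → Color) (y : ∀ i, Term (κJ i) (κ i)) {d : Color} (t : Term κ d) :
    D.eval (t.subst κJ y) =
      (endOperad (carrier M N)).comp (D.eval t) fun i => D.eval (y i) :=
  Functor.hext (fun X => D.obj_subst κJ y t X) (fun _ _ g => D.map_subst κJ y t g)

end GenFunctors

namespace GenData

open SemigroupalCategory

variable {M N : Type u} [Category.{v} M] [Category.{v} N]
  [SemigroupalCategory N] [SemigroupalCategory M] [Braiding M]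
  {F : StrongBraidedFunctor M (Center N)} {I : Type} {κ : I → Color}
  {X Y : ∀ i, carrier M N (κ i)}

theorem Rel.unique_heq {full : Prop} {d : Color} {t t' : Term κ d} {b : Braid}
    {A B A' B' : carrier M N d} {φ : A ⟶ B} {φ' : A' ⟶ B'}
    (h : (ofFunctor F).Rel full X t t' b φ)
    (h' : (ofFunctor F).Rel full X t t' b φ') : φ ≍ φ' := by
  obtain ⟨rfl, rfl⟩ := h.source_eq
  obtain ⟨rfl, rfl⟩ := h'.source_eq
  exact heq_of_eq (h.unique h')

/-- The structure isomorphisms of a central functor are natural. -/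
theorem Rel.exists_natural {d : Color} {t t' : Term κ d} {b : Braid}
    {A B : carrier M N d} {φ : A ⟶ B} (h : (ofFunctor F).Rel False X t t' b φ) (g : X ⟶ Y) :
    ∃ (ψ : (ofFunctor F).obj t Y ⟶ (ofFunctor F).obj t' Y)
      (φ' : (ofFunctor F).obj t X ⟶ (ofFunctor F).obj t' X),
      (ofFunctor F).Rel False Y t t' b ψ ∧ φ' ≍ φ ∧
        φ' ≫ (ofFunctor F).map t' g = (ofFunctor F).map t g ≫ ψ := by
  induction h with
  | id t => exact ⟨_, _, .id t, HEq.rfl, (Category.id_comp _).trans (Category.comp_id _).symm⟩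
  | comp h h' ih ih' =>
    obtain ⟨rfl, rfl⟩ := h.source_eq
    obtain ⟨-, rfl⟩ := h'.source_eq
    obtain ⟨ψ, _, hr, rfl, hn⟩ := ih
    obtain ⟨ψ', _, hr', rfl, hn'⟩ := ih'
    refine ⟨_, _, hr.comp hr', HEq.rfl, ?_⟩
    rw [Category.assoc, hn', reassoc_of% hn]
  | inv φ h ih =>
    obtain ⟨rfl, rfl⟩ := h.source_eq
    obtain ⟨ψ, _, hr, rfl, hn⟩ := ih
    obtain ⟨e, rfl⟩ := hr.exists_iso
    refine ⟨_, _, .inv e hr, HEq.rfl, ?_⟩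
    rw [Iso.inv_comp_eq, ← Category.assoc, hn, Category.assoc, Iso.hom_inv_id, Category.comp_id]
  | mapC h h' ih ih' =>
    obtain ⟨rfl, rfl⟩ := h.source_eq
    obtain ⟨rfl, rfl⟩ := h'.source_eq
    obtain ⟨ψ, _, hr, rfl, hn⟩ := ih
    obtain ⟨ψ', _, hr', rfl, hn'⟩ := ih'
    refine ⟨_, _, hr.mapC hr', HEq.rfl, ?_⟩
    refine ((ofFunctor F).mapC_comp _ _ _ _).symm.trans ?_
    exact (congrArg₂ (ofFunctor F).mapC hn hn').trans ((ofFunctor F).mapC_comp _ _ _ _)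
  | mapO h h' ih ih' =>
    obtain ⟨rfl, rfl⟩ := h.source_eq
    obtain ⟨rfl, rfl⟩ := h'.source_eq
    obtain ⟨ψ, _, hr, rfl, hn⟩ := ih
    obtain ⟨ψ', _, hr', rfl, hn'⟩ := ih'
    refine ⟨_, _, hr.mapO hr', HEq.rfl, ?_⟩
    refine ((ofFunctor F).mapO_comp _ _ _ _).symm.trans ?_
    exact (congrArg₂ (ofFunctor F).mapO hn hn').trans ((ofFunctor F).mapO_comp _ _ _ _)
  | mapF h ih =>
    obtain ⟨rfl, rfl⟩ := h.source_eq
    obtain ⟨ψ, _, hr, rfl, hn⟩ := ih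
    refine ⟨_, _, hr.mapF, HEq.rfl, ?_⟩
    refine ((ofFunctor F).F.map_comp _ _).symm.trans ?_
    exact (congrArg (ofFunctor F).F.map hn).trans ((ofFunctor F).F.map_comp _ _)
  | αC s t r => exact ⟨_, _, .αC s t r, HEq.rfl, (assoc_naturality (C := M) _ _ _).symm⟩
  | αO s t r => exact ⟨_, _, .αO s t r, HEq.rfl, (assoc_naturality (C := N) _ _ _).symm⟩
  | μ s t =>
    exact ⟨_, _, .μ s t, HEq.rfl, congrArg Center.Hom.hom (F.μ_naturality _ _).symm⟩
  | τ s t h => exact ⟨_, _, .τ s t h, HEq.rfl, (Braiding.braid_naturality (C := M) _ _).symm⟩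
  | ψ s t h =>
    exact ⟨_, _, .ψ s t h, HEq.rfl, (Center.half_naturality (C := N)
      (F.map ((ofFunctor F).map s g)) ((ofFunctor F).map t g)).symm⟩

theorem Rel.natural {d : Color} {t t' : Term κ d} {b : Braid}
    {φ : (ofFunctor F).obj t X ⟶ (ofFunctor F).obj t' X}
    {ψ : (ofFunctor F).obj t Y ⟶ (ofFunctor F).obj t' Y}
    (h : (ofFunctor F).Rel False X t t' b φ) (h' : (ofFunctor F).Rel False Y t t' b ψ)
    (g : X ⟶ Y) : (ofFunctor F).map t g ≫ ψ = φ ≫ (ofFunctor F).map t' g := by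
  obtain ⟨ψ', _, hr, rfl, hn⟩ := h.exists_natural g
  rw [h'.unique hr, hn]

variable (F)

/-- The value on a morphism of `PaPB` of the algebra given by a central functor. -/
noncomputable def value {d : Color} {x y : PaPBObj κ d} (f : x ⟶ y)
    (X : ∀ i, carrier M N (κ i)) :
    (ofFunctor F).obj x.term X ⟶ (ofFunctor F).obj y.term X :=
  (conn_of_bicolored (ofFunctor F) X f.bicolored).choose

theorem rel_value {d : Color} {x y : PaPBObj κ d} (f : x ⟶ y) (X : ∀ i, carrier M N (κ i)) :
    (ofFunctor F).Rel False X x.term y.term f.braid (value F f X) :=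
  (conn_of_bicolored (ofFunctor F) X f.bicolored).choose_spec

/-- The algebra over `PaPB` given by a central functor. -/
noncomputable def algebra : PaPBAlgebra M N where
  app {I} _ κ d :=
    { obj := fun x : PaPBObj κ d => (ofFunctor F).eval x.term
      map := fun {x y : PaPBObj κ d} (f : x ⟶ y) =>
        { app := value F f
          naturality := fun X Y g => (rel_value F f X).natural (rel_value F f Y) g }
      map_id := fun (x : PaPBObj κ d) => by
        refine NatTrans.ext (funext fun X => ?_)
        exact (rel_value F (𝟙 x) X).unique (.id x.term)
      map_comp := fun {x y z : PaPBObj κ d} (f : x ⟶ y) (g : y ⟶ z) => by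
        refine NatTrans.ext (funext fun X => ?_)
        exact (rel_value F (f ≫ g) X).unique ((rel_value F f X).comp (rel_value F g X)) }
  app_relabel {I J _ _} e κ d := by
    have h (x : PaPBObj (κ ∘ e) d) := (ofFunctor F).eval_relabel e κ x.term
    refine Functor.hext (fun x : PaPBObj (κ ∘ e) d => h x)
      (fun (x y : PaPBObj (κ ∘ e) d) (f : x ⟶ y) => NatTrans.heq_of_app (h x) (h y) fun X => ?_)
    exact (rel_value F ((PaPB.relabel e κ d).map f) X).unique_heq
      ((rel_value F f fun i => X (e i)).relabel e κ X)
  app_one d := rfl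
  app_comp x y := GenFunctors.eval_subst _ _ (fun i => PaPBObj.term (y i)) (PaPBObj.term x)
  app_compMap {I _ J _ κ κJ d x x' y y'} f g := by
    have h (x : PaPBObj κ d) (y : ∀ i, PaPBObj (κJ i) (κ i)) :=
      (ofFunctor F).eval_subst κJ (fun i => (y i).term) x.term
    refine NatTrans.heq_of_app (h x y) (h x' y') fun X => ?_
    have h₁ := Rel.juxtapose X (fun i => (rel_value F (g i) fun j => X ⟨i, j⟩).toFull)
      (PaPBObj.term x)
    have h₂ := Rel.subst (fun i => PaPBObj.term (y' i)) X (rel_value F f _).toFull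
    have h₃ := (h₁.comp h₂).congr_braid
      (b' := (PaPBObj.compMap (x := x) (x' := x') f g).braid) (by
        have e (y : ∀ i, PaPBObj (κJ i) (κ i)) : (fun i => (y i).term.word.length) =
            fun i => Nat.card (J i) := funext fun i => (y i).length_word
        exact congrArg₂ (fun ℓ ℓ' => juxtapose ℓ (fun i => PaPBObj.Hom.braid (g i))
          (PaPBObj.word x) * Braid.cable (blockSizes ℓ' (PaPBObj.word x))
          (PaPBObj.Hom.braid f)) (e y) (e y'))
    have h₄ : _ ≫ _ = _ ≫ _ :=
      (rel_value F f fun i => (ofFunctor F).obj (PaPBObj.term (y i)) fun j => X ⟨i, j⟩).natural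
        (rel_value F f fun i => (ofFunctor F).obj (PaPBObj.term (y' i)) fun j => X ⟨i, j⟩)
        (fun i => value F (g i) fun j => X ⟨i, j⟩)
    rw [h₄] at h₃
    exact (rel_value F (PaPBObj.compMap (x := x) (x' := x') f g) X).toFull.unique_heq h₃

theorem corresponds_algebra : Corresponds (algebra F) F where
  muC := rfl
  muO := rfl
  fObj := rfl
  alphaC X := heq_of_eq ((rel_value F PaPB.alphaC X).unique
    (.αC (X := X) (.leaf (κ := PaPB.ccc) 0) (.leaf (κ := PaPB.ccc) 1) (.leaf (κ := PaPB.ccc) 2)))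
  alphaO X := heq_of_eq ((rel_value F PaPB.alphaO X).unique
    (.αO (X := X) (.leaf (κ := PaPB.ooo) 0) (.leaf (κ := PaPB.ooo) 1) (.leaf (κ := PaPB.ooo) 2)))
  tau X := heq_of_eq ((rel_value F PaPB.tau X).unique
    ((Rel.τ (X := X) (.leaf (κ := PaPB.cc) 0) (.leaf (κ := PaPB.cc) 1)
      (Or.inr ⟨rfl, rfl⟩)).congr_braid (Braid.blockCross_one_one.trans (one_mul _).symm)))
  p X := heq_of_eq ((rel_value F PaPB.p X).unique
    (.μ (X := X) (.leaf (κ := PaPB.cc) 0) (.leaf (κ := PaPB.cc) 1)))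
  psi X := heq_of_eq ((rel_value F PaPB.psi X).unique
    ((Rel.ψ (X := X) (.leaf (κ := PaPB.co) 0) (.leaf (κ := PaPB.co) 1)
      (Or.inr ⟨rfl, rfl⟩)).congr_braid (Braid.blockCross_one_one.trans (one_mul _).symm)))

end GenData

/-! ### Algebras with prescribed values on the generators -/

/-- Two enumerations without repetitions that label the same word differ by a bijection. -/
theorem List.exists_equiv_of_map_eq {J J' I : Type} {e : J → I} {e' : J' → I} {w : List J}
    {w' : List J'} (hw : w.Nodup) (hc : ∀ j, j ∈ w) (hw' : w'.Nodup) (hc' : ∀ j, j ∈ w')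
    (h : w.map e = w'.map e') : ∃ ε : J ≃ J', w.map ε = w' ∧ e' ∘ ε = e := by
  classical
  have hl : w.length = w'.length := by simpa using congrArg List.length h
  let E := hw.getEquivOfForallMemList w hc
  let E' := hw'.getEquivOfForallMemList w' hc'
  refine ⟨E.symm.trans ((finCongr hl).trans E'), ?_, ?_⟩
  · refine List.ext_getElem (by simpa using hl) fun n h₁ h₂ => ?_
    have h₃ : n < w.length := by simpa using h₁
    have : E.symm w[n] = ⟨n, h₃⟩ := by
      rw [Equiv.symm_apply_eq]
      rfl
    rw [List.getElem_map, Equiv.trans_apply, this]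
    rfl
  · funext j
    obtain ⟨n, rfl⟩ := E.surjective j
    have := congrArg (fun l => l[n.1]?) h
    simp only [List.getElem?_map] at this
    simp only [Function.comp_apply, Equiv.trans_apply, Equiv.symm_apply_apply]
    rw [List.getElem?_eq_getElem n.2, List.getElem?_eq_getElem (hl ▸ n.2)] at this
    exact (Option.some.inj this).symm

namespace Term

variable {I J : Type} {κ : I → Color} {d : Color}

/-- A term is determined by its word and any relabelling of its inputs.  The color is generalized
in order to allow for an induction. -/
theorem heq_of_relabel_heq (e : J → I) {d d' : Color} (t : Term (κ ∘ e) d) (t' : Term (κ ∘ e) d')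
    (hd : d = d') (h : t.relabel e κ ≍ t'.relabel e κ) (hw : t.word = t'.word) : t ≍ t' := by
  have long {j : J} {w w' : List J} (hw : [j] = w ++ w') (h : 0 < w.length) (h' : 0 < w'.length) :
      False := by
    have := congrArg List.length hw
    simp at this
    omega
  have parts {a a' b b' : Color} {s : Term (κ ∘ e) a} {s' : Term (κ ∘ e) a'} {t : Term (κ ∘ e) b}
      {t' : Term (κ ∘ e) b'} (hw : s.word ++ t.word = s'.word ++ t'.word)
      (h : (s.relabel e κ).word = (s'.relabel e κ).word) :
      s.word = s'.word ∧ t.word = t'.word := by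
    refine List.append_inj hw ?_
    rw [word_relabel, word_relabel] at h
    simpa using congrArg List.length h
  induction t generalizing d' with
  | leaf j =>
    cases t' with
    | leaf j' =>
      obtain rfl : j = j' := by simpa [word] using hw
      rfl
    | mulC s' t' => exact (long hw s'.length_word_pos t'.length_word_pos).elim
    | mulO s' t' => exact (long hw s'.length_word_pos t'.length_word_pos).elim
    | f s' =>
      have := s'.closed_of_mem rfl j (by rw [show s'.word = [j] from hw.symm]; simp)
      exact nomatch this.symm.trans hd
  | mulC s t hs ht =>
    cases t' with
    | leaf j => exact (long hw.symm s.length_word_pos t.length_word_pos).elim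
    | mulC s' t' =>
      injection eq_of_heq h with h₁ h₂
      obtain ⟨w₁, w₂⟩ := parts hw (congrArg word h₁)
      obtain rfl := eq_of_heq (hs s' rfl (heq_of_eq h₁) w₁)
      obtain rfl := eq_of_heq (ht t' rfl (heq_of_eq h₂) w₂)
      rfl
    | mulO => cases hd
    | f => cases hd
  | mulO s t hs ht =>
    cases t' with
    | leaf j => exact (long hw.symm s.length_word_pos t.length_word_pos).elim
    | mulC => cases hd
    | mulO s' t' =>
      injection eq_of_heq h with h₁ h₂
      obtain ⟨w₁, w₂⟩ := parts hw (congrArg word h₁)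
      obtain rfl := eq_of_heq (hs s' rfl (heq_of_eq h₁) w₁)
      obtain rfl := eq_of_heq (ht t' rfl (heq_of_eq h₂) w₂)
      rfl
    | f s' => exact nomatch eq_of_heq h
  | f s hs =>
    cases t' with
    | leaf j =>
      have := s.closed_of_mem rfl j (by rw [show s.word = [j] from hw]; simp)
      exact nomatch hd.trans this
    | mulC => cases hd
    | mulO => exact nomatch eq_of_heq h
    | f s' =>
      injection eq_of_heq h with h₁
      obtain rfl := eq_of_heq (hs s' rfl (heq_of_eq h₁) hw)
      rfl

theorem eq_of_relabel_eq (e : J → I) {t t' : Term (κ ∘ e) d}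
    (h : t.relabel e κ = t'.relabel e κ) (hw : t.word = t'.word) : t = t' :=
  eq_of_heq (heq_of_relabel_heq e t t' rfl (heq_of_eq h) hw)

theorem relabel_subst {I₀ : Type} {κ₀ : I₀ → Color} {J : I₀ → Type} (e : ∀ i, J i → I)
    (y : ∀ i, Term (κ ∘ e i) (κ₀ i)) (t : Term κ₀ d) :
    (t.subst (fun i => κ ∘ e i) y).relabel (fun p : Σ i, J i => e p.1 p.2) κ =
      t.bind fun i => (y i).relabel (e i) κ := by
  induction t with
  | leaf i => exact relabel_relabel _ _ _ _
  | mulC s t hs ht => exact congrArg₂ _ hs ht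
  | mulO s t hs ht => exact congrArg₂ _ hs ht
  | f s hs => exact congrArg _ hs

end Term

namespace GenFunctors

variable {M N : Type u} [Category.{v} M] [Category.{v} N]

/-- The algebra `A` takes the values `D` on the generating objects. -/
structure Matches (A : PaPBAlgebra M N) (D : GenFunctors M N) : Prop where
  muC : (A.app PaPB.cc .closed).obj PaPB.muC = D.eval (PaPBObj.term PaPB.muC)
  muO : (A.app PaPB.oo .opened).obj PaPB.muO = D.eval (PaPBObj.term PaPB.muO)
  fObj : (A.app PaPB.c .opened).obj PaPB.fObj = D.eval (PaPBObj.term PaPB.fObj)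

/-- The value of an algebra on a morphism of `PaPB`. -/
abbrev _root_.PaPBAlgebra.val (A : PaPBAlgebra M N) {I : Type} [Finite I] {κ : I → Color}
    {d : Color} {x y : PaPBObj κ d} (f : x ⟶ y) (X : ∀ i, carrier M N (κ i)) :
    ((A.app κ d).obj x).obj X ⟶ ((A.app κ d).obj y).obj X :=
  NatTrans.app ((A.app κ d).map f) X

variable (A : PaPBAlgebra M N)

theorem obj_relabel_eq {I J : Type} [Finite I] [Finite J] (e : I ≃ J) {κ : J → Color} {d : Color}
    (x : PaPBObj (κ ∘ e) d) : (A.app κ d).obj (x.relabel e κ) =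
      Pi.comap (fun j => carrier M N (κ j)) e ⋙ (A.app (κ ∘ e) d).obj x :=
  Functor.congr_obj (A.app_relabel e κ d) x

theorem val_relabel {I J : Type} [Finite I] [Finite J] (e : I ≃ J) {κ : J → Color} {d : Color}
    {x y : PaPBObj (κ ∘ e) d} {f : x ⟶ y} {g : x.relabel e κ ⟶ y.relabel e κ}
    (h : g.braid = f.braid) (X : ∀ j, carrier M N (κ j)) :
    A.val g X ≍ A.val f fun i => X (e i) := by
  have : g = (PaPB.relabel e κ d).map f := PaPBObj.hom_ext h
  subst this
  exact NatTrans.app_heq (obj_relabel_eq A e x) (obj_relabel_eq A e y)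
    (Functor.hcongr_hom (A.app_relabel e κ d) f) X

theorem val_compMap {I : Type} [Finite I] {J : I → Type} [∀ i, Finite (J i)] {κ : I → Color}
    {κJ : ∀ i, J i → Color} {d : Color} {x x' : PaPBObj κ d} {y y' : ∀ i, PaPBObj (κJ i) (κ i)}
    (f : x ⟶ x') (g : ∀ i, y i ⟶ y' i) (X : ∀ p : Σ i, J i, carrier M N (κJ p.1 p.2)) :
    A.val (PaPBObj.compMap f g) X ≍ A.val f _ ≫
      ((A.app κ d).obj x').map fun i => A.val (g i) fun j => X ⟨i, j⟩ :=
  NatTrans.app_heq (A.app_comp x y) (A.app_comp x' y') (A.app_compMap f g) X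

variable {A} {D : GenFunctors M N}

/-- Every term arises by relabelling from an object of `PaPB` on which the algebra has the expected
value. -/
theorem Matches.exists_linear (hA : Matches A D) {I : Type} {κ : I → Color} {d : Color}
    (t : Term κ d) : ∃ (J : Type) (_ : Finite J) (e : J → I) (s : PaPBObj (κ ∘ e) d),
      s.term.relabel e κ = t ∧ (A.app (κ ∘ e) d).obj s = D.eval s.term := by
  have bind {I₀ : Type} [Finite I₀] {κ₀ : I₀ → Color} {d : Color} (x : PaPBObj κ₀ d)
      (hx : (A.app κ₀ d).obj x = D.eval x.term) (y : ∀ i, Term κ (κ₀ i))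
      (h : ∀ i, ∃ (J : Type) (_ : Finite J) (e : J → I) (s : PaPBObj (κ ∘ e) (κ₀ i)),
        s.term.relabel e κ = y i ∧ (A.app (κ ∘ e) (κ₀ i)).obj s = D.eval s.term) :
      ∃ (J : Type) (_ : Finite J) (e : J → I) (s : PaPBObj (κ ∘ e) d),
        s.term.relabel e κ = x.term.bind y ∧ (A.app (κ ∘ e) d).obj s = D.eval s.term := by
    choose J hJ e s hs hs' using h
    obtain rfl : (fun i => (s i).term.relabel (e i) κ) = y := funext hs
    refine ⟨Σ i, J i, inferInstance, fun p => e p.1 p.2, PaPBObj.comp x s,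
      Term.relabel_subst e _ _, ?_⟩
    refine (A.app_comp x s).trans ?_
    refine Eq.trans ?_ (D.eval_subst (fun i => κ ∘ e i) (fun i => (s i).term) x.term).symm
    rw [hx]
    congr 1
    funext i
    exact hs' i
  induction t with
  | leaf i => exact ⟨Unit, inferInstance, fun _ => i, PaPB.one (κ i), rfl, A.app_one (κ i)⟩
  | mulC s t hs ht =>
    exact bind _ hA.muC (fun i : Fin 2 => match i with | 0 => s | 1 => t)
      (fun i => match i with | 0 => hs | 1 => ht)
  | mulO s t hs ht =>
    exact bind _ hA.muO (fun i : Fin 2 => match i with | 0 => s | 1 => t)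
      (fun i => match i with | 0 => hs | 1 => ht)
  | f s hs => exact bind _ hA.fObj (fun _ => s) (fun _ => hs)

theorem _root_.PaPBObj.exists_equiv {I J : Type} {e : J → I} {κ : I → Color} {d : Color}
    {s : PaPBObj (κ ∘ e) d} {x : PaPBObj κ d} (h : s.term.relabel e κ = x.term) :
    ∃ ε : J ≃ I, ⇑ε = e := by
  have hw : s.word.map e = x.word.map id := by
    rw [← Term.word_relabel, h, List.map_id]
  obtain ⟨ε, -, hε⟩ := List.exists_equiv_of_map_eq s.nodup s.complete x.nodup x.complete hw
  exact ⟨ε, hε⟩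

/-- The values of an algebra on objects are determined by those on the generators. -/
theorem Matches.obj_eq (hA : Matches A D) {I : Type} [Finite I] {κ : I → Color} {d : Color}
    (x : PaPBObj κ d) : (A.app κ d).obj x = D.eval x.term := by
  obtain ⟨J, hJ, e, s, hs, hs'⟩ := hA.exists_linear x.term
  obtain ⟨ε, rfl⟩ := PaPBObj.exists_equiv hs
  obtain rfl : s.relabel ε κ = x := PaPBObj.ext hs
  rw [obj_relabel_eq, hs']
  exact (D.eval_relabel ε κ s.term).symm

end GenFunctors

/-- The algebra `A` takes the values `D` on the generators. -/
structure GenData.Matches {M N : Type u} [Category.{v} M] [Category.{v} N]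
    (A : PaPBAlgebra M N) (D : GenData M N) : Prop extends D.toGenFunctors.Matches A where
  alphaC : ∀ X : Fin 3 → M, NatTrans.app ((A.app PaPB.ccc .closed).map PaPB.alphaC) X ≍
    (D.αC (X 0) (X 1) (X 2)).hom
  alphaO : ∀ Y : Fin 3 → N, NatTrans.app ((A.app PaPB.ooo .opened).map PaPB.alphaO) Y ≍
    (D.αO (Y 0) (Y 1) (Y 2)).hom
  tau : ∀ X : Fin 2 → M, NatTrans.app ((A.app PaPB.cc .closed).map PaPB.tau) X ≍
    (D.τ (X 0) (X 1)).hom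
  p : ∀ X : Fin 2 → M, NatTrans.app ((A.app PaPB.cc .opened).map PaPB.p) X ≍
    (D.μ (X 0) (X 1)).hom
  psi : ∀ Z : ∀ i : Fin 2, carrier M N (PaPB.co i),
    NatTrans.app ((A.app PaPB.co .opened).map PaPB.psi) Z ≍
      (D.ψ (show M from Z 0) (show N from Z 1)).hom


/-! ### Morphisms composed of the values on the generators -/

theorem CategoryTheory.Category.comp_heq {C : Type*} [Category* C] {X Y Z X' Y' Z' : C} {f : X ⟶ Y}
    {g : Y ⟶ Z} {f' : X' ⟶ Y'} {g' : Y' ⟶ Z'} (hX : X = X') (hY : Y = Y') (hZ : Z = Z')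
    (hf : f ≍ f') (hg : g ≍ g') : f ≫ g ≍ f' ≫ g' := by
  subst hX hY hZ hf hg
  rfl

namespace GenData

open GenFunctors

variable {M N : Type u} [Category.{v} M] [Category.{v} N] (A : PaPBAlgebra M N)

theorem val_comp {I : Type} [Finite I] {κ : I → Color} {d : Color} {x y z : PaPBObj κ d}
    (f : x ⟶ y) (g : y ⟶ z) (X : ∀ i, carrier M N (κ i)) :
    A.val (f ≫ g) X = A.val f X ≫ A.val g X :=
  congrArg (fun α => NatTrans.app α X) ((A.app κ d).map_comp f g)

theorem val_id {I : Type} [Finite I] {κ : I → Color} {d : Color} (x : PaPBObj κ d)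
    (X : ∀ i, carrier M N (κ i)) : A.val (𝟙 x) X = 𝟙 _ :=
  congrArg (fun α => NatTrans.app α X) ((A.app κ d).map_id x)

/-- The morphism `φ` is the value of the algebra `A` on the morphism with the braid `b` between the
terms `t` and `t'`.  As inputs may be repeated or omitted in the terms, this refers to a morphism
of `PaPB` from which `t` and `t'` arise by a relabelling of the inputs. -/
def Lift {I : Type} {κ : I → Color} (X : ∀ i, carrier M N (κ i)) {d : Color} (t t' : Term κ d)
    (b : Braid) {P Q : carrier M N d} (φ : P ⟶ Q) : Prop :=
  ∃ (J : Type) (_ : Finite J) (e : J → I) (s s' : PaPBObj (κ ∘ e) d) (f : s ⟶ s'),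
    s.term.relabel e κ = t ∧ s'.term.relabel e κ = t' ∧ f.braid = b ∧
      ((A.app (κ ∘ e) d).obj s).obj (fun j => X (e j)) = P ∧
      ((A.app (κ ∘ e) d).obj s').obj (fun j => X (e j)) = Q ∧ A.val f (fun j => X (e j)) ≍ φ

namespace Lift

variable {A} {I : Type} {κ : I → Color} {X : ∀ i, carrier M N (κ i)} {d : Color}

theorem congr {t t' : Term κ d} {b b' : Braid} {P Q P' Q' : carrier M N d} {φ : P ⟶ Q}
    {φ' : P' ⟶ Q'} (h : Lift A X t t' b φ) (hb : b = b') (hP : P = P') (hQ : Q = Q')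
    (hφ : φ ≍ φ') : Lift A X t t' b' φ' := by
  subst hb hP hQ hφ
  exact h

theorem comp {t t' t'' : Term κ d} {b b' : Braid} {P Q R : carrier M N d} {φ : P ⟶ Q} {φ' : Q ⟶ R}
    (h : Lift A X t t' b φ) (h' : Lift A X t' t'' b' φ') :
    Lift A X t t'' (b * b') (φ ≫ φ') := by
  obtain ⟨J, hJ, e, s, s', f, rfl, hs', rfl, rfl, rfl, hφ⟩ := h
  obtain ⟨J', hJ', e', u, u', f', hu, rfl, rfl, hP, rfl, hφ'⟩ := h'
  have hw : s'.word.map e = u.word.map e' := by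
    rw [← Term.word_relabel, ← Term.word_relabel, hs', hu]
  obtain ⟨ε, hε, rfl⟩ := List.exists_equiv_of_map_eq s'.nodup s'.complete u.nodup u.complete hw
  obtain rfl : s'.relabel ε (κ ∘ e') = u := by
    refine PaPBObj.ext (Term.eq_of_relabel_eq e' ?_ ?_)
    · rw [hu, ← hs']
      exact Term.relabel_relabel _ _ _ _
    · exact (Term.word_relabel _ _ _).trans hε
  let g : s.relabel ε (κ ∘ e') ⟶ s'.relabel ε (κ ∘ e') := (PaPB.relabel ε (κ ∘ e') d).map f
  refine ⟨J', hJ', e', _, u', g ≫ f', Term.relabel_relabel _ _ _ _, rfl, rfl, ?_, rfl, ?_⟩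
  · rw [obj_relabel_eq]
    rfl
  · have h₁ := val_relabel A ε (f := f) (g := g) rfl fun j => X (e' j)
    rw [val_comp]
    have h₂ := Functor.congr_obj (obj_relabel_eq A ε (κ := κ ∘ e') s) fun j => X (e' j)
    exact Category.comp_heq h₂ hP rfl (h₁.trans hφ) hφ'

theorem inv {t t' : Term κ d} {b : Braid} {P Q : carrier M N d} (φ : P ≅ Q)
    (h : Lift A X t t' b φ.hom) : Lift A X t' t b⁻¹ φ.inv := by
  obtain ⟨J, hJ, e, s, s', f, rfl, rfl, rfl, rfl, rfl, hφ⟩ := h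
  refine ⟨J, hJ, e, s', s, Groupoid.inv f, rfl, rfl, rfl, rfl, rfl, heq_of_eq ?_⟩
  have h : A.val (Groupoid.inv f) (fun j => X (e j)) ≫ φ.hom = 𝟙 _ := by
    rw [← eq_of_heq hφ, ← val_comp, Groupoid.inv_comp, val_id]
  exact (Iso.eq_comp_inv φ).2 h |>.trans (Category.id_comp _)

/-- Insertion of morphisms in the inputs of a morphism of `PaPB`. -/
theorem bind {I₀ : Type} [Finite I₀] {κ₀ : I₀ → Color} {x x' : PaPBObj κ₀ d} (g : x ⟶ x')
    {t t' : ∀ i, Term κ (κ₀ i)} {β : I₀ → Braid} {P Q : ∀ i, carrier M N (κ₀ i)}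
    (γ : ∀ i, P i ⟶ Q i) (h : ∀ i, Lift A X (t i) (t' i) (β i) (γ i)) :
    Lift A X (x.term.bind t) (x'.term.bind t')
      (insertBraids (fun i => (t i).word.length) x.word g.braid β)
      (A.val g P ≫ ((A.app κ₀ d).obj x').map γ) := by
  choose J hJ e s s' f hs hs' hf hP hQ hγ using h
  obtain rfl : (fun i => (s i).term.relabel (e i) κ) = t := funext hs
  obtain rfl : (fun i => (s' i).term.relabel (e i) κ) = t' := funext hs'
  obtain rfl : (fun i => (f i).braid) = β := funext hf
  obtain rfl : (fun i => ((A.app _ _).obj (s i)).obj fun j => X (e i j)) = P := funext hP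
  obtain rfl : (fun i => ((A.app _ _).obj (s' i)).obj fun j => X (e i j)) = Q := funext hQ
  obtain rfl : (fun i => A.val (f i) fun j => X (e i j)) = γ := funext fun i => eq_of_heq (hγ i)
  refine ⟨Σ i, J i, inferInstance, fun p => e p.1 p.2, PaPBObj.comp x s, PaPBObj.comp x' s',
    PaPBObj.compMap g f, Term.relabel_subst e _ _, Term.relabel_subst e _ _, ?_, ?_, ?_, ?_⟩
  · change insertBraids _ _ _ _ = _
    congr 1
    funext i
    rw [Term.word_relabel, List.length_map]
    exact (s i).length_word.symm
  · exact Functor.congr_obj (A.app_comp x s) _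
  · exact Functor.congr_obj (A.app_comp x' s') _
  · exact val_compMap A g f fun p => X (e p.1 p.2)

variable {D : GenData M N}

theorem mapC (hA : Matches A D) {s s' t t' : Term κ .closed} {b b' : Braid} {P Q P' Q' : M}
    {φ : P ⟶ Q} {φ' : P' ⟶ Q'} (h : Lift A X (d := .closed) s s' b φ)
    (h' : Lift A X (d := .closed) t t' b' φ') :
    Lift A X (d := .closed) (.mulC s t) (.mulC s' t') (b * Braid.shift s.word.length b')
      (D.mapC φ φ') := by
  have key := Lift.bind (A := A) (X := X) (κ₀ := PaPB.cc) (𝟙 (show PaPBObj _ _ from PaPB.muC))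
    (t := fun i => match i with | 0 => s | 1 => t) (t' := fun i => match i with | 0 => s' | 1 => t')
    (β := fun i => match i with | 0 => b | 1 => b')
    (P := fun i => match i with | 0 => P | 1 => P') (Q := fun i => match i with | 0 => Q | 1 => Q')
    (fun i => match i with | 0 => φ | 1 => φ') (fun i => match i with | 0 => h | 1 => h')
  rw [val_id, Category.id_comp] at key
  refine key.congr ?_ (Functor.congr_obj hA.muC _) (Functor.congr_obj hA.muC _)
    (Functor.hcongr_hom hA.muC _)
  change juxtapose _ _ [0, 1] * Braid.cable _ 1 = _
  simp [juxtapose, Braid.cable_one]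

theorem mapO (hA : Matches A D) {s s' t t' : Term κ .opened} {b b' : Braid} {P Q P' Q' : N}
    {φ : P ⟶ Q} {φ' : P' ⟶ Q'} (h : Lift A X (d := .opened) s s' b φ)
    (h' : Lift A X (d := .opened) t t' b' φ') :
    Lift A X (d := .opened) (.mulO s t) (.mulO s' t') (b * Braid.shift s.word.length b')
      (D.mapO φ φ') := by
  have key := Lift.bind (A := A) (X := X) (κ₀ := PaPB.oo) (𝟙 (show PaPBObj _ _ from PaPB.muO))
    (t := fun i => match i with | 0 => s | 1 => t) (t' := fun i => match i with | 0 => s' | 1 => t')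
    (β := fun i => match i with | 0 => b | 1 => b')
    (P := fun i => match i with | 0 => P | 1 => P') (Q := fun i => match i with | 0 => Q | 1 => Q')
    (fun i => match i with | 0 => φ | 1 => φ') (fun i => match i with | 0 => h | 1 => h')
  rw [val_id, Category.id_comp] at key
  refine key.congr ?_ (Functor.congr_obj hA.muO _) (Functor.congr_obj hA.muO _)
    (Functor.hcongr_hom hA.muO _)
  change juxtapose _ _ [0, 1] * Braid.cable _ 1 = _
  simp [juxtapose, Braid.cable_one]

theorem mapF (hA : Matches A D) {s s' : Term κ .closed} {b : Braid} {P Q : M} {φ : P ⟶ Q}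
    (h : Lift A X (d := .closed) s s' b φ) :
    Lift A X (d := .opened) (.f s) (.f s') b (D.F.map φ) := by
  have key := Lift.bind (A := A) (X := X) (κ₀ := PaPB.c) (𝟙 (show PaPBObj _ _ from PaPB.fObj))
    (t := fun _ => s) (t' := fun _ => s') (β := fun _ => b) (P := fun _ => P) (Q := fun _ => Q)
    (fun _ => φ) (fun _ => h)
  rw [val_id, Category.id_comp] at key
  refine key.congr ?_ (Functor.congr_obj hA.fObj _) (Functor.congr_obj hA.fObj _)
    (Functor.hcongr_hom hA.fObj _)
  change juxtapose _ _ [0] * Braid.cable _ 1 = _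
  simp [juxtapose, Braid.cable_one]

theorem id (hA : Matches A D) (t : Term κ d) : Lift A X t t 1 (𝟙 (D.obj t X)) := by
  induction t with
  | leaf i =>
    have h := congrArg (fun G : _ ⥤ _ => G.obj fun _ : Unit => X i) (A.app_one (κ i))
    refine ⟨Unit, inferInstance, fun _ => i, PaPB.one (κ i), PaPB.one (κ i), 𝟙 _, rfl, rfl, rfl,
      h, h, ?_⟩
    exact (heq_of_eq (val_id A (PaPB.one (κ i)) fun _ => X i)).trans
      (congr_arg_heq (fun P => 𝟙 P) h)
  | mulC s t hs ht =>
    exact (mapC hA hs ht).congr (by simp) rfl rfl (heq_of_eq (D.mapC_id _ _))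
  | mulO s t hs ht =>
    exact (mapO hA hs ht).congr (by simp) rfl rfl (heq_of_eq (D.mapO_id _ _))
  | f s hs => exact (mapF hA hs).congr rfl rfl rfl (heq_of_eq (D.F.map_id _))

/-- The value of the algebra on a morphism of `PaPB`, with terms substituted for the inputs. -/
theorem substitute (hA : Matches A D) {I₀ : Type} [Finite I₀] {κ₀ : I₀ → Color}
    {x x' : PaPBObj κ₀ d} (g : x ⟶ x') (t : ∀ i, Term κ (κ₀ i)) {P Q : carrier M N d}
    {φ : P ⟶ Q} (hP : D.obj x.term (fun i => D.obj (t i) X) = P)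
    (hQ : D.obj x'.term (fun i => D.obj (t i) X) = Q)
    (hφ : A.val g (fun i => D.obj (t i) X) ≍ φ) {b : Braid}
    (hb : Braid.cable (blockSizes (fun i => (t i).word.length) x.word) g.braid = b) :
    Lift A X (x.term.bind t) (x'.term.bind t) b φ := by
  have key := Lift.bind (A := A) (X := X) g (t := t) (t' := t) (β := fun _ => 1) (fun i => 𝟙 _)
    fun i => Lift.id hA (t i)
  refine key.congr ?_ ((Functor.congr_obj (hA.obj_eq x) _).trans hP)
    ((Functor.congr_obj (hA.obj_eq x') _).trans hQ) ?_
  · rw [insertBraids, juxtapose_one, one_mul, hb]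
  · refine HEq.trans (heq_of_eq ?_) hφ
    exact (congrArg _ (CategoryTheory.Functor.map_id _ _)).trans (Category.comp_id _)

end Lift

/-- If an algebra takes the values `D` on the generators, then every composite of these is the value
of the algebra on a morphism with the corresponding braid. -/
theorem Matches.lift {A} {D : GenData M N} (hA : Matches A D) {I : Type} {κ : I → Color}
    {X : ∀ i, carrier M N (κ i)} {full : Prop} {d : Color} {t t' : Term κ d} {b : Braid}
    {P Q : carrier M N d} {φ : P ⟶ Q} (h : D.Rel full X t t' b φ) : Lift A X t t' b φ := by
  have cross (ℓ : Fin 2 → ℕ) : Braid.cable (blockSizes ℓ [0, 1]) (1 * Braid.σ 0) =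
      Braid.blockCross (ℓ 0) (ℓ 1) := by
    rw [one_mul, ← Braid.blockCross_one_one]
    simpa using cable_blockCross ℓ [0] [1]
  induction h with
  | id t => exact .id hA t
  | comp _ _ h h' => exact h.comp h'
  | inv φ _ h => exact h.inv φ
  | mapC _ _ h h' => exact .mapC hA h h'
  | mapO _ _ h h' => exact .mapO hA h h'
  | mapF _ h => exact .mapF hA h
  | αC s t r =>
    exact Lift.substitute hA PaPB.alphaC (fun i => match i with | 0 => s | 1 => t | 2 => r) rfl rfl
      (hA.alphaC _) (Braid.cable_one _)
  | αO s t r =>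
    exact Lift.substitute hA PaPB.alphaO (fun i => match i with | 0 => s | 1 => t | 2 => r) rfl rfl
      (hA.alphaO _) (Braid.cable_one _)
  | μ s t =>
    exact Lift.substitute hA PaPB.p (fun i => match i with | 0 => s | 1 => t) rfl rfl
      (hA.p _) (Braid.cable_one _)
  | τ s t =>
    exact Lift.substitute hA PaPB.tau (fun i => match i with | 0 => s | 1 => t) rfl rfl
      (hA.tau _) (cross _)
  | ψ s t =>
    exact Lift.substitute hA PaPB.psi (fun i => match i with | 0 => s | 1 => t) rfl rfl
      (hA.psi _) (cross _)

/-- The values of an algebra are determined by its values on the generators. -/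
theorem Matches.val_heq {A} {D : GenData M N} (hA : Matches A D) {I : Type} [Finite I]
    {κ : I → Color} {X : ∀ i, carrier M N (κ i)} {full : Prop} {d : Color} {x y : PaPBObj κ d}
    (f : x ⟶ y) {P Q : carrier M N d} {φ : P ⟶ Q}
    (h : D.Rel full X x.term y.term f.braid φ) : A.val f X ≍ φ := by
  obtain ⟨J, hJ, e, s, s', g, hs, hs', hb, -, -, hφ⟩ := hA.lift h
  obtain ⟨ε, rfl⟩ := PaPBObj.exists_equiv hs
  obtain rfl : s.relabel ε κ = x := PaPBObj.ext hs
  obtain rfl : s'.relabel ε κ = y := PaPBObj.ext hs'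
  exact (val_relabel A ε hb.symm X).trans hφ

/-- An algebra is determined by its values on the generators. -/
theorem Matches.unique {A A' : PaPBAlgebra M N} {D : GenData M N} (hA : Matches A D)
    (hA' : Matches A' D) : A = A' := by
  have happ : @A.app = @A'.app := by
    funext I hI κ d
    refine Functor.hext (fun x => (hA.obj_eq x).trans (hA'.obj_eq x).symm) fun x y f => ?_
    refine NatTrans.heq_of_app ((hA.obj_eq x).trans (hA'.obj_eq x).symm)
      ((hA.obj_eq y).trans (hA'.obj_eq y).symm) fun X => ?_
    obtain ⟨φ, hφ⟩ := D.conn_of_bicolored X (PaPBObj.Hom.bicolored f)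
    exact (hA.val_heq f hφ).trans (hA'.val_heq f hφ).symm
  cases A
  cases A'
  cases happ
  rfl

end GenData

theorem Corresponds.matches {M N : Type u} [Category.{v} M] [Category.{v} N]
    [SemigroupalCategory N] [SemigroupalCategory M] [SemigroupalCategory.Braiding M]
    {A : PaPBAlgebra M N}
    {F : SemigroupalCategory.StrongBraidedFunctor M (SemigroupalCategory.Center N)}
    (h : Corresponds A F) : GenData.Matches A (GenData.ofFunctor F) where
  muC := h.muC
  muO := h.muO
  fObj := h.fObj
  alphaC := h.alphaC
  alphaO := h.alphaO
  tau := h.tau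
  p := h.p
  psi := h.psi

/-! ### The values of a given algebra on the generators -/

theorem CategoryTheory.NatTrans.naturality_of_eq {C D : Type*} [Category* C] [Category* D]
    {F G F' G' : C ⥤ D} (hF : F = F') (hG : G = G') (α : F ⟶ G) {X Y : C} (g : X ⟶ Y)
    {φ : F'.obj X ⟶ G'.obj X} {ψ : F'.obj Y ⟶ G'.obj Y} (hφ : α.app X ≍ φ) (hψ : α.app Y ≍ ψ) :
    F'.map g ≫ ψ = φ ≫ G'.map g := by
  subst hF hG
  obtain rfl := eq_of_heq hφ
  obtain rfl := eq_of_heq hψ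
  exact α.naturality g

theorem CategoryTheory.Iso.exists_heq {C : Type*} [Category* C] {X Y X' Y' : C} (hX : X = X')
    (hY : Y = Y') (e : X ≅ Y) : ∃ e' : X' ≅ Y', e.hom ≍ e'.hom := by
  subst hX hY
  exact ⟨e, HEq.rfl⟩

namespace carrier

variable {M N : Type u} [Category.{v} M] [Category.{v} N]

/-- The family of two objects. -/
def pair {κ : Fin 2 → Color} (X : carrier M N (κ 0)) (Y : carrier M N (κ 1)) :
    ∀ i, carrier M N (κ i)
  | 0 => X
  | 1 => Y

/-- The family of two morphisms. -/
def pairMap {κ : Fin 2 → Color} {X X' : carrier M N (κ 0)} {Y Y' : carrier M N (κ 1)}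
    (f : X ⟶ X') (g : Y ⟶ Y') : pair X Y ⟶ pair X' Y'
  | 0 => f
  | 1 => g

theorem pairMap_eta {κ : Fin 2 → Color} {X X' : carrier M N (κ 0)} {Y Y' : carrier M N (κ 1)}
    (f : pair X Y ⟶ pair X' Y') : pairMap (f 0) (f 1) = f :=
  funext fun i => match i with | 0 => rfl | 1 => rfl

theorem pairMap_id {κ : Fin 2 → Color} (X : carrier M N (κ 0)) (Y : carrier M N (κ 1)) :
    pairMap (𝟙 X) (𝟙 Y) = 𝟙 (pair X Y) :=
  pairMap_eta (𝟙 (pair X Y))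

theorem pairMap_comp {κ : Fin 2 → Color} {X X' X'' : carrier M N (κ 0)}
    {Y Y' Y'' : carrier M N (κ 1)} (f : X ⟶ X') (g : Y ⟶ Y') (f' : X' ⟶ X'') (g' : Y' ⟶ Y'') :
    pairMap (f ≫ f') (g ≫ g') = pairMap f g ≫ pairMap f' g' :=
  pairMap_eta (pairMap f g ≫ pairMap f' g')

/-- The family of three objects. -/
def triple {κ : Fin 3 → Color} (X : carrier M N (κ 0)) (Y : carrier M N (κ 1))
    (Z : carrier M N (κ 2)) : ∀ i, carrier M N (κ i)
  | 0 => X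
  | 1 => Y
  | 2 => Z

/-- The family of three morphisms. -/
def tripleMap {κ : Fin 3 → Color} {X X' : carrier M N (κ 0)} {Y Y' : carrier M N (κ 1)}
    {Z Z' : carrier M N (κ 2)} (f : X ⟶ X') (g : Y ⟶ Y') (h : Z ⟶ Z') :
    triple X Y Z ⟶ triple X' Y' Z'
  | 0 => f
  | 1 => g
  | 2 => h

/-- The family of four objects. -/
def quadruple {κ : Fin 4 → Color} (W : carrier M N (κ 0)) (X : carrier M N (κ 1))
    (Y : carrier M N (κ 2)) (Z : carrier M N (κ 3)) : ∀ i, carrier M N (κ i)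
  | 0 => W
  | 1 => X
  | 2 => Y
  | 3 => Z

theorem exists_pair (M N : Type u) {κ : Fin 2 → Color} (X : ∀ i, carrier M N (κ i)) :
    ∃ Y Z, X = pair Y Z :=
  ⟨X 0, X 1, funext fun i => match i with | 0 => rfl | 1 => rfl⟩

theorem exists_triple (M N : Type u) {κ : Fin 3 → Color} (X : ∀ i, carrier M N (κ i)) :
    ∃ Y Z W, X = triple Y Z W :=
  ⟨X 0, X 1, X 2, funext fun i => match i with | 0 => rfl | 1 => rfl | 2 => rfl⟩

end carrier

namespace PaPBAlgebra

open carrier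

variable {M N : Type u} [Category.{v} M] [Category.{v} N] (A : PaPBAlgebra M N)

/-- The values of an algebra on the generating objects. -/
def genFunctors : GenFunctors M N where
  mulC X Y := ((A.app PaPB.cc .closed).obj PaPB.muC).obj (pair X Y)
  mapC f g := ((A.app PaPB.cc .closed).obj PaPB.muC).map (pairMap (κ := PaPB.cc) f g)
  mapC_id X Y := (congrArg _ (pairMap_id (κ := PaPB.cc) X Y)).trans
    (CategoryTheory.Functor.map_id ((A.app PaPB.cc .closed).obj PaPB.muC) _)
  mapC_comp f g f' g' := (congrArg _ (pairMap_comp (κ := PaPB.cc) f g f' g')).trans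
    (Functor.map_comp ((A.app PaPB.cc .closed).obj PaPB.muC) _ _)
  mulO X Y := ((A.app PaPB.oo .opened).obj PaPB.muO).obj (pair X Y)
  mapO f g := ((A.app PaPB.oo .opened).obj PaPB.muO).map (pairMap (κ := PaPB.oo) f g)
  mapO_id X Y := (congrArg _ (pairMap_id (κ := PaPB.oo) X Y)).trans
    (CategoryTheory.Functor.map_id ((A.app PaPB.oo .opened).obj PaPB.muO) _)
  mapO_comp f g f' g' := (congrArg _ (pairMap_comp (κ := PaPB.oo) f g f' g')).trans
    (Functor.map_comp ((A.app PaPB.oo .opened).obj PaPB.muO) _ _)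
  F :=
    { obj := fun X => ((A.app PaPB.c .opened).obj PaPB.fObj).obj fun _ => X
      map := fun f => ((A.app PaPB.c .opened).obj PaPB.fObj).map fun _ => f
      map_id := fun _ => CategoryTheory.Functor.map_id ((A.app PaPB.c .opened).obj PaPB.fObj) _
      map_comp := fun _ _ => Functor.map_comp ((A.app PaPB.c .opened).obj PaPB.fObj) _ _ }

theorem matches_genFunctors : A.genFunctors.Matches A where
  muC := by
    refine Functor.hext (fun X => ?_) fun X Y g => ?_
    · obtain ⟨X, X', rfl⟩ := exists_pair M N (κ := PaPB.cc) X
      rfl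
    · obtain ⟨X, X', rfl⟩ := exists_pair M N (κ := PaPB.cc) X
      obtain ⟨Y, Y', rfl⟩ := exists_pair M N (κ := PaPB.cc) Y
      exact heq_of_eq (congrArg _ (pairMap_eta (κ := PaPB.cc) g).symm)
  muO := by
    refine Functor.hext (fun X => ?_) fun X Y g => ?_
    · obtain ⟨X, X', rfl⟩ := exists_pair M N (κ := PaPB.oo) X
      rfl
    · obtain ⟨X, X', rfl⟩ := exists_pair M N (κ := PaPB.oo) X
      obtain ⟨Y, Y', rfl⟩ := exists_pair M N (κ := PaPB.oo) Y
      exact heq_of_eq (congrArg _ (pairMap_eta (κ := PaPB.oo) g).symm)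
  fObj := by
    refine Functor.hext (fun X => ?_) fun X Y g => ?_
    · obtain ⟨X, rfl⟩ : ∃ Y : M, X = fun _ => Y :=
        ⟨X 0, funext fun i => by rw [Subsingleton.elim i 0]⟩
      rfl
    · obtain ⟨X, rfl⟩ : ∃ Y : M, X = fun _ => Y :=
        ⟨X 0, funext fun i => by rw [Subsingleton.elim i 0]⟩
      obtain ⟨Y, rfl⟩ : ∃ Z : M, Y = fun _ => Z :=
        ⟨Y 0, funext fun i => by rw [Subsingleton.elim i 0]⟩
      obtain ⟨g, rfl⟩ : ∃ h : X ⟶ Y, g = fun _ => h :=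
        ⟨g 0, funext fun i => by rw [Subsingleton.elim i 0]⟩
      rfl

/-- The value of an algebra on a morphism of `PaPB`, with the expected endpoints. -/
theorem exists_iso {I : Type} [Finite I] {κ : I → Color} {d : Color} {x y : PaPBObj κ d}
    (f : x ⟶ y) (X : ∀ i, carrier M N (κ i)) :
    ∃ e : A.genFunctors.obj x.term X ≅ A.genFunctors.obj y.term X, A.val f X ≍ e.hom :=
  Iso.exists_heq (Functor.congr_obj (A.matches_genFunctors.obj_eq x) X)
    (Functor.congr_obj (A.matches_genFunctors.obj_eq y) X)
    (Iso.app ((A.app κ d).mapIso ((Groupoid.isoEquivHom x y).symm f)) X)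

/-- The values of an algebra on the generators. -/
noncomputable def genData : GenData M N where
  toGenFunctors := A.genFunctors
  αC X Y Z := (A.exists_iso PaPB.alphaC (triple (κ := PaPB.ccc) X Y Z)).choose
  αO X Y Z := (A.exists_iso PaPB.alphaO (triple (κ := PaPB.ooo) X Y Z)).choose
  μ X Y := (A.exists_iso PaPB.p (pair (κ := PaPB.cc) X Y)).choose
  τ X Y := (A.exists_iso PaPB.tau (pair (κ := PaPB.cc) X Y)).choose
  ψ X Y := (A.exists_iso PaPB.psi (pair (κ := PaPB.co) X Y)).choose

theorem matches_genData : A.genData.Matches A where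
  toMatches := A.matches_genFunctors
  alphaC X := by
    obtain ⟨X, Y, Z, rfl⟩ := exists_triple M N (κ := PaPB.ccc) X
    exact (A.exists_iso PaPB.alphaC _).choose_spec
  alphaO X := by
    obtain ⟨X, Y, Z, rfl⟩ := exists_triple M N (κ := PaPB.ooo) X
    exact (A.exists_iso PaPB.alphaO _).choose_spec
  p X := by
    obtain ⟨X, Y, rfl⟩ := exists_pair M N (κ := PaPB.cc) X
    exact (A.exists_iso PaPB.p _).choose_spec
  tau X := by
    obtain ⟨X, Y, rfl⟩ := exists_pair M N (κ := PaPB.cc) X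
    exact (A.exists_iso PaPB.tau _).choose_spec
  psi X := by
    obtain ⟨X, Y, rfl⟩ := exists_pair M N (κ := PaPB.co) X
    exact (A.exists_iso PaPB.psi _).choose_spec

end PaPBAlgebra

/-! ### The monoidal structures of an algebra -/

namespace GenData.Matches

open carrier

variable {M N : Type u} [Category.{v} M] [Category.{v} N] {A : PaPBAlgebra M N} {D : GenData M N}

/-- The naturality of the values of an algebra, in terms of the values on the generators. -/
theorem natural (hA : D.Matches A) {I : Type} [Finite I] {κ : I → Color} {d : Color}
    {x y : PaPBObj κ d} (f : x ⟶ y) {X Y : ∀ i, carrier M N (κ i)} (g : X ⟶ Y)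
    {φ : D.obj x.term X ⟶ D.obj y.term X} {ψ : D.obj x.term Y ⟶ D.obj y.term Y}
    (hφ : A.val f X ≍ φ) (hψ : A.val f Y ≍ ψ) :
    D.map x.term g ≫ ψ = φ ≫ D.map y.term g :=
  NatTrans.naturality_of_eq (hA.obj_eq x) (hA.obj_eq y) ((A.app κ d).map f) g hφ hψ

/-- Two composites of the values on the generators agree if they come from the same morphism of
`PaPB`; this presupposes that each input occurs exactly once. -/
theorem coherence (hA : D.Matches A) {I : Type} [Finite I] {κ : I → Color}
    {X : ∀ i, carrier M N (κ i)} {d : Color} {t t' : Term κ d} {b b' : Braid}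
    {P Q : carrier M N d} {φ φ' : P ⟶ Q} (h : D.Rel True X t t' b φ)
    (h' : D.Rel True X t t' b' φ') (ht : t.word.Nodup ∧ ∀ i, i ∈ t.word)
    (ht' : t'.word.Nodup ∧ ∀ i, i ∈ t'.word) (hb : b = b') : φ = φ' := by
  subst hb
  let f : (⟨t, ht.1, ht.2⟩ : PaPBObj κ d) ⟶ ⟨t', ht'.1, ht'.2⟩ := ⟨b, h.bicolored⟩
  exact eq_of_heq ((hA.val_heq f h).symm.trans (hA.val_heq f h'))

open SemigroupalCategory

/-- The non-unital monoidal structure of `N` given by an algebra. -/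
abbrev monoidalN (hA : D.Matches A) : SemigroupalCategory N where
  tensorObj := D.mulO
  tensorHom := D.mapO
  tensor_id := D.mapO_id
  tensor_comp := D.mapO_comp
  assoc := D.αO
  assoc_naturality f₁ f₂ f₃ := hA.natural PaPB.alphaO (tripleMap (κ := PaPB.ooo) f₁ f₂ f₃)
    (hA.alphaO _) (hA.alphaO _)
  pentagon W X Y Z := by
    let w := Term.leaf (κ := fun _ : Fin 4 => .opened) 0
    let x := Term.leaf (κ := fun _ : Fin 4 => .opened) 1
    let y := Term.leaf (κ := fun _ : Fin 4 => .opened) 2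
    let z := Term.leaf (κ := fun _ : Fin 4 => .opened) 3
    exact hA.coherence (X := quadruple W X Y Z)
      ((Rel.mapO (.αO w x y) (.id z)).comp ((Rel.αO w (.mulO x y) z).comp
        (.mapO (.id w) (.αO x y z))))
      ((Rel.αO (.mulO w x) y z).comp (.αO w x (.mulO y z))) (by decide) (by decide) (by simp)

/-- The non-unital monoidal structure of `M` given by an algebra. -/
abbrev monoidalM (hA : D.Matches A) : SemigroupalCategory M where
  tensorObj := D.mulC
  tensorHom := D.mapC
  tensor_id := D.mapC_id
  tensor_comp := D.mapC_comp
  assoc := D.αC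
  assoc_naturality f₁ f₂ f₃ := hA.natural PaPB.alphaC (tripleMap (κ := PaPB.ccc) f₁ f₂ f₃)
    (hA.alphaC _) (hA.alphaC _)
  pentagon W X Y Z := by
    let w := Term.leaf (κ := fun _ : Fin 4 => .closed) 0
    let x := Term.leaf (κ := fun _ : Fin 4 => .closed) 1
    let y := Term.leaf (κ := fun _ : Fin 4 => .closed) 2
    let z := Term.leaf (κ := fun _ : Fin 4 => .closed) 3
    exact hA.coherence (X := quadruple W X Y Z)
      ((Rel.mapC (.αC w x y) (.id z)).comp ((Rel.αC w (.mulC x y) z).comp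
        (.mapC (.id w) (.αC x y z))))
      ((Rel.αC (.mulC w x) y z).comp (.αC w x (.mulC y z))) (by decide) (by decide) (by simp)

/-- The braiding of `M` given by an algebra. -/
abbrev braidingM (hA : D.Matches A) : @Braiding M _ hA.monoidalM :=
  letI := hA.monoidalM
  { braid := D.τ
    braid_naturality := fun f g => hA.natural PaPB.tau (pairMap (κ := PaPB.cc) f g)
      (hA.tau _) (hA.tau _)
    hexagon_forward := fun X Y Z => by
      let x := Term.leaf (κ := PaPB.ccc) 0
      let y := Term.leaf (κ := PaPB.ccc) 1
      let z := Term.leaf (κ := PaPB.ccc) 2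
      refine hA.coherence (X := triple X Y Z)
        ((Rel.αC x y z).comp ((Rel.τ x (.mulC y z) (.inl trivial)).comp (.αC y z x)))
        ((Rel.mapC (.τ x y (.inl trivial)) (.id z)).comp ((Rel.αC y x z).comp
          (.mapC (.id y) (.τ x z (.inl trivial))))) (by decide) (by decide) ?_
      simp [x, y, z, Term.word, Braid.blockCross, Braid.strandCross, Braid.shift_σ,
        Braid.shift_zero]
    hexagon_reverse := fun X Y Z => by
      let x := Term.leaf (κ := PaPB.ccc) 0
      let y := Term.leaf (κ := PaPB.ccc) 1
      let z := Term.leaf (κ := PaPB.ccc) 2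
      refine hA.coherence (X := triple X Y Z)
        ((Rel.inv _ (.αC x y z)).comp ((Rel.τ (.mulC x y) z (.inl trivial)).comp
          (.inv _ (.αC z x y))))
        ((Rel.mapC (.id x) (.τ y z (.inl trivial))).comp ((Rel.inv _ (.αC x z y)).comp
          (.mapC (.τ x z (.inl trivial)) (.id y)))) (by decide) (by decide) ?_
      simp [x, y, z, Term.word, Braid.blockCross, Braid.strandCross, Braid.shift_σ] }

end GenData.Matches

/-! ### The central functor of an algebra -/

namespace GenData.Matches

open SemigroupalCategory carrier

variable {M N : Type u} [Category.{v} M] [Category.{v} N] {A : PaPBAlgebra M N} {D : GenData M N}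

theorem psi_naturality (hA : D.Matches A) {X X' : M} {Y Y' : N} (f : X ⟶ X') (g : Y ⟶ Y') :
    D.mapO (D.F.map f) g ≫ (D.ψ X' Y').hom = (D.ψ X Y).hom ≫ D.mapO g (D.F.map f) :=
  hA.natural PaPB.psi (pairMap (κ := PaPB.co) f g) (hA.psi _) (hA.psi _)

/-- The half-braiding of `F(X)` given by an algebra. -/
abbrev center (hA : D.Matches A) (X : M) : @Center N _ hA.monoidalN :=
  letI := hA.monoidalN
  { obj := D.F.obj X
    half :=
      { β := D.ψ X
        naturality := fun f => by
          have := hA.psi_naturality (𝟙 X) f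
          rwa [D.F.map_id] at this
        hexagon := fun Y Z => by
          let x := Term.leaf (κ := ![.closed, .opened, .opened]) 0
          let y := Term.leaf (κ := ![.closed, .opened, .opened]) 1
          let z := Term.leaf (κ := ![.closed, .opened, .opened]) 2
          refine hA.coherence (X := triple X Y Z)
            ((Rel.αO (.f x) y z).comp ((Rel.ψ x (.mulO y z) (.inl trivial)).comp (.αO y z (.f x))))
            ((Rel.mapO (.ψ x y (.inl trivial)) (.id z)).comp ((Rel.αO y (.f x) z).comp
              (.mapO (.id y) (.ψ x z (.inl trivial))))) (by decide) (by decide) ?_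
          simp [x, y, z, Term.word, Braid.blockCross, Braid.strandCross, Braid.shift_σ,
            Braid.shift_zero] } }

/-- The strong braided monoidal functor to the Drinfeld center given by an algebra. -/
abbrev functor (hA : D.Matches A) :
    letI := hA.monoidalN; letI := hA.monoidalM; letI := hA.braidingM;
    StrongBraidedFunctor M (Center N) :=
  letI := hA.monoidalN
  letI := hA.monoidalM
  letI := hA.braidingM
  { obj := hA.center
    map := fun f => ⟨D.F.map f, fun Z => hA.psi_naturality f (𝟙 Z)⟩
    map_id := fun X => Center.hom_ext (D.F.map_id X)
    map_comp := fun f g => Center.hom_ext (D.F.map_comp f g)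
    μ := fun X Y => Center.mkIso (X := hA.center X ⊠ hA.center Y) (Y := hA.center (X ⊠ Y)) (D.μ X Y)
      fun Z => by
        let x := Term.leaf (κ := ![.closed, .closed, .opened]) 0
        let y := Term.leaf (κ := ![.closed, .closed, .opened]) 1
        let z := Term.leaf (κ := ![.closed, .closed, .opened]) 2
        refine hA.coherence (X := triple X Y Z)
          ((Rel.mapO (.μ x y) (.id z)).comp (.ψ (.mulC x y) z (.inl trivial)))
          (((Rel.αO (.f x) (.f y) z).comp ((Rel.mapO (.id (.f x)) (.ψ y z (.inl trivial))).comp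
            ((Rel.inv _ (.αO (.f x) z (.f y))).comp ((Rel.mapO (.ψ x z (.inl trivial))
              (.id (.f y))).comp (.αO z (.f x) (.f y)))))).comp (.mapO (.id z) (.μ x y)))
          (by decide) (by decide) ?_
        simp [x, y, z, Term.word, Braid.blockCross, Braid.strandCross, Braid.shift_σ]
    μ_naturality := fun f g => Center.hom_ext
      (hA.natural PaPB.p (pairMap (κ := PaPB.cc) f g) (hA.p _) (hA.p _))
    associativity := fun X Y Z => Center.hom_ext <| by
      let x := Term.leaf (κ := PaPB.ccc) 0
      let y := Term.leaf (κ := PaPB.ccc) 1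
      let z := Term.leaf (κ := PaPB.ccc) 2
      exact hA.coherence (X := triple X Y Z)
        ((Rel.mapO (.μ x y) (.id (.f z))).comp ((Rel.μ (.mulC x y) z).comp (.mapF (.αC x y z))))
        ((Rel.αO (.f x) (.f y) (.f z)).comp ((Rel.mapO (.id (.f x)) (.μ y z)).comp
          (.μ x (.mulC y z)))) (by decide) (by decide) (by simp)
    braided := fun X Y => Center.hom_ext <| by
      let x := Term.leaf (κ := PaPB.cc) 0
      let y := Term.leaf (κ := PaPB.cc) 1
      exact hA.coherence (X := pair X Y)
        ((Rel.μ x y).comp (.mapF (.τ x y (.inl trivial))))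
        ((Rel.ψ x (.f y) (.inl trivial)).comp (.μ y x)) (by decide) (by decide) (by simp; rfl) }

/-- The central functor given by an algebra. -/
abbrev centralTriple (hA : D.Matches A) : CentralTriple M N :=
  letI := hA.monoidalN
  letI := hA.monoidalM
  letI := hA.braidingM
  { F := hA.functor }

theorem correspondsTo_centralTriple (hA : D.Matches A) : hA.centralTriple.CorrespondsTo A :=
  letI := hA.monoidalN
  letI := hA.monoidalM
  letI := hA.braidingM
  show Corresponds A hA.functor from
  { muC := hA.muC
    muO := hA.muO
    fObj := hA.fObj
    alphaC := hA.alphaC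
    alphaO := hA.alphaO
    tau := hA.tau
    p := hA.p
    psi := hA.psi }

end GenData.Matches

/-! ### Central functors are determined by the corresponding algebra -/

namespace SemigroupalCategory

theorem ext_of_tensorFunctor {C : Type u} [Category.{v} C] {S S' : SemigroupalCategory C}
    (h : @tensorFunctor C _ S = @tensorFunctor C _ S')
    (ha : ∀ X Y Z, (S.assoc X Y Z).hom ≍ (S'.assoc X Y Z).hom) : S = S' := by
  have hobj (X Y : C) : S.tensorObj X Y = S'.tensorObj X Y :=
    Functor.congr_obj h fun i => match i with | 0 => X | 1 => Y
  have hmap {X X' Y Y' : C} (f : X ⟶ X') (g : Y ⟶ Y') : S.tensorHom f g ≍ S'.tensorHom f g :=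
    Functor.hcongr_hom (X := fun i : Fin 2 => match i with | 0 => X | 1 => Y)
      (Y := fun i : Fin 2 => match i with | 0 => X' | 1 => Y') h
      fun i => match i with | 0 => f | 1 => g
  obtain ⟨obj, map, _, _, a, _, _⟩ := S
  obtain ⟨obj', map', _, _, a', _, _⟩ := S'
  obtain rfl : obj = obj' := funext fun X => funext fun Y => hobj X Y
  obtain rfl : @map = @map' := by
    funext X X' Y Y' f g
    exact eq_of_heq (hmap f g)
  obtain rfl : a = a' := by
    funext X Y Z
    exact Iso.ext (eq_of_heq (ha X Y Z))
  rfl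

theorem Braiding.ext_of_heq {C : Type u} [Category.{v} C] [SemigroupalCategory C]
    {b b' : Braiding C} (h : ∀ X Y, (b.braid X Y).hom ≍ (b'.braid X Y).hom) : b = b' := by
  obtain ⟨b, _, _, _⟩ := b
  obtain ⟨b', _, _, _⟩ := b'
  obtain rfl : b = b' := by
    funext X Y
    exact Iso.ext (eq_of_heq (h X Y))
  rfl

namespace Center

variable {C : Type u} [Category.{v} C] [SemigroupalCategory C]

theorem ext_of_heq {X Y : Center C} (h : X.obj = Y.obj)
    (hβ : ∀ Z, (X.half.β Z).hom ≍ (Y.half.β Z).hom) : X = Y := by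
  obtain ⟨X, b⟩ := X
  obtain ⟨Y, b'⟩ := Y
  obtain rfl : X = Y := h
  obtain rfl : b = b' := HalfBraiding.ext (funext fun Z => Iso.ext (eq_of_heq (hβ Z)))
  rfl

theorem hom_heq {X Y X' Y' : Center C} (hX : X = X') (hY : Y = Y') {f : X ⟶ Y} {g : X' ⟶ Y'}
    (h : f.hom ≍ g.hom) : f ≍ g := by
  subst hX hY
  exact heq_of_eq (hom_ext (eq_of_heq h))

end Center

theorem StrongBraidedFunctor.ext_of_heq {C D : Type*} [Category* C] [SemigroupalCategory C]
    [Braiding C] [Category* D] [SemigroupalCategory D] [Braiding D]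
    {F G : StrongBraidedFunctor C D} (h : F.toFunctor = G.toFunctor)
    (hμ : ∀ X Y, (F.μ X Y).hom ≍ (G.μ X Y).hom) : F = G := by
  obtain ⟨F, m, _, _, _⟩ := F
  obtain ⟨G, m', _, _, _⟩ := G
  obtain rfl : F = G := h
  obtain rfl : m = m' := by
    funext X Y
    exact Iso.ext (eq_of_heq (hμ X Y))
  rfl

end SemigroupalCategory

namespace CentralTriple.CorrespondsTo

open SemigroupalCategory carrier

variable {M N : Type u} [Category.{v} M] [Category.{v} N] {A : PaPBAlgebra M N}
  {T T' : CentralTriple M N}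

theorem tensorFunctors (h : T.CorrespondsTo A) :
    (A.app PaPB.oo .opened).obj PaPB.muO = @tensorFunctor N _ T.monoidalN ∧
      (A.app PaPB.cc .closed).obj PaPB.muC = @tensorFunctor M _ T.monoidalM :=
  let := T.monoidalN
  let := T.monoidalM
  let := T.braidingM
  ⟨Corresponds.muO h, Corresponds.muC h⟩

theorem assoc_heq (h : T.CorrespondsTo A) :
    (∀ X Y Z : N, A.val PaPB.alphaO (triple (κ := PaPB.ooo) X Y Z) ≍
      (T.monoidalN.assoc X Y Z).hom) ∧
    ∀ X Y Z : M, A.val PaPB.alphaC (triple (κ := PaPB.ccc) X Y Z) ≍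
      (T.monoidalM.assoc X Y Z).hom :=
  let := T.monoidalN
  let := T.monoidalM
  let := T.braidingM
  ⟨fun _ _ _ => Corresponds.alphaO h _, fun _ _ _ => Corresponds.alphaC h _⟩

theorem braid_heq (h : T.CorrespondsTo A) (X Y : M) :
    A.val PaPB.tau (pair (κ := PaPB.cc) X Y) ≍
      (@Braiding.braid M _ T.monoidalM T.braidingM X Y).hom :=
  let := T.monoidalN
  let := T.monoidalM
  let := T.braidingM
  Corresponds.tau h _

/-- An algebra determines the corresponding triple. -/
theorem unique (h : T.CorrespondsTo A) (h' : T'.CorrespondsTo A) : T = T' := by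
  have hT := h.tensorFunctors
  have hT' := h'.tensorFunctors
  have hα := h.assoc_heq
  have hα' := h'.assoc_heq
  have hβ := h.braid_heq
  have hβ' := h'.braid_heq
  obtain ⟨F⟩ := T
  obtain ⟨F'⟩ := T'
  rename_i SN SM B SN' SM' B'
  obtain rfl : SN = SN' := ext_of_tensorFunctor (hT.1.symm.trans hT'.1) fun X Y Z =>
    (hα.1 X Y Z).symm.trans (hα'.1 X Y Z)
  obtain rfl : SM = SM' := ext_of_tensorFunctor (hT.2.symm.trans hT'.2) fun X Y Z =>
    (hα.2 X Y Z).symm.trans (hα'.2 X Y Z)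
  obtain rfl : B = B' := Braiding.ext_of_heq fun X Y => (hβ X Y).symm.trans (hβ' X Y)
  have hF := h.fObj.symm.trans h'.fObj
  have hobj (X : M) : F.obj X = F'.obj X := by
    refine Center.ext_of_heq (Functor.congr_obj hF fun _ => X) fun Z => ?_
    exact (h.psi (pair (κ := PaPB.co) X Z)).symm.trans (h'.psi (pair (κ := PaPB.co) X Z))
  obtain rfl : F = F' := by
    refine StrongBraidedFunctor.ext_of_heq (Functor.hext hobj fun X Y f => ?_) fun X Y => ?_
    · exact Center.hom_heq (hobj X) (hobj Y) (Functor.hcongr_hom hF (X := fun _ => X)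
        (Y := fun _ => Y) fun _ => f)
    · refine Center.hom_heq (congrArg₂ _ (hobj X) (hobj Y)) (hobj _) ?_
      exact (h.p (pair (N := N) (κ := PaPB.cc) X Y)).symm.trans (h'.p _)
  rfl

end CentralTriple.CorrespondsTo

/-! ### The correspondence -/

theorem mainTheorem2 (M N : Type u) [Category.{v} M] [Category.{v} N] :
    ∃ e : PaPBAlgebra M N ≃ CentralTriple M N,
      ∀ (A : PaPBAlgebra M N) (T : CentralTriple M N), e A = T ↔ T.CorrespondsTo A := by
  let e (A : PaPBAlgebra M N) : CentralTriple M N := A.matches_genData.centralTriple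
  have he (A : PaPBAlgebra M N) : (e A).CorrespondsTo A :=
    A.matches_genData.correspondsTo_centralTriple
  have iff (A : PaPBAlgebra M N) (T : CentralTriple M N) : e A = T ↔ T.CorrespondsTo A :=
    ⟨fun h => h ▸ he A, fun h => (he A).unique h⟩
  refine ⟨Equiv.ofBijective e ⟨fun A A' h => ?_, fun T => ?_⟩, iff⟩
  · have h₁ := he A
    rw [h] at h₁
    let := (e A').monoidalN
    let := (e A').monoidalM
    let := (e A').braidingM
    exact (Corresponds.matches h₁).unique (Corresponds.matches (he A'))
  · let := T.monoidalN
    let := T.monoidalM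
    let := T.braidingM
    exact ⟨GenData.algebra T.F, (iff _ T).2 (GenData.corresponds_algebra T.F)⟩
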